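/- Let $q\ge 2$ and $\varepsilon\in(0,1)$. There is a number $C=C(q,\varepsilon)>0$ such that the following holds. Let $\Omega$ be a topological space with a Borel probability measure $\mu$ (for example, a compact subset of $\mathbb R^d$ with a Borel probability measure), let $N$ be a non-negative integer, and let $X_N$ be a linear space of continuous real-valued (or complex-valued) functions on $\Omega$ with finite norm $\|f\|_q=\left(\int_\Omega |f|^q\,d\mu\right)^{1/q}$, spanned by $N$ functions (so that $\dim X_N\le N$). Then for every integer $m\ge 1$ with $$m\ge C\,N^{q/2}(\log N)^{2-2/q}$$ (where the right-hand side is read as $0$ if $N=0$) one has $X_N\in\mathcal M^w(m,q,\varepsilon)$, that is, there exist points $\xi^1,\dots,\xi^m\in\Omega$ (not necessarily distinct) and weights $\lambda_1,\dots,\lambda_m\in\mathbb R$ such that $$(1-\varepsilon)\|f\|_q^q\le\sum_{\nu=1}^m\lambda_\nu|f(\xi^\nu)|^q\le(1+\varepsilon)\|f\|_q^q\qquad\text{for all } f\in X_N .$$ -/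

import Mathlib

open MeasureTheory

noncomputable section

/-- The weighted Marcinkiewicz-type discretization theorem with parameters `m`, `q` and constants
`C₁`, `C₂` for a linear space `X` of functions on `Ω`: there are knots `ξ ν` and real
weights `lam ν`, `ν = 1, …, m`, with
`C₁ ‖f‖_q ^ q ≤ ∑ ν, lam ν * |f (ξ ν)| ^ q ≤ C₂ ‖f‖_q ^ q` for all `f ∈ X`, where `‖·‖_q` is the
norm of `L_q(Ω, μ)`. Knots may coincide and weights may have any sign. -/
def WeightedMarcinkiewicz {𝕜 : Type*} [RCLike 𝕜] {Ω : Type*} [MeasurableSpace Ω]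
    (μ : Measure Ω) (X : Submodule 𝕜 (Ω → 𝕜)) (m : ℕ) (q C₁ C₂ : ℝ) : Prop :=
  ∃ (ξ : Fin m → Ω) (lam : Fin m → ℝ), ∀ f ∈ X,
    C₁ * lpNorm f (ENNReal.ofReal q) μ ^ q ≤ ∑ ν, lam ν * ‖f (ξ ν)‖ ^ q ∧
    ∑ ν, lam ν * ‖f (ξ ν)‖ ^ q ≤ C₂ * lpNorm f (ENNReal.ofReal q) μ ^ q

/-- `X ∈ M^w(m, q, ε)`: the weighted discretization theorem holds with `C₁ = 1 - ε` and
`C₂ = 1 + ε`. -/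
def WeightedMarcinkiewiczEps {𝕜 : Type*} [RCLike 𝕜] {Ω : Type*} [MeasurableSpace Ω]
    (μ : Measure Ω) (X : Submodule 𝕜 (Ω → 𝕜)) (m : ℕ) (q ε : ℝ) : Prop :=
  WeightedMarcinkiewicz μ X m q (1 - ε) (1 + ε)

/-- The linear space `L_q(Ω, μ) ∩ C(Ω)` of continuous functions (not classes of functions) with
finite `L_q` norm. -/
def continuousLq (𝕜 : Type*) [RCLike 𝕜] {Ω : Type*} [TopologicalSpace Ω] [MeasurableSpace Ω]
    (μ : Measure Ω) (q : ℝ) : Submodule 𝕜 (Ω → 𝕜) where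
  carrier := {f | Continuous f ∧ MemLp f (ENNReal.ofReal q) μ}
  add_mem' := fun hf hg => ⟨hf.1.add hg.1, hf.2.add hg.2⟩
  zero_mem' := ⟨continuous_const, MemLp.zero⟩
  smul_mem' := fun c _ hf => ⟨hf.1.const_smul c, hf.2.const_smul c⟩

/-- `X` is spanned by `N` functions, i.e. it is finite-dimensional of dimension at most `N`. -/
def SpannedBy {𝕜 : Type*} [RCLike 𝕜] {Ω : Type*} (X : Submodule 𝕜 (Ω → 𝕜)) (N : ℕ) : Prop :=
  ∃ u : Fin N → Ω → 𝕜, X = Submodule.span 𝕜 (Set.range u)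

end

/-! The weights come from a change of density, the nodes from thinning out a huge random sample.

Density: regard the span as a real space of dimension d ≤ 2N. A nearly determinant-maximizing
coordinate system u (`exists_lewis_basis`) with square function Φ = ∑ |u_i|² has this property:
after division of the functions by √Φ, passage to the probability Φ^(q/2) dμ and multiplication by
√D, where D is of order N, every evaluation is bounded by √D ‖x‖ in the Euclidean norm, while the
L_q norm is at least ‖x‖.

Thinning: by the strong law, m·2^k equally weighted random points are almost exact for large k. A
choice of signs that makes the signed sum of the |f(ξ)|^q uniformly small splits the points into two
almost equally good halves, and the smaller half is kept (`exists_half_subset`). Halving down to n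
nodes costs a relative error of order √(D^(q/2)/n)·(log n)^(1-1/q). These costs grow geometrically
as the sample shrinks, so their sum is governed by n = m, whatever k was. It is at most ε once m is
of order N^(q/2) (log N)^(2-2/q).

Signs (`exists_signs_powSum`): the signed sum is a subgaussian process over the ball of the discrete
q-norm, handled by chaining with point-dependent cell radii. Each point x is replaced at scale n by
an interpolant, the minimizer of the normalized q-power sum plus a multiple of √2^n times the
distance to x (`exists_interpolant`). Minimality bounds the sum over scales of the weighted
distances (`sum_interpolation_le`). Clarkson's inequality forces interpolants of nearby points into
a small ball (`powSum_sub_interpolant_le`), and the dual Sudakov inequality cuts that ball into few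
pieces (`exists_labelling_of_eval`). The cell radii then satisfy a contracting recursion
(`sum_recursion_le`), which yields the power 1-1/q of the logarithm.

Distances are measured between signed powers instead of powers of norms: these dominate the metric
of the process, and a midpoint stays within a constant multiple of the distance between its
endpoints. That fails for |a|^q, as a = -b shows. -/

/-! ### Signed powers in an inner product space -/

section SignedPow

variable {F : Type*} [NormedAddCommGroup F] [InnerProductSpace ℝ F]

/-- The signed power `a ↦ ‖a‖ ^ (q - 1) • a`, whose norm is `‖a‖ ^ q`. -/
noncomputable def signedPow (q : ℝ) (a : F) : F := ‖a‖ ^ (q - 1) • a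

theorem norm_signedPow {q : ℝ} (hq : 2 ≤ q) (a : F) : ‖signedPow q a‖ = ‖a‖ ^ q := by
  rw [signedPow, norm_smul, Real.norm_of_nonneg (by positivity)]
  rcases eq_or_ne a 0 with rfl | ha
  · rw [norm_zero, mul_zero, Real.zero_rpow (by linarith)]
  · have : 0 < ‖a‖ := norm_pos_iff.2 ha
    rw [← Real.rpow_add_one this.ne', sub_add_cancel]

theorem abs_norm_rpow_sub_le {q : ℝ} (hq : 2 ≤ q) (a b : F) :
    |‖a‖ ^ q - ‖b‖ ^ q| ≤ ‖signedPow q a - signedPow q b‖ := by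
  rw [← norm_signedPow hq a, ← norm_signedPow hq b]
  exact abs_norm_sub_norm_le _ _

/-- Strong monotonicity: the inner product of the two differences equals (s+t)/2·‖a-b‖² plus a term
that is nonnegative because s, t are ordered as the norms are. Cauchy–Schwarz finishes. -/
theorem mul_norm_sub_le_signedPow {q : ℝ} (hq : 2 ≤ q) (a b : F) :
    (‖a‖ ^ (q - 1) + ‖b‖ ^ (q - 1)) * ‖a - b‖ ≤ 2 * ‖signedPow q a - signedPow q b‖ := by
  set s := ‖a‖ ^ (q - 1) with hs
  set t := ‖b‖ ^ (q - 1) with ht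
  have hst : 0 ≤ (s - t) * (‖a‖ ^ 2 - ‖b‖ ^ 2) := by
    rcases le_total ‖a‖ ‖b‖ with h | h
    · have h1 : s ≤ t := Real.rpow_le_rpow (norm_nonneg _) h (by linarith)
      have h2 : ‖a‖ ^ 2 ≤ ‖b‖ ^ 2 := by gcongr
      exact mul_nonneg_of_nonpos_of_nonpos (by linarith) (by linarith)
    · have h1 : t ≤ s := Real.rpow_le_rpow (norm_nonneg _) h (by linarith)
      have h2 : ‖b‖ ^ 2 ≤ ‖a‖ ^ 2 := by gcongr
      exact mul_nonneg (by linarith) (by linarith)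
  have hin : inner ℝ (signedPow q a - signedPow q b) (a - b)
      = (s + t) / 2 * ‖a - b‖ ^ 2 + (s - t) * (‖a‖ ^ 2 - ‖b‖ ^ 2) / 2 := by
    simp only [signedPow, ← hs, ← ht]
    rw [@norm_sub_sq_real]
    simp only [inner_sub_left, inner_sub_right, inner_smul_left, real_inner_self_eq_norm_sq,
      real_inner_comm a b]
    simp only [conj_trivial]
    ring
  have hcs := real_inner_le_norm (signedPow q a - signedPow q b) (a - b)
  rcases eq_or_lt_of_le (norm_nonneg (a - b)) with h0 | h0
  · rw [← h0, mul_zero]; positivity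
  · refine le_of_mul_le_mul_right ?_ h0
    nlinarith

/-- The matching upper bound. With ‖b‖ ≤ ‖a‖ the difference is s(a-b) + (s-t)b, and Bernoulli's
inequality bounds s-t by (q-1)s(1-‖b‖/‖a‖). -/
theorem norm_signedPow_sub_le {q : ℝ} (hq : 2 ≤ q) (a b : F) :
    ‖signedPow q a - signedPow q b‖ ≤ q * (‖a‖ ^ (q - 1) + ‖b‖ ^ (q - 1)) * ‖a - b‖ := by
  wlog h : ‖b‖ ≤ ‖a‖ generalizing a b
  · have := this b a (le_of_not_ge h)
    rwa [norm_sub_rev, add_comm, norm_sub_rev b a] at this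
  set s := ‖a‖ ^ (q - 1) with hs
  set t := ‖b‖ ^ (q - 1) with ht
  have hs0 : 0 ≤ s := by positivity
  have ht0 : 0 ≤ t := by positivity
  have hts : t ≤ s := Real.rpow_le_rpow (norm_nonneg _) h (by linarith)
  have hdec : signedPow q a - signedPow q b = s • (a - b) + (s - t) • b := by
    simp only [signedPow, ← hs, ← ht, smul_sub, sub_smul]; abel
  have hab : ‖a‖ - ‖b‖ ≤ ‖a - b‖ := norm_sub_norm_le _ _
  have key : (s - t) * ‖b‖ ≤ (q - 1) * s * ‖a - b‖ := by
    rcases eq_or_lt_of_le (norm_nonneg a) with h0 | h0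
    · have hb0 : ‖b‖ = 0 := le_antisymm (h0 ▸ h) (norm_nonneg _)
      rw [hb0, mul_zero]
      have : 0 ≤ q - 1 := by linarith
      positivity
    · have hB := one_add_mul_self_le_rpow_one_add (s := ‖b‖ / ‖a‖ - 1)
        (by have : 0 ≤ ‖b‖ / ‖a‖ := by positivity
            linarith) (p := q - 1) (by linarith)
      rw [add_sub_cancel, Real.div_rpow (norm_nonneg _) (norm_nonneg _), ← hs, ← ht] at hB
      have hspos : 0 < s := by positivity
      have h1 : s - t ≤ (q - 1) * s * (1 - ‖b‖ / ‖a‖) := by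
        have h3 := mul_le_mul_of_nonneg_right hB hs0
        rw [div_mul_cancel₀ _ hspos.ne'] at h3
        linarith
      calc (s - t) * ‖b‖ ≤ (s - t) * ‖a‖ := by
            apply mul_le_mul_of_nonneg_left h; linarith
        _ ≤ (q - 1) * s * (1 - ‖b‖ / ‖a‖) * ‖a‖ := mul_le_mul_of_nonneg_right h1 h0.le
        _ = (q - 1) * s * (‖a‖ - ‖b‖) := by field_simp
        _ ≤ _ := by
            apply mul_le_mul_of_nonneg_left hab
            have : 0 ≤ q - 1 := by linarith
            positivity
  calc ‖signedPow q a - signedPow q b‖ ≤ ‖s • (a - b)‖ + ‖(s - t) • b‖ := by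
        rw [hdec]; exact norm_add_le _ _
    _ = s * ‖a - b‖ + (s - t) * ‖b‖ := by
        rw [norm_smul, norm_smul, Real.norm_of_nonneg hs0, Real.norm_of_nonneg (by linarith)]
    _ ≤ q * s * ‖a - b‖ := by linarith
    _ ≤ _ := by
        apply mul_le_mul_of_nonneg_right _ (norm_nonneg _)
        apply mul_le_mul_of_nonneg_left _ (by linarith)
        linarith

/-- The two-sided comparison of signed-power distances with (‖a‖^(q-1)+‖b‖^(q-1))‖a-b‖ transfers the
behaviour of midpoints from the linear metric. This makes a midpoint an admissible competitor in the
interpolation argument. -/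
theorem norm_signedPow_sub_midpoint_le {q : ℝ} (hq : 2 ≤ q) (a b : F) :
    ‖signedPow q a - signedPow q ((1 / 2 : ℝ) • (a + b))‖
      ≤ 2 * q * ‖signedPow q a - signedPow q b‖ := by
  set z := (1 / 2 : ℝ) • (a + b) with hz
  have h1 : a - z = (1 / 2 : ℝ) • (a - b) := by
    rw [hz]; module
  have hzn : ‖z‖ ^ (q - 1) ≤ ‖a‖ ^ (q - 1) + ‖b‖ ^ (q - 1) := by
    have hz1 : ‖z‖ ≤ max ‖a‖ ‖b‖ := by
      rw [hz, norm_smul, Real.norm_of_nonneg (by norm_num)]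
      have := norm_add_le a b
      have := le_max_left ‖a‖ ‖b‖
      have := le_max_right ‖a‖ ‖b‖
      linarith
    have hA : 0 ≤ ‖a‖ ^ (q - 1) := by positivity
    have hB : 0 ≤ ‖b‖ ^ (q - 1) := by positivity
    rcases le_max_iff.1 hz1 with h | h
    · have := Real.rpow_le_rpow (norm_nonneg z) h (by linarith : 0 ≤ q - 1)
      linarith
    · have := Real.rpow_le_rpow (norm_nonneg z) h (by linarith : 0 ≤ q - 1)
      linarith
  have hA : 0 ≤ ‖a‖ ^ (q - 1) := by positivity
  have hB : 0 ≤ ‖b‖ ^ (q - 1) := by positivity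
  have h2 := norm_signedPow_sub_le hq a z
  have h3 := mul_norm_sub_le_signedPow hq a b
  have h4 : ‖a - z‖ = 1 / 2 * ‖a - b‖ := by
    rw [h1, norm_smul, Real.norm_of_nonneg (by norm_num)]
  rw [h4] at h2
  calc _ ≤ _ := h2
    _ ≤ q * (2 * (‖a‖ ^ (q - 1) + ‖b‖ ^ (q - 1))) * (1 / 2 * ‖a - b‖) := by
        apply mul_le_mul_of_nonneg_right _ (by positivity)
        apply mul_le_mul_of_nonneg_left _ (by linarith)
        linarith
    _ = q * ((‖a‖ ^ (q - 1) + ‖b‖ ^ (q - 1)) * ‖a - b‖) := by ring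
    _ ≤ q * (2 * ‖signedPow q a - signedPow q b‖) := by
        apply mul_le_mul_of_nonneg_left h3 (by linarith)
    _ = _ := by ring

theorem rpow_half_sq {q x : ℝ} (hx : 0 ≤ x) : (x ^ 2) ^ (q / 2) = x ^ q := by
  rw [← Real.rpow_natCast, ← Real.rpow_mul hx]; congr 1; push_cast; ring

theorem add_rpow_le_two_rpow {p s t : ℝ} (hp : 1 ≤ p) (hs : 0 ≤ s) (ht : 0 ≤ t) :
    (s + t) ^ p ≤ 2 ^ (p - 1) * (s ^ p + t ^ p) := by
  have := NNReal.rpow_add_le_mul_rpow_add_rpow ⟨s, hs⟩ ⟨t, ht⟩ hp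
  exact_mod_cast this

/-- Clarkson's inequality. -/
theorem clarkson_rpow {q : ℝ} (hq : 2 ≤ q) (a b : F) :
    ‖(1 / 2 : ℝ) • (a + b)‖ ^ q + ‖(1 / 2 : ℝ) • (a - b)‖ ^ q ≤ (‖a‖ ^ q + ‖b‖ ^ q) / 2 := by
  rw [← rpow_half_sq (norm_nonneg _), ← rpow_half_sq (norm_nonneg _)]
  -- With exponent q/2 ≥ 1 on squared norms: superadditivity, then the parallelogram law, then
  -- convexity.
  refine (Real.add_rpow_le_rpow_add (by positivity) (by positivity) (by linarith)).trans ?_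
  have hpar : ‖(1 / 2 : ℝ) • (a + b)‖ ^ 2 + ‖(1 / 2 : ℝ) • (a - b)‖ ^ 2
      = ‖a‖ ^ 2 / 2 + ‖b‖ ^ 2 / 2 := by
    rw [norm_smul, norm_smul, mul_pow, mul_pow, norm_add_sq_real, norm_sub_sq_real]
    rw [Real.norm_of_nonneg (by norm_num)]; ring
  rw [hpar]
  refine (add_rpow_le_two_rpow (by linarith) (by positivity) (by positivity)).trans ?_
  rw [Real.div_rpow (by positivity) (by norm_num), Real.div_rpow (by positivity) (by norm_num),
    rpow_half_sq (norm_nonneg _), rpow_half_sq (norm_nonneg _)]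
  rw [Real.rpow_sub_one (by norm_num)]
  have : (0:ℝ) < 2 ^ (q / 2) := by positivity
  apply le_of_eq; field_simp

end SignedPow

/-! ### Gaussian measure and covering numbers -/

section Covering

/-- A separated set of maximal cardinality is a net; each point is labelled by a net point related
to it. -/
theorem exists_labelling_of_card_le {α : Type*} (U : Set α) (R : α → α → Prop)
    (hrefl : ∀ x, R x x) (hsymm : ∀ x y, R x y → R y x) (K : ℕ) (hK : 0 < K)
    (hcard : ∀ t : Finset α, (↑t ⊆ U) → (∀ x ∈ t, ∀ y ∈ t, x ≠ y → ¬ R x y) → t.card ≤ K) :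
    ∃ f : α → Fin K, ∀ x ∈ U, ∀ y ∈ U, f x = f y → ∃ z, R x z ∧ R y z := by
  classical
  let P : ℕ → Prop := fun k => ∃ t : Finset α, (↑t ⊆ U) ∧
    (∀ x ∈ t, ∀ y ∈ t, x ≠ y → ¬ R x y) ∧ t.card = k
  have hP0 : P 0 := ⟨∅, by simp, by simp, rfl⟩
  obtain ⟨t, htU, hsep, htc⟩ : P (Nat.findGreatest P K) :=
    Nat.findGreatest_spec (m := 0) (Nat.zero_le _) hP0
  have hcov : ∀ x ∈ U, ∃ z ∈ t, R x z := by
    intro x hx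
    by_contra! hcon
    have hxt : x ∉ t := fun h => hcon x h (hrefl x)
    have hP : P (t.card + 1) := by
      refine ⟨insert x t, ?_, ?_, Finset.card_insert_of_notMem hxt⟩
      · rw [Finset.coe_insert]; exact Set.insert_subset hx htU
      · intro a ha b hb hab
        rcases Finset.mem_insert.1 ha with ha1 | ha1 <;>
          rcases Finset.mem_insert.1 hb with hb1 | hb1
        · exact absurd (ha1.trans hb1.symm) hab
        · exact ha1 ▸ hcon b hb1
        · exact fun h => hcon a ha1 (hsymm _ _ (hb1 ▸ h))
        · exact hsep a ha1 b hb1 hab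
    have hle : t.card + 1 ≤ K := by
      obtain ⟨t', h1, h2, h3⟩ := hP
      exact h3 ▸ hcard t' h1 h2
    have := Nat.le_findGreatest hle hP
    omega
  have htK : t.card ≤ K := hcard t htU hsep
  choose! z hz hRz using hcov
  let f : α → Fin K := fun x =>
    if h : z x ∈ t then Fin.castLE htK (t.equivFin ⟨z x, h⟩) else ⟨0, hK⟩
  refine ⟨f, fun x hx y hy hxy => ⟨z x, hRz x hx, ?_⟩⟩
  have hfx : f x = Fin.castLE htK (t.equivFin ⟨z x, hz x hx⟩) := dif_pos (hz x hx)
  have hfy : f y = Fin.castLE htK (t.equivFin ⟨z y, hz y hy⟩) := dif_pos (hz y hy)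
  rw [hfx, hfy] at hxy
  have := t.equivFin.injective (Fin.castLE_injective htK hxy)
  rw [Subtype.mk.injEq] at this
  rw [this]; exact hRz y hy

end Covering

/-! ### The weighted Euclidean and supremum norms of the evaluations -/

section EvalPair

variable {E : Type*} [NormedAddCommGroup E] [InnerProductSpace ℝ E] [FiniteDimensional ℝ E]
  {J : Type*} [Fintype J]

/-- A weighted Hilbertian norm and a supremum norm, as the norm of a linear image. -/
noncomputable def evalPair (l : J → E →L[ℝ] ℂ) (b : J → ℝ) (c : ℝ) :
    E →L[ℝ] (EuclideanSpace ℂ J) × (J → ℂ) :=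
  LinearMap.toContinuousLinearMap
    { toFun := fun x => (WithLp.toLp 2 fun j => b j • l j x, fun j => c • l j x)
      map_add' := fun x y => by ext <;> simp
      map_smul' := fun t x => by ext <;> simp [mul_left_comm] }

theorem norm_evalPair_le_iff (l : J → E →L[ℝ] ℂ) {b : J → ℝ} {c : ℝ} (hc : 0 < c) (x : E)
    {R : ℝ} (hR : 0 ≤ R) :
    ‖evalPair l b c x‖ ≤ R ↔
      ∑ j, b j ^ 2 * ‖l j x‖ ^ 2 ≤ R ^ 2 ∧ ∀ j, c * ‖l j x‖ ≤ R := by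
  change ‖(WithLp.toLp 2 fun j => b j • l j x, fun j => c • l j x)‖ ≤ R ↔ _
  rw [Prod.norm_def, max_le_iff, pi_norm_le_iff_of_nonneg hR, EuclideanSpace.norm_eq,
    Real.sqrt_le_left hR]
  simp only [norm_smul, mul_pow, Real.norm_eq_abs, sq_abs, abs_of_pos hc]

end EvalPair

/-! ### Gaussian mass and the dual Sudakov inequality -/

section Gaussian

variable {E : Type*} [NormedAddCommGroup E]

/-- The unnormalized Gaussian density. -/
noncomputable def gaussDensity (x : E) : ℝ := Real.exp (-‖x‖ ^ 2 / 2)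

theorem gaussDensity_pos (x : E) : 0 < gaussDensity x := Real.exp_pos _

variable [InnerProductSpace ℝ E]

theorem exp_inner_mul_gaussDensity (a x : E) :
    Real.exp (inner ℝ a x) * gaussDensity x = Real.exp (‖a‖ ^ 2 / 2) * gaussDensity (x - a) := by
  unfold gaussDensity
  rw [← Real.exp_add, ← Real.exp_add, norm_sub_sq_real, real_inner_comm]
  congr 1; ring

variable [FiniteDimensional ℝ E] [MeasurableSpace E] [BorelSpace E]

theorem integrable_gaussDensity : Integrable (gaussDensity : E → ℝ) := by
  have h := (GaussianFourier.integrable_cexp_neg_mul_sq_norm_add (V := E) (b := 1 / 2)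
    (by norm_num) 0 0).norm
  refine h.congr (Filter.Eventually.of_forall fun x => ?_)
  simp only [Complex.norm_exp, gaussDensity]
  congr 1
  simp [← Complex.ofReal_pow]
  ring

theorem integral_gaussDensity_pos : 0 < ∫ x : E, gaussDensity x := by
  rw [integral_pos_iff_support_of_nonneg (fun x => (gaussDensity_pos x).le)
    integrable_gaussDensity]
  have : Function.support (gaussDensity : E → ℝ) = Set.univ := by
    ext x; simp [(gaussDensity_pos x).ne']
  rw [this]
  exact Measure.measure_univ_pos.2 (NeZero.ne _)

theorem integrable_exp_inner_mul_gaussDensity (a : E) :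
    Integrable fun x : E => Real.exp (inner ℝ a x) * gaussDensity x := by
  simp_rw [exp_inner_mul_gaussDensity]
  exact (integrable_gaussDensity.comp_sub_right a).const_mul _

theorem integral_exp_inner_mul_gaussDensity (a : E) :
    ∫ x : E, Real.exp (inner ℝ a x) * gaussDensity x
      = Real.exp (‖a‖ ^ 2 / 2) * ∫ x : E, gaussDensity x := by
  simp_rw [exp_inner_mul_gaussDensity]
  rw [integral_const_mul, integral_sub_right_eq_self (fun x : E => gaussDensity x) a]

/-- Averaging the shifted density over x and -x, which symmetry of K allows, produces the factor
cosh⟨x,z⟩ ≥ 1. Hence a shift by z costs at most exp(-‖z‖²/2) of the mass. -/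
theorem setIntegral_gaussDensity_add_ge {K : Set E} (hK : MeasurableSet K)
    (hsymm : ∀ x, x ∈ K ↔ -x ∈ K) (z : E) :
    Real.exp (-‖z‖ ^ 2 / 2) * ∫ x in K, gaussDensity x ≤ ∫ x in K, gaussDensity (x + z) := by
  have hneg : ∫ x in K, gaussDensity (-x + z) = ∫ x in K, gaussDensity (x + z) := by
    rw [← integral_indicator hK, ← integral_indicator hK]
    rw [← integral_neg_eq_self (fun x => K.indicator (fun x => gaussDensity (x + z)) x)]
    congr 1; ext x
    by_cases hx : x ∈ K
    · rw [Set.indicator_of_mem hx, Set.indicator_of_mem ((hsymm x).1 hx)]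
    · rw [Set.indicator_of_notMem hx, Set.indicator_of_notMem (fun h => hx ((hsymm x).2 h))]
  have hi1 : Integrable (fun x : E => gaussDensity (x + z)) :=
    integrable_gaussDensity.comp_add_right z
  have hi2 : Integrable (fun x : E => gaussDensity (-x + z)) := hi1.comp_neg
  have hpt : ∀ x : E, 2 * (Real.exp (-‖z‖ ^ 2 / 2) * gaussDensity x)
      ≤ gaussDensity (x + z) + gaussDensity (-x + z) := by
    intro x
    have e1 : gaussDensity (x + z)
        = Real.exp (-‖z‖ ^ 2 / 2) * gaussDensity x * Real.exp (-inner ℝ x z) := by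
      unfold gaussDensity
      rw [← Real.exp_add, ← Real.exp_add, norm_add_sq_real]; congr 1; ring
    have e2 : gaussDensity (-x + z)
        = Real.exp (-‖z‖ ^ 2 / 2) * gaussDensity x * Real.exp (inner ℝ x z) := by
      unfold gaussDensity
      rw [← Real.exp_add, ← Real.exp_add, norm_add_sq_real, norm_neg, inner_neg_left]
      congr 1; ring
    rw [e1, e2, ← mul_add, mul_comm]
    have h0 : 0 ≤ Real.exp (-‖z‖ ^ 2 / 2) * gaussDensity x :=
      mul_nonneg (Real.exp_pos _).le (gaussDensity_pos x).le
    apply mul_le_mul_of_nonneg_left _ h0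
    have := Real.one_le_cosh (inner ℝ x z)
    rw [Real.cosh_eq] at this
    linarith
  have h := setIntegral_mono (μ := volume) (s := K)
    (((integrable_gaussDensity.const_mul _).const_mul _).integrableOn)
    (hi1.integrableOn.add hi2.integrableOn) hpt
  rw [integral_const_mul, integral_const_mul] at h
  simp only [Pi.add_apply] at h
  rw [integral_add hi1.integrableOn hi2.integrableOn, hneg] at h
  linarith

variable {V : Type*} [SeminormedAddCommGroup V] [NormedSpace ℝ V]

/-- Packing form of the dual Sudakov inequality. -/
theorem card_le_of_separated (G : E →L[ℝ] V)
    (hG : (∫ x : E, gaussDensity x) / 2 ≤ ∫ x in {x : E | ‖G x‖ ≤ 1}, gaussDensity x)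
    (R : ℝ) (t : Finset E) (ht : ∀ z ∈ t, ‖z‖ ≤ R)
    (hsep : ∀ z ∈ t, ∀ z' ∈ t, z ≠ z' → 2 < ‖G (z - z')‖) :
    (t.card : ℝ) ≤ 2 * Real.exp (R ^ 2 / 2) := by
  set K : Set E := {x : E | ‖G x‖ ≤ 1} with hKdef
  have hK : MeasurableSet K := by
    apply IsClosed.measurableSet
    exact isClosed_le (by fun_prop) continuous_const
  have hsymm : ∀ x, x ∈ K ↔ -x ∈ K := by
    intro x; simp [hKdef]
  set T : E → Set E := fun z => {x | x - z ∈ K} with hT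
  have hTm : ∀ z, MeasurableSet (T z) := fun z => (measurable_sub_const z) hK
  have hshift : ∀ z, ∫ x in T z, gaussDensity x = ∫ x in K, gaussDensity (x + z) := by
    intro z
    rw [← integral_indicator (hTm z), ← integral_indicator hK,
      ← integral_add_right_eq_self _ z]
    congr 1; ext x
    simp [Set.indicator, hT]
  have hdisj : Set.Pairwise (↑t : Set E) (Function.onFun Disjoint T) := by
    intro z hz z' hz' hne
    rw [Function.onFun, Set.disjoint_left]
    intro x hx hx'
    have h1 : ‖G (x - z)‖ ≤ 1 := hx
    have h2 : ‖G (x - z')‖ ≤ 1 := hx'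
    have h3 := hsep z hz z' hz' hne
    have h4 : G (z - z') = G (x - z') - G (x - z) := by
      rw [← map_sub]; congr 1; abel
    rw [h4] at h3
    linarith [norm_sub_le (G (x - z')) (G (x - z))]
  have hsum : ∑ z ∈ t, ∫ x in T z, gaussDensity x ≤ ∫ x : E, gaussDensity x := by
    rw [← integral_biUnion_finset t (fun z _ => hTm z) hdisj
      (fun z _ => integrable_gaussDensity.integrableOn)]
    exact setIntegral_le_integral integrable_gaussDensity
      (Filter.Eventually.of_forall fun x => (gaussDensity_pos x).le)
  have hZ := integral_gaussDensity_pos (E := E)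
  have hlow : ∀ z ∈ t, Real.exp (-R ^ 2 / 2) * ((∫ x : E, gaussDensity x) / 2)
      ≤ ∫ x in T z, gaussDensity x := by
    intro z hz
    rw [hshift]
    refine le_trans ?_ (setIntegral_gaussDensity_add_ge hK hsymm z)
    have hz2 : ‖z‖ ^ 2 ≤ R ^ 2 := by
      have := ht z hz
      gcongr
    gcongr
  have h1 := (Finset.card_nsmul_le_sum t _ _ hlow).trans hsum
  rw [nsmul_eq_mul] at h1
  have h2 : (t.card : ℝ) * Real.exp (-R ^ 2 / 2) ≤ 2 := by
    by_contra! hcon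
    nlinarith
  have h3 : Real.exp (-R ^ 2 / 2) * Real.exp (R ^ 2 / 2) = 1 := by
    rw [← Real.exp_add, ← Real.exp_zero]; congr 1; ring
  calc (t.card : ℝ) = t.card * Real.exp (-R ^ 2 / 2) * Real.exp (R ^ 2 / 2) := by
        rw [mul_assoc, h3, mul_one]
    _ ≤ _ := mul_le_mul_of_nonneg_right h2 (Real.exp_pos _).le

/-- Dual Sudakov inequality: a ball is partitioned into `4 ^ 2 ^ n` pieces that are small with
respect to a norm which is bounded with Gaussian probability one half. -/
theorem exists_labelling_of_gauss (G : E →L[ℝ] V)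
    (hG : (∫ x : E, gaussDensity x) / 2 ≤ ∫ x in {x : E | ‖G x‖ ≤ 1}, gaussDensity x)
    (n : ℕ) (u₀ : E) (r : ℝ) (U : Set E) (hU : ∀ u ∈ U, ‖u - u₀‖ ≤ r) :
    ∃ f : E → Fin (4 ^ 2 ^ n), ∀ u ∈ U, ∀ u' ∈ U, f u = f u' →
      ‖G (u - u')‖ ≤ 4 * r / √2 ^ n := by
  have hpos : (0 : ℝ) < √2 ^ n := by positivity
  have hsq : (√2 ^ n) ^ 2 = (2 : ℝ) ^ n := by
    rw [← pow_mul, mul_comm, pow_mul, Real.sq_sqrt (by norm_num)]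
  rcases le_or_gt r 0 with hr | hr
  · refine ⟨fun _ => ⟨0, by positivity⟩, fun u hu u' hu' _ => ?_⟩
    have h1 : ‖u - u₀‖ = 0 := le_antisymm ((hU u hu).trans hr) (norm_nonneg _)
    have h2 : ‖u' - u₀‖ = 0 := le_antisymm ((hU u' hu').trans hr) (norm_nonneg _)
    have h3 : u = u' := by
      rw [norm_sub_eq_zero_iff] at h1 h2; rw [h1, h2]
    have h4 : r = 0 := le_antisymm hr (h1 ▸ hU u hu)
    simp [h3, h4]
  obtain ⟨f, hf⟩ := exists_labelling_of_card_le U (fun x y => ‖G (x - y)‖ ≤ 2 * r / √2 ^ n)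
    (fun x => by simp; positivity)
    (fun x y h => by rwa [← norm_neg, ← map_neg, neg_sub])
    (4 ^ 2 ^ n) (by positivity) (by
      classical
      intro t htU hsep
      -- Dilation to a ball of radius √2^n about 0 turns the separation 2r/√2^n into 2, and the
      -- packing bound 2·exp(2^n/2) is at most 4^2^n. Two points with a common neighbour in the net
      -- are then within twice the separation, which gives 4r/√2^n.
      set φ : E → E := fun u => (√2 ^ n / r) • (u - u₀) with hφ
      have hc : 0 < √2 ^ n / r := by positivity
      have hinj : Function.Injective φ := by
        intro a b hab
        have := smul_right_injective E hc.ne' hab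
        exact sub_left_injective this
      have := card_le_of_separated G hG (√2 ^ n) (t.image φ) (by
        intro z hz
        obtain ⟨u, hu, rfl⟩ := Finset.mem_image.1 hz
        rw [hφ, norm_smul, Real.norm_of_nonneg hc.le]
        calc √2 ^ n / r * ‖u - u₀‖ ≤ √2 ^ n / r * r :=
              mul_le_mul_of_nonneg_left (hU u (htU hu)) hc.le
          _ = _ := by field_simp) (by
        intro z hz z' hz' hne
        obtain ⟨u, hu, rfl⟩ := Finset.mem_image.1 hz
        obtain ⟨u', hu', rfl⟩ := Finset.mem_image.1 hz'
        have h1 := hsep u hu u' hu' (fun h => hne (h ▸ rfl))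
        rw [not_le] at h1
        have h2 : φ u - φ u' = (√2 ^ n / r) • (u - u') := by
          simp only [hφ, ← smul_sub]; congr 1; abel
        rw [h2, map_smul, norm_smul, Real.norm_of_nonneg hc.le]
        calc (2 : ℝ) = √2 ^ n / r * (2 * r / √2 ^ n) := by field_simp
          _ < _ := mul_lt_mul_of_pos_left h1 hc)
      rw [Finset.card_image_of_injective _ hinj, hsq] at this
      have h4 : (2 : ℝ) * Real.exp (2 ^ n / 2) ≤ 4 ^ 2 ^ n := by
        have e1 : Real.exp ((2 : ℝ) ^ n / 2) ≤ 2 ^ 2 ^ n := by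
          have : Real.exp ((2 : ℝ) ^ n / 2) = Real.exp (1 / 2) ^ (2 ^ n) := by
            rw [← Real.exp_nat_mul]; congr 1; push_cast; ring
          rw [this]
          apply pow_le_pow_left₀ (Real.exp_pos _).le
          have h5 := Real.exp_one_lt_d9
          have h6 : Real.exp (1 / 2) ^ 2 = Real.exp 1 := by
            rw [← Real.exp_nat_mul]; norm_num
          nlinarith [Real.exp_pos (1 / 2)]
        have e2 : (2 : ℝ) ≤ 2 ^ 2 ^ n := le_self_pow₀ (by norm_num) (by positivity)
        calc (2 : ℝ) * Real.exp (2 ^ n / 2) ≤ 2 ^ 2 ^ n * 2 ^ 2 ^ n :=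
              mul_le_mul e2 e1 (Real.exp_pos _).le (by positivity)
          _ = 4 ^ 2 ^ n := by rw [← mul_pow]; norm_num
      exact_mod_cast this.trans h4)
  refine ⟨f, fun u hu u' hu' huu => ?_⟩
  obtain ⟨z, h1, h2⟩ := hf u hu u' hu' huu
  have h3 : G (u - u') = G (u - z) - G (u' - z) := by
    rw [← map_sub]; congr 1; abel
  rw [h3]
  calc _ ≤ _ := norm_sub_le _ _
    _ ≤ 2 * r / √2 ^ n + 2 * r / √2 ^ n := add_le_add h1 h2
    _ = _ := by ring


/-- The sum of the four exponentials `exp (± s re z)`, `exp (± s im z)`. -/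
noncomputable def expSum (s : ℝ) (z : ℂ) : ℝ :=
  Real.exp (s * z.re) + Real.exp (-s * z.re) + Real.exp (s * z.im) + Real.exp (-s * z.im)

theorem expSum_nonneg (s : ℝ) (z : ℂ) : 0 ≤ expSum s z := by unfold expSum; positivity

/-- Together with `exp_le_expSum`, this reduces both the second moment and the tail of an evaluation
to its Laplace transform, for which the Gaussian integral is explicit. -/
theorem norm_sq_le_expSum {s : ℝ} (hs : 0 < s) (z : ℂ) : ‖z‖ ^ 2 ≤ s⁻¹ ^ 2 * expSum s z := by
  have key : ∀ y : ℝ, y ^ 2 ≤ Real.exp y + Real.exp (-y) := by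
    have pos : ∀ y : ℝ, 0 ≤ y → y ^ 2 ≤ Real.exp y := by
      intro y hy
      have h1 := Real.quadratic_le_exp_of_nonneg (x := y / 2) (by linarith)
      have h2 : Real.exp y = Real.exp (y / 2) ^ 2 := by
        rw [← Real.exp_nat_mul]; congr 1; push_cast; ring
      have h3 : (1 + y / 2 + (y / 2) ^ 2 / 2) ^ 2 ≤ Real.exp (y / 2) ^ 2 := by gcongr
      have h4 : 0 ≤ y * ((y - 2) ^ 2 + 4) := by positivity
      have h5 : 0 ≤ y ^ 4 := by positivity
      rw [h2]
      nlinarith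
    intro y
    rcases le_total 0 y with h | h
    · linarith [pos y h, Real.exp_pos (-y)]
    · have := pos (-y) (by linarith)
      rw [neg_sq] at this
      linarith [Real.exp_pos y]
  have h1 := key (s * z.re)
  have h2 := key (s * z.im)
  rw [← neg_mul] at h1 h2
  have h3 : ‖z‖ ^ 2 = s⁻¹ ^ 2 * ((s * z.re) ^ 2 + (s * z.im) ^ 2) := by
    rw [Complex.sq_norm, Complex.normSq_apply]; field_simp
  rw [h3]
  apply mul_le_mul_of_nonneg_left _ (by positivity)
  unfold expSum; linarith

theorem exp_le_expSum {s τ : ℝ} (hs : 0 ≤ s) {z : ℂ} (hz : 2 * τ < ‖z‖) :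
    Real.exp (s * τ) ≤ expSum s z := by
  have h := Complex.norm_le_abs_re_add_abs_im z
  have key : ∀ y : ℝ, τ ≤ |y| → Real.exp (s * τ) ≤ Real.exp (s * y) + Real.exp (-s * y) := by
    intro y hy
    rcases le_abs'.1 hy with h | h
    · have : Real.exp (s * τ) ≤ Real.exp (-s * y) := Real.exp_le_exp.2 (by nlinarith)
      linarith [Real.exp_pos (s * y)]
    · have : Real.exp (s * τ) ≤ Real.exp (s * y) := Real.exp_le_exp.2 (by nlinarith)
      linarith [Real.exp_pos (-s * y)]
  unfold expSum
  rcases le_or_gt τ |z.re| with h1 | h1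
  · have := key _ h1
    linarith [Real.exp_pos (s * z.im), Real.exp_pos (-s * z.im)]
  · have := key z.im (by linarith)
    linarith [Real.exp_pos (s * z.re), Real.exp_pos (-s * z.re)]

theorem integral_exp_mul_gaussDensity_le (φ : E →L[ℝ] ℝ) {B : ℝ} (hφ : ∀ x, |φ x| ≤ B * ‖x‖)
    (hB : 0 ≤ B) (s : ℝ) :
    Integrable (fun x : E => Real.exp (s * φ x) * gaussDensity x) ∧
    ∫ x : E, Real.exp (s * φ x) * gaussDensity x
      ≤ Real.exp (s ^ 2 * B ^ 2 / 2) * ∫ x : E, gaussDensity x := by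
  set a := (InnerProductSpace.toDual ℝ E).symm (s • φ) with ha
  have h1 : ∀ x, s * φ x = inner ℝ a x := by
    intro x
    rw [ha, InnerProductSpace.toDual_symm_apply]; rfl
  have h2 : ‖a‖ ≤ |s| * B := by
    rw [ha, LinearIsometryEquiv.norm_map, norm_smul, Real.norm_eq_abs]
    exact mul_le_mul_of_nonneg_left (φ.opNorm_le_bound hB hφ) (abs_nonneg _)
  simp_rw [h1]
  refine ⟨integrable_exp_inner_mul_gaussDensity a, ?_⟩
  rw [integral_exp_inner_mul_gaussDensity]
  apply mul_le_mul_of_nonneg_right _ integral_gaussDensity_pos.le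
  apply Real.exp_le_exp.2
  have : ‖a‖ ^ 2 ≤ (|s| * B) ^ 2 := by gcongr
  rw [mul_pow, sq_abs] at this
  linarith

theorem integral_expSum_mul_gaussDensity_le (l : E →L[ℝ] ℂ) {B : ℝ} (hl : ∀ x, ‖l x‖ ≤ B * ‖x‖)
    (hB : 0 ≤ B) (s : ℝ) :
    Integrable (fun x : E => expSum s (l x) * gaussDensity x) ∧
    ∫ x : E, expSum s (l x) * gaussDensity x
      ≤ 4 * Real.exp (s ^ 2 * B ^ 2 / 2) * ∫ x : E, gaussDensity x := by
  have hre := integral_exp_mul_gaussDensity_le (Complex.reCLM.comp l) (B := B)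
    (fun x => (Complex.abs_re_le_norm _).trans (hl x)) hB
  have him := integral_exp_mul_gaussDensity_le (Complex.imCLM.comp l) (B := B)
    (fun x => (Complex.abs_im_le_norm _).trans (hl x)) hB
  obtain ⟨i1, e1⟩ := hre s
  obtain ⟨i2, e2⟩ := hre (-s)
  obtain ⟨i3, e3⟩ := him s
  obtain ⟨i4, e4⟩ := him (-s)
  rw [neg_sq] at e2 e4
  simp only [ContinuousLinearMap.comp_apply, Complex.reCLM_apply, Complex.imCLM_apply] at *
  have hEq : (fun x : E => expSum s (l x) * gaussDensity x) = fun x =>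
      Real.exp (s * (l x).re) * gaussDensity x + Real.exp (-s * (l x).re) * gaussDensity x
      + Real.exp (s * (l x).im) * gaussDensity x + Real.exp (-s * (l x).im) * gaussDensity x := by
    ext x; unfold expSum; ring
  have i12 := i1.add i2
  have i123 := i12.add i3
  rw [hEq]
  refine ⟨i123.add i4, ?_⟩
  have := integral_add i123 i4
  simp only [Pi.add_apply] at this
  rw [this]
  have := integral_add i12 i3
  simp only [Pi.add_apply] at this
  rw [this, integral_add i1 i2]
  linarith

/-- Under the Gaussian measure the weighted square sum has mean of order D ∑ b² ≤ Γ², and the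
maximum of at most 2^L evaluations is of order √(DL). With probability at least one half both are
under control, so dual Sudakov applies to the two norms at once. -/
theorem exists_labelling_of_eval {J : Type*} [Fintype J] (l : J → E →L[ℝ] ℂ) {D : ℝ} (hD : 0 < D)
    (hl : ∀ j x, ‖l j x‖ ≤ √D * ‖x‖) {L : ℕ} (hL : 1 ≤ L) (hJ : Fintype.card J ≤ 2 ^ L)
    (b : J → ℝ) {Γ : ℝ} (hΓ : 0 < Γ) (hb : D * ∑ j, b j ^ 2 ≤ Γ ^ 2)
    (n : ℕ) (u₀ : E) (r : ℝ) (U : Set E) (hU : ∀ u ∈ U, ‖u - u₀‖ ≤ r) :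
    ∃ f : E → Fin (4 ^ 2 ^ n), ∀ u ∈ U, ∀ u' ∈ U, f u = f u' →
      ∑ j, b j ^ 2 * ‖l j (u - u')‖ ^ 2 ≤ 32 * Γ ^ 2 * (4 * r / √2 ^ n) ^ 2 ∧
      ∀ j, ‖l j (u - u')‖ ≤ √(40 * D * L) * (4 * r / √2 ^ n) := by
  have hL' : (1 : ℝ) ≤ L := by exact_mod_cast hL
  -- The constants give each of the two bad events mass at most Z/4: the mean of the square sum is
  -- at most 8Γ² = M²/4, and the union bound over the tails beyond 2τ is 2^L·4·exp(-5L) ≤ 1/4.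
  set M := √(32 * Γ ^ 2) with hM
  have hM0 : 0 < M := by positivity
  have hM2 : M ^ 2 = 32 * Γ ^ 2 := Real.sq_sqrt (by positivity)
  set τ := √(10 * D * L) with hτ
  have hτ0 : 0 < τ := by positivity
  have hτ2 : τ ^ 2 = 10 * D * L := Real.sq_sqrt (by positivity)
  have h2τ : √(40 * D * L) = 2 * τ := by
    rw [Real.sqrt_eq_iff_mul_self_eq (by positivity) (by positivity)]
    nlinarith
  set Z := ∫ x : E, gaussDensity x with hZ
  have hZ0 : 0 < Z := integral_gaussDensity_pos
  have hsD : √D ^ 2 = D := Real.sq_sqrt hD.le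
  have hsD0 : 0 < √D := by positivity
  set G := evalPair l (fun j => b j / M) (2 * τ)⁻¹ with hG
  set s := τ / D with hs
  -- `H` dominates the density off the good set: the first terms when the square sum is too large,
  -- the second when some evaluation is.
  let H : E → ℝ := fun x =>
    ∑ j, ((b j / M) ^ 2 * D * (expSum (√D)⁻¹ (l j x) * gaussDensity x)
      + Real.exp (-(s * τ)) * (expSum s (l j x) * gaussDensity x))
  have hI1 := fun j => integral_expSum_mul_gaussDensity_le (l j) (hl j) hsD0.le (√D)⁻¹
  have hI2 := fun j => integral_expSum_mul_gaussDensity_le (l j) (hl j) hsD0.le s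
  have hHi : Integrable H := integrable_finsetSum _ fun j _ =>
    ((hI1 j).1.const_mul _).add ((hI2 j).1.const_mul _)
  have hexp : 4 * Real.exp ((√D)⁻¹ ^ 2 * √D ^ 2 / 2) ≤ 8 := by
    have h5 := Real.exp_one_lt_d9
    have h6 : Real.exp (1 / 2) ^ 2 = Real.exp 1 := by
      rw [← Real.exp_nat_mul]; norm_num
    have : (√D)⁻¹ ^ 2 * √D ^ 2 / 2 = 1 / 2 := by field_simp
    rw [this]
    nlinarith [Real.exp_pos (1 / 2)]
  have hHint : ∫ x, H x ≤ Z / 2 := by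
    have e1 : ∫ x, H x = ∑ j, ((b j / M) ^ 2 * D * ∫ x, expSum (√D)⁻¹ (l j x) * gaussDensity x)
        + ∑ j, Real.exp (-(s * τ)) * ∫ x, expSum s (l j x) * gaussDensity x := by
      simp only [H]
      rw [integral_finsetSum, ← Finset.sum_add_distrib]
      swap
      · exact fun j _ => ((hI1 j).1.const_mul _).add ((hI2 j).1.const_mul _)
      refine Finset.sum_congr rfl fun j _ => ?_
      rw [integral_add ((hI1 j).1.const_mul _) ((hI2 j).1.const_mul _), integral_const_mul,
        integral_const_mul]
    have e2 : ∑ j, ((b j / M) ^ 2 * D * ∫ x, expSum (√D)⁻¹ (l j x) * gaussDensity x)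
        ≤ Z / 4 := by
      calc _ ≤ ∑ j, ((b j / M) ^ 2 * D * (8 * Z)) := by
            refine Finset.sum_le_sum fun j _ => ?_
            apply mul_le_mul_of_nonneg_left _ (by positivity)
            exact (hI1 j).2.trans (mul_le_mul_of_nonneg_right hexp hZ0.le)
        _ = (D * ∑ j, b j ^ 2) * (8 * Z / M ^ 2) := by
            rw [Finset.mul_sum, Finset.sum_mul]
            refine Finset.sum_congr rfl fun j _ => ?_
            field_simp
        _ ≤ Γ ^ 2 * (8 * Z / M ^ 2) := mul_le_mul_of_nonneg_right hb (by positivity)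
        _ = Z / 4 := by rw [hM2]; field_simp; norm_num
    have e3 : ∑ j, Real.exp (-(s * τ)) * ∫ x, expSum s (l j x) * gaussDensity x ≤ Z / 4 := by
      have hst : s * τ = 10 * L := by
        rw [hs, div_mul_eq_mul_div, ← sq, hτ2]; field_simp
      have hs2 : s ^ 2 * √D ^ 2 / 2 = 5 * L := by
        rw [hsD, hs, div_pow, hτ2]; field_simp; norm_num
      have hbd : ∀ j, Real.exp (-(s * τ)) * ∫ x, expSum s (l j x) * gaussDensity x
          ≤ 4 * Real.exp (-5 * L) * Z := by
        intro j
        calc _ ≤ Real.exp (-(s * τ)) * (4 * Real.exp (s ^ 2 * √D ^ 2 / 2) * Z) :=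
              mul_le_mul_of_nonneg_left (hI2 j).2 (Real.exp_pos _).le
          _ = 4 * (Real.exp (-(10 * L)) * Real.exp (5 * L)) * Z := by rw [hst, hs2]; ring
          _ = _ := by rw [← Real.exp_add]; congr 3; ring
      have hJ' : (Fintype.card J : ℝ) ≤ 2 ^ L := by exact_mod_cast hJ
      calc _ ≤ ∑ _j : J, 4 * Real.exp (-5 * L) * Z := Finset.sum_le_sum fun j _ => hbd j
        _ = Fintype.card J * (4 * Real.exp (-5 * L) * Z) := by simp
        _ ≤ 2 ^ L * (4 * Real.exp (-5 * L) * Z) :=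
            mul_le_mul_of_nonneg_right hJ' (by positivity)
        _ ≤ Z / 4 := by
            have h32 : (32 : ℝ) ≤ Real.exp 5 := by
              have h2 : (2 : ℝ) ≤ Real.exp 1 := by linarith [Real.add_one_le_exp 1]
              have : Real.exp 5 = Real.exp 1 ^ 5 := by rw [← Real.exp_nat_mul]; norm_num
              rw [this]
              calc (32 : ℝ) = 2 ^ 5 := by norm_num
                _ ≤ _ := by gcongr
            have h5 : Real.exp (-5 * L) ≤ (1 / 32) ^ L := by
              have : Real.exp (-5 * L) = (Real.exp 5)⁻¹ ^ L := by
                rw [← Real.exp_neg, ← Real.exp_nat_mul]; congr 1; ring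
              rw [this, one_div]; gcongr
            have h6 : (2 : ℝ) ^ L * (1 / 32) ^ L ≤ 1 / 16 := by
              rw [← mul_pow]
              calc ((2 : ℝ) * (1 / 32)) ^ L ≤ (2 * (1 / 32)) ^ 1 :=
                    pow_le_pow_of_le_one (by norm_num) (by norm_num) hL
                _ = _ := by norm_num
            calc 2 ^ L * (4 * Real.exp (-5 * L) * Z) ≤ 2 ^ L * (4 * (1 / 32) ^ L * Z) := by
                  gcongr
              _ = 4 * (2 ^ L * (1 / 32) ^ L) * Z := by ring
              _ ≤ 4 * (1 / 16) * Z := by gcongr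
              _ = _ := by ring
    rw [e1]; linarith
  have hmass : Z / 2 ≤ ∫ x in {x : E | ‖G x‖ ≤ 1}, gaussDensity x := by
    have hKm : MeasurableSet {x : E | ‖G x‖ ≤ 1} :=
      (isClosed_le (by fun_prop) continuous_const).measurableSet
    have hsplit := integral_add_compl hKm (integrable_gaussDensity (E := E))
    have hH0 : ∀ x, 0 ≤ H x := fun x => Finset.sum_nonneg fun j _ => by
      have := expSum_nonneg (√D)⁻¹ (l j x)
      have := expSum_nonneg s (l j x)
      have := gaussDensity_pos x
      positivity
    have hle : ∫ x in {x : E | ‖G x‖ ≤ 1}ᶜ, gaussDensity x ≤ ∫ x, H x := by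
      refine le_trans (setIntegral_mono_on integrable_gaussDensity.integrableOn
        hHi.integrableOn hKm.compl fun x hx => ?_) (setIntegral_le_integral hHi
          (Filter.Eventually.of_forall hH0))
      have hw := gaussDensity_pos x
      have hx' : ¬ ‖G x‖ ≤ 1 := hx
      rw [hG, norm_evalPair_le_iff l (by positivity) x zero_le_one] at hx'
      have hA : ∀ j, (b j / M) ^ 2 * ‖l j x‖ ^ 2 * gaussDensity x
          ≤ (b j / M) ^ 2 * D * (expSum (√D)⁻¹ (l j x) * gaussDensity x) := by
        intro j
        have := norm_sq_le_expSum (inv_pos.2 hsD0) (l j x)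
        rw [inv_inv, hsD] at this
        calc _ ≤ (b j / M) ^ 2 * (D * expSum (√D)⁻¹ (l j x)) * gaussDensity x := by gcongr
          _ = _ := by ring
      have hB : ∀ j, 0 ≤ Real.exp (-(s * τ)) * (expSum s (l j x) * gaussDensity x) := fun j => by
        have := expSum_nonneg s (l j x)
        positivity
      have hA0 : ∀ j, 0 ≤ (b j / M) ^ 2 * D * (expSum (√D)⁻¹ (l j x) * gaussDensity x) :=
        fun j => by
          have := expSum_nonneg (√D)⁻¹ (l j x)
          positivity
      by_cases hcase : ∑ j, (b j / M) ^ 2 * ‖l j x‖ ^ 2 ≤ 1 ^ 2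
      · have : ¬ ∀ j, (2 * τ)⁻¹ * ‖l j x‖ ≤ 1 := fun h => hx' ⟨hcase, h⟩
        push Not at this
        obtain ⟨j, hj⟩ := this
        have hj' : 2 * τ < ‖l j x‖ := by
          rw [inv_mul_eq_div, lt_div_iff₀ (by positivity), one_mul] at hj
          exact hj
        have h1 := exp_le_expSum (s := s) (by positivity) hj'
        calc gaussDensity x = Real.exp (-(s * τ)) * (Real.exp (s * τ) * gaussDensity x) := by
              rw [← mul_assoc, ← Real.exp_add]; simp
          _ ≤ Real.exp (-(s * τ)) * (expSum s (l j x) * gaussDensity x) := by gcongr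
          _ ≤ (b j / M) ^ 2 * D * (expSum (√D)⁻¹ (l j x) * gaussDensity x)
              + Real.exp (-(s * τ)) * (expSum s (l j x) * gaussDensity x) := by
              linarith [hA0 j]
          _ ≤ H x := Finset.single_le_sum
              (f := fun j => (b j / M) ^ 2 * D * (expSum (√D)⁻¹ (l j x) * gaussDensity x)
              + Real.exp (-(s * τ)) * (expSum s (l j x) * gaussDensity x))
              (fun j _ => add_nonneg (hA0 j) (hB j)) (Finset.mem_univ j)
      · rw [not_le, one_pow] at hcase
        calc gaussDensity x ≤ (∑ j, (b j / M) ^ 2 * ‖l j x‖ ^ 2) * gaussDensity x := by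
              nlinarith
          _ = ∑ j, (b j / M) ^ 2 * ‖l j x‖ ^ 2 * gaussDensity x := Finset.sum_mul _ _ _
          _ ≤ H x := Finset.sum_le_sum fun j _ => by linarith [hA j, hB j]
    linarith
  obtain ⟨f, hf⟩ := exists_labelling_of_gauss G hmass n u₀ r U hU
  refine ⟨f, fun u hu u' hu' huu => ?_⟩
  have hr : 0 ≤ r := (norm_nonneg _).trans (hU u hu)
  have h := hf u hu u' hu' huu
  rw [hG, norm_evalPair_le_iff l (by positivity) _ (by positivity)] at h
  refine ⟨?_, fun j => ?_⟩
  · rw [← hM2]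
    calc ∑ j, b j ^ 2 * ‖l j (u - u')‖ ^ 2
        = M ^ 2 * ∑ j, (b j / M) ^ 2 * ‖l j (u - u')‖ ^ 2 := by
          rw [Finset.mul_sum]
          refine Finset.sum_congr rfl fun j _ => ?_
          field_simp
      _ ≤ _ := mul_le_mul_of_nonneg_left h.1 (by positivity)
  · rw [h2τ]
    calc ‖l j (u - u')‖ = 2 * τ * ((2 * τ)⁻¹ * ‖l j (u - u')‖) := by field_simp
      _ ≤ _ := mul_le_mul_of_nonneg_left (h.2 j) (by positivity)

end Gaussian

/-! ### Random signs -/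

section Signs

/-- The sign `1` or `-1` attached to a Boolean. -/
def boolSign (b : Bool) : ℝ := if b then 1 else -1

theorem abs_boolSign (b : Bool) : |boolSign b| = 1 := by cases b <;> simp [boolSign]

variable {J : Type*} [Fintype J]

/-- The exponential of the sum factorizes over coordinates, and cosh y ≤ exp(y²/2). -/
theorem sum_exp_boolSign_le [DecidableEq J] (y : J → ℝ) (θ : ℝ) :
    ∑ σ : J → Bool, Real.exp (θ * ∑ j, boolSign (σ j) * y j)
      ≤ 2 ^ Fintype.card J * Real.exp (θ ^ 2 * (∑ j, y j ^ 2) / 2) := by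
  have h1 : ∀ σ : J → Bool, Real.exp (θ * ∑ j, boolSign (σ j) * y j)
      = ∏ j, Real.exp (boolSign (σ j) * (θ * y j)) := by
    intro σ
    rw [← Real.exp_sum, Finset.mul_sum]
    congr 1; exact Finset.sum_congr rfl fun j _ => by ring
  simp_rw [h1]
  have h2 := Finset.prod_univ_sum (fun _ : J => (Finset.univ : Finset Bool))
    (fun j b => Real.exp (boolSign b * (θ * y j)))
  rw [Fintype.piFinset_univ] at h2
  rw [← h2]
  calc _ ≤ ∏ j, (2 * Real.exp ((θ * y j) ^ 2 / 2)) := by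
        refine Finset.prod_le_prod (fun j _ => by positivity) fun j _ => ?_
        have := Real.cosh_le_exp_half_sq (θ * y j)
        rw [Real.cosh_eq] at this
        simp only [Fintype.univ_bool, Finset.sum_insert, Finset.mem_singleton, Bool.true_eq_false,
          not_false_eq_true, Finset.sum_singleton, boolSign, if_true, one_mul, Bool.false_eq_true,
          if_false, neg_mul]
        linarith
    _ = _ := by
        rw [Finset.prod_mul_distrib, ← Real.exp_sum]
        simp only [Finset.prod_const, Finset.card_univ]
        congr 2
        rw [Finset.mul_sum, Finset.sum_div]
        exact Finset.sum_congr rfl fun j _ => by ring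

/-- Chernoff and union bounds by counting: if every sign pattern violated some inequality, the
exponential majorants would sum to at least 1 for each pattern, contradicting their average over all
patterns. -/
theorem exists_signs_of_sum_lt_one {A : Type*} [Fintype A] (y : A → EuclideanSpace ℝ J)
    (t : A → ℝ) (ht : ∀ α, 0 ≤ t α) (hsum : ∑ α, 2 * Real.exp (-(t α) ^ 2 / 2) < 1) :
    ∃ σ : J → Bool, ∀ α, |∑ j, boolSign (σ j) * y α j| ≤ t α * ‖y α‖ := by
  classical
  by_contra! hcon
  set S : A → (J → Bool) → ℝ := fun α σ => ∑ j, boolSign (σ j) * y α j with hS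
  set θ : A → ℝ := fun α => t α / ‖y α‖ with hθ
  set B : A → (J → Bool) → ℝ := fun α σ =>
    Real.exp (-(t α) ^ 2) * (Real.exp (θ α * S α σ) + Real.exp (-θ α * S α σ)) with hB
  have hB0 : ∀ α σ, 0 ≤ B α σ := fun α σ => by positivity
  have h1 : ∀ σ, 1 ≤ ∑ α, B α σ := by
    intro σ
    obtain ⟨α, hα⟩ := hcon σ
    refine le_trans ?_ (Finset.single_le_sum (fun α _ => hB0 α σ) (Finset.mem_univ α))
    have hy : y α ≠ 0 := by
      intro h0
      simp [h0] at hα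
    have hn : 0 < ‖y α‖ := norm_pos_iff.2 hy
    have hθ0 : 0 ≤ θ α := div_nonneg (ht α) hn.le
    have h2 : (t α) ^ 2 ≤ θ α * |S α σ| := by
      calc (t α) ^ 2 = θ α * (t α * ‖y α‖) := by rw [hθ]; field_simp
        _ ≤ _ := mul_le_mul_of_nonneg_left hα.le hθ0
    have h3 : Real.exp ((t α) ^ 2) ≤ Real.exp (θ α * S α σ) + Real.exp (-θ α * S α σ) := by
      rcases abs_cases (S α σ) with ⟨h, _⟩ | ⟨h, _⟩
      · rw [h] at h2
        linarith [Real.exp_le_exp.2 h2, Real.exp_pos (-θ α * S α σ)]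
      · rw [h] at h2
        have : Real.exp ((t α) ^ 2) ≤ Real.exp (-θ α * S α σ) := Real.exp_le_exp.2 (by linarith)
        linarith [Real.exp_pos (θ α * S α σ)]
    calc (1 : ℝ) = Real.exp (-(t α) ^ 2) * Real.exp ((t α) ^ 2) := by
          rw [← Real.exp_add]; simp
      _ ≤ _ := mul_le_mul_of_nonneg_left h3 (Real.exp_pos _).le
  have h4 : ∀ α, ∑ σ, B α σ ≤ 2 ^ Fintype.card J * (2 * Real.exp (-(t α) ^ 2 / 2)) := by
    intro α
    simp only [hB]
    rw [← Finset.mul_sum, Finset.sum_add_distrib]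
    have e1 := sum_exp_boolSign_le (fun j => y α j) (θ α)
    have e2 := sum_exp_boolSign_le (fun j => y α j) (-θ α)
    rw [neg_sq] at e2
    have e3 : θ α ^ 2 * (∑ j, y α j ^ 2) ≤ (t α) ^ 2 := by
      rw [← EuclideanSpace.real_norm_sq_eq, ← mul_pow]
      have h0 : 0 ≤ θ α := div_nonneg (ht α) (norm_nonneg _)
      gcongr
      rcases eq_or_ne ‖y α‖ 0 with h | h
      · rw [h, mul_zero]; exact ht α
      · exact (div_mul_cancel₀ _ h).le
    have e4 : Real.exp (-(t α) ^ 2) * Real.exp (θ α ^ 2 * (∑ j, y α j ^ 2) / 2)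
        ≤ Real.exp (-(t α) ^ 2 / 2) := by
      rw [← Real.exp_add]; apply Real.exp_le_exp.2; linarith
    calc _ ≤ Real.exp (-(t α) ^ 2) *
          (2 * (2 ^ Fintype.card J * Real.exp (θ α ^ 2 * (∑ j, y α j ^ 2) / 2))) := by
          apply mul_le_mul_of_nonneg_left _ (Real.exp_pos _).le
          linarith
      _ = 2 ^ Fintype.card J * (2 *
          (Real.exp (-(t α) ^ 2) * Real.exp (θ α ^ 2 * (∑ j, y α j ^ 2) / 2))) := by ring
      _ ≤ _ := by gcongr
  have h5 : (2 : ℝ) ^ Fintype.card J ≤ ∑ σ : J → Bool, ∑ α, B α σ := by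
    calc (2 : ℝ) ^ Fintype.card J = ∑ _σ : J → Bool, (1 : ℝ) := by simp
      _ ≤ _ := Finset.sum_le_sum fun σ _ => h1 σ
  rw [Finset.sum_comm] at h5
  have h6 := h5.trans (Finset.sum_le_sum fun α _ => h4 α)
  rw [← Finset.mul_sum] at h6
  have h7 : (0 : ℝ) < 2 ^ Fintype.card J := by positivity
  nlinarith

/-- Chaining along partitions into `8 ^ 2 ^ n` cells, `n ≤ L`, for a sign process on at most
`2 ^ L` coordinates. -/
theorem exists_signs_of_labels {T : Type*} (X : T → EuclideanSpace ℝ J) (L : ℕ)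
    (hJ : Fintype.card J ≤ 2 ^ L) (a : ∀ n : ℕ, T → Fin (8 ^ 2 ^ n)) (δ : ℕ → T → ℝ)
    (t₀ : T) (hX0 : X t₀ = 0)
    (ha : ∀ n t t', a n t = a n t' → ‖X t - X t'‖ ≤ δ n t)
    (h0 : ∀ t t', ‖X t - X t'‖ ≤ δ 0 t) :
    ∃ σ : J → Bool, ∀ t, |∑ j, boolSign (σ j) * X t j|
      ≤ 11 * ∑ n ∈ Finset.range (L + 1), √2 ^ n * δ n t := by
  classical
  -- At level 0 every point is represented by `t₀`, where `X` vanishes, so that all chains start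
  -- from 0.
  let rep : ∀ n : ℕ, Fin (8 ^ 2 ^ n) → T := fun n i =>
    if h : n ≠ 0 ∧ ∃ t, a n t = i then h.2.choose else t₀
  have hrep : ∀ n t, ‖X t - X (rep n (a n t))‖ ≤ δ n t := by
    intro n t
    rcases eq_or_ne n 0 with rfl | hn
    · exact h0 _ _
    · have h : n ≠ 0 ∧ ∃ t', a n t' = a n t := ⟨hn, t, rfl⟩
      have : rep n (a n t) = h.2.choose := dif_pos h
      rw [this]
      exact ha n _ _ h.2.choose_spec.symm
  have hrep0 : ∀ i, rep 0 i = t₀ := fun i => dif_neg (by simp)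
  let A := Σ n : Fin L, Fin (8 ^ 2 ^ (n : ℕ)) × Fin (8 ^ 2 ^ ((n : ℕ) + 1))
  -- A link is a pair of labels at consecutive levels; level n has 8^2^n·8^2^(n+1) = 512^2^n of
  -- them. The threshold 5√2^n makes each failure at most 2·4096^(-2^n), and the total is below 1.
  obtain ⟨σ, hσ⟩ := exists_signs_of_sum_lt_one (A := A)
    (fun α => X (rep _ α.2.2) - X (rep _ α.2.1)) (fun α => 5 * √2 ^ (α.1 : ℕ))
    (fun α => by positivity) (by
      rw [Fintype.sum_sigma]
      simp only [Finset.sum_const, Finset.card_univ, Fintype.card_prod, Fintype.card_fin,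
        nsmul_eq_mul]
      have hterm : ∀ n : ℕ, ((8 ^ 2 ^ n * 8 ^ 2 ^ (n + 1) : ℕ) : ℝ) *
          (2 * Real.exp (-(5 * √2 ^ n) ^ 2 / 2)) ≤ 2 / 8 * (1 / 8) ^ n := by
        intro n
        have hsq : (√2 ^ n) ^ 2 = (2 : ℝ) ^ n := by
          rw [← pow_mul, mul_comm, pow_mul, Real.sq_sqrt (by norm_num)]
        have e1 : Real.exp (-(5 * √2 ^ n) ^ 2 / 2) ≤ (1 / 4096) ^ 2 ^ n := by
          have h12 : (4096 : ℝ) ≤ Real.exp 12 := by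
            have h2 : (2 : ℝ) ≤ Real.exp 1 := by linarith [Real.add_one_le_exp 1]
            have : Real.exp 12 = Real.exp 1 ^ 12 := by rw [← Real.exp_nat_mul]; norm_num
            rw [this]
            calc (4096 : ℝ) = 2 ^ 12 := by norm_num
              _ ≤ _ := by gcongr
          calc Real.exp (-(5 * √2 ^ n) ^ 2 / 2) ≤ Real.exp ((2 ^ n : ℕ) * (-12)) := by
                apply Real.exp_le_exp.2
                rw [mul_pow, hsq]; push_cast
                have : (0 : ℝ) < 2 ^ n := by positivity
                linarith
            _ = (Real.exp 12)⁻¹ ^ 2 ^ n := by rw [Real.exp_nat_mul, Real.exp_neg]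
            _ ≤ _ := by rw [one_div]; gcongr
        have e2 : ((8 ^ 2 ^ n * 8 ^ 2 ^ (n + 1) : ℕ) : ℝ) = 512 ^ 2 ^ n := by
          push_cast
          rw [pow_succ 2 n, mul_comm (2 ^ n) 2, pow_mul, ← mul_pow]; norm_num
        rw [e2]
        calc (512 : ℝ) ^ 2 ^ n * (2 * Real.exp (-(5 * √2 ^ n) ^ 2 / 2))
            ≤ 512 ^ 2 ^ n * (2 * (1 / 4096) ^ 2 ^ n) := by gcongr
          _ = 2 * (1 / 8) ^ 2 ^ n := by
              rw [mul_left_comm, ← mul_pow]; norm_num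
          _ ≤ 2 * (1 / 8) ^ (n + 1) := by
              apply mul_le_mul_of_nonneg_left _ (by norm_num)
              exact pow_le_pow_of_le_one (by norm_num) (by norm_num)
                (Nat.lt_two_pow_self)
          _ = _ := by ring
      rw [Fin.sum_univ_eq_sum_range (fun n => ((8 ^ 2 ^ n * 8 ^ 2 ^ (n + 1) : ℕ) : ℝ) *
          (2 * Real.exp (-(5 * √2 ^ n) ^ 2 / 2))) L]
      calc _ ≤ ∑ n ∈ Finset.range L, 2 / 8 * (1 / 8 : ℝ) ^ n :=
            Finset.sum_le_sum fun n _ => hterm n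
        _ ≤ 2 / 8 * (1 - 1 / 8)⁻¹ := by
            rw [← Finset.mul_sum]
            apply mul_le_mul_of_nonneg_left _ (by norm_num)
            rw [← tsum_geometric_of_lt_one (by norm_num) (by norm_num)]
            exact Summable.sum_le_tsum _ (fun _ _ => by positivity)
              (summable_geometric_of_lt_one (by norm_num) (by norm_num))
        _ < 1 := by norm_num)
  refine ⟨σ, fun t => ?_⟩
  set S : EuclideanSpace ℝ J → ℝ := fun v => ∑ j, boolSign (σ j) * v j with hS
  have hSsub : ∀ v w, S (v - w) = S v - S w := by
    intro v w
    simp [hS, mul_sub, Finset.sum_sub_distrib]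
  -- Chaining stops at level L: since there are at most 2^L coordinates, Cauchy–Schwarz alone
  -- controls the last increment by √2^L times its norm. The constant 11 is 5 + 5 for the two ends
  -- of the links plus 1 for this increment.
  have hSbd : ∀ v, |S v| ≤ √2 ^ L * ‖v‖ := by
    intro v
    have h1 : |S v| ≤ ∑ j, |v j| := by
      refine (Finset.abs_sum_le_sum_abs _ _).trans (Finset.sum_le_sum fun j _ => ?_)
      rw [abs_mul, abs_boolSign, one_mul]
    have h2 : (∑ j, |v j|) ^ 2 ≤ Fintype.card J * ‖v‖ ^ 2 := by
      have := sq_sum_le_card_mul_sum_sq (s := Finset.univ) (f := fun j => |v j|)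
      simpa [EuclideanSpace.real_norm_sq_eq] using this
    have h3 : (Fintype.card J : ℝ) ≤ (√2 ^ L) ^ 2 := by
      rw [← pow_mul, mul_comm, pow_mul, Real.sq_sqrt (by norm_num)]
      exact_mod_cast hJ
    refine h1.trans (abs_le_of_sq_le_sq' ?_ (by positivity)).2
    rw [mul_pow]
    exact h2.trans (mul_le_mul_of_nonneg_right h3 (by positivity))
  set ρ : ℕ → T := fun n => rep n (a n t) with hρ
  have hlink : ∀ n ∈ Finset.range L, |S (X (ρ (n + 1))) - S (X (ρ n))|
      ≤ 5 * (√2 ^ n * δ n t) + 5 * (√2 ^ (n + 1) * δ (n + 1) t) := by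
    intro n hn
    have h1 := hσ ⟨⟨n, Finset.mem_range.1 hn⟩, (a n t, a (n + 1) t)⟩
    rw [← hSsub]
    refine h1.trans ?_
    have h2 : ‖X (ρ (n + 1)) - X (ρ n)‖ ≤ δ (n + 1) t + δ n t := by
      have : X (ρ (n + 1)) - X (ρ n) = (X t - X (ρ n)) - (X t - X (ρ (n + 1))) := by abel
      rw [this]
      refine (norm_sub_le _ _).trans ?_
      linarith [hrep n t, hrep (n + 1) t]
    have h3 : 0 ≤ δ (n + 1) t := (norm_nonneg _).trans (hrep (n + 1) t)
    have h4 : (1 : ℝ) ≤ √2 := by rw [Real.one_le_sqrt]; norm_num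
    have h5 : (0 : ℝ) < √2 ^ n := by positivity
    calc _ ≤ 5 * √2 ^ n * (δ (n + 1) t + δ n t) :=
          mul_le_mul_of_nonneg_left h2 (by positivity)
      _ ≤ _ := by
          rw [pow_succ]
          have : √2 ^ n * δ (n + 1) t * 1 ≤ √2 ^ n * δ (n + 1) t * √2 :=
            mul_le_mul_of_nonneg_left h4 (by positivity)
          linarith
  have hδ0 : ∀ n, 0 ≤ √2 ^ n * δ n t := fun n =>
    mul_nonneg (by positivity) ((norm_nonneg _).trans (hrep n t))
  have htel := Finset.sum_range_sub (fun n => S (X (ρ n))) L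
  have hz : S (X (ρ 0)) = 0 := by simp [hρ, hrep0, hX0, hS]
  have hlast : |S (X t) - S (X (ρ L))| ≤ √2 ^ L * δ L t := by
    rw [← hSsub]
    exact (hSbd _).trans (mul_le_mul_of_nonneg_left (hrep L t) (by positivity))
  have hsum : |S (X (ρ L))| ≤ 5 * ∑ n ∈ Finset.range L, √2 ^ n * δ n t
      + 5 * ∑ n ∈ Finset.range L, √2 ^ (n + 1) * δ (n + 1) t := by
    rw [hz, sub_zero] at htel
    rw [← htel, Finset.mul_sum, Finset.mul_sum, ← Finset.sum_add_distrib]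
    exact (Finset.abs_sum_le_sum_abs _ _).trans (Finset.sum_le_sum hlink)
  have e1 := Finset.sum_range_succ (fun n => √2 ^ n * δ n t) L
  have e2 := Finset.sum_range_succ' (fun n => √2 ^ n * δ n t) L
  have e3 : |S (X t)| ≤ |S (X t) - S (X (ρ L))| + |S (X (ρ L))| := by
    have := abs_add_le (S (X t) - S (X (ρ L))) (S (X (ρ L)))
    rwa [sub_add_cancel] at this
  have e4 : 0 ≤ ∑ n ∈ Finset.range L, √2 ^ n * δ n t := Finset.sum_nonneg fun n _ => hδ0 n
  have := hδ0 0
  have := hδ0 L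
  change |S (X t)| ≤ _
  linarith

end Signs

/-! ### Interpolation in a uniformly convex body -/

section Interpolation

variable {E : Type*} [NormedAddCommGroup E] [InnerProductSpace ℝ E]
  {J : Type*}

/-- The vector of signed `q`-th powers of the values of `x` at the nodes. -/
noncomputable def signedVec (l : J → E →L[ℝ] ℂ) (q : ℝ) (x : E) : EuclideanSpace ℂ J :=
  WithLp.toLp 2 fun j => signedPow q (l j x)

theorem continuous_signedVec {l : J → E →L[ℝ] ℂ} {q : ℝ} (hq : 2 ≤ q) : Continuous (signedVec l q) := by
  unfold signedVec
  refine (PiLp.continuous_toLp 2 _).comp (continuous_pi fun j => ?_)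
  unfold signedPow
  exact (((l j).continuous.norm).rpow_const fun _ => Or.inr (by linarith)).smul (l j).continuous

variable [Fintype J]

/-- The `q`-th power sum of the values of `x` at the nodes. -/
noncomputable def powSum (l : J → E →L[ℝ] ℂ) (q : ℝ) (x : E) : ℝ := ∑ j, ‖l j x‖ ^ q

variable {l : J → E →L[ℝ] ℂ} {q : ℝ}

theorem powSum_nonneg (x : E) : 0 ≤ powSum l q x :=
  Finset.sum_nonneg fun _ _ => by positivity

theorem powSum_smul (t : ℝ) (x : E) : powSum l q (t • x) = |t| ^ q * powSum l q x := by
  unfold powSum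
  rw [Finset.mul_sum]
  refine Finset.sum_congr rfl fun j _ => ?_
  rw [map_smul, norm_smul, Real.norm_eq_abs, Real.mul_rpow (abs_nonneg _) (norm_nonneg _)]

theorem continuous_powSum (hq : 2 ≤ q) : Continuous (powSum l q) := by
  unfold powSum
  refine continuous_finsetSum _ fun j _ => ?_
  exact ((l j).continuous.norm).rpow_const fun _ => Or.inr (by linarith)

theorem powSum_clarkson (hq : 2 ≤ q) (x y : E) :
    powSum l q ((1 / 2 : ℝ) • (x + y)) + powSum l q ((1 / 2 : ℝ) • (x - y))
      ≤ (powSum l q x + powSum l q y) / 2 := by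
  unfold powSum
  rw [← Finset.sum_add_distrib, ← Finset.sum_add_distrib, Finset.sum_div]
  refine Finset.sum_le_sum fun j _ => ?_
  have := clarkson_rpow hq (l j x) (l j y)
  simpa only [map_smul, map_add, map_sub] using this

theorem norm_signedVec_sub_midpoint_le (hq : 2 ≤ q) (x y : E) :
    ‖signedVec l q x - signedVec l q ((1 / 2 : ℝ) • (x + y))‖
      ≤ 2 * q * ‖signedVec l q x - signedVec l q y‖ := by
  refine (abs_le_of_sq_le_sq' ?_ (by positivity)).2
  rw [mul_pow, EuclideanSpace.norm_sq_eq, EuclideanSpace.norm_sq_eq, Finset.mul_sum]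
  refine Finset.sum_le_sum fun j _ => ?_
  have := norm_signedPow_sub_midpoint_le hq (l j x) (l j y)
  rw [← mul_pow]
  simp only [signedVec, PiLp.sub_apply, map_smul, map_add] at *
  gcongr

theorem norm_le_of_powSum_le {W : ℝ} (hW : 0 < W) (hq : 2 ≤ q)
    (hlow : ∀ x, W * ‖x‖ ^ q ≤ powSum l q x) {r : ℝ} (hr : 0 ≤ r) {x : E}
    (hx : powSum l q x ≤ W * r ^ q) : ‖x‖ ≤ r :=
  (Real.rpow_le_rpow_iff (norm_nonneg _) hr (by linarith)).1
    (le_of_mul_le_mul_left ((hlow x).trans hx) hW)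

/-- The lower bound by the Euclidean norm makes the ball compact, so the continuous functional
attains its minimum. -/
theorem exists_interpolant [FiniteDimensional ℝ E] {W : ℝ} (hW : 0 < W) (hq : 2 ≤ q)
    (hlow : ∀ x, W * ‖x‖ ^ q ≤ powSum l q x) (c : ℝ) (x : E) (hx : powSum l q x ≤ W) :
    ∃ u, powSum l q u ≤ W ∧ ∀ y, powSum l q y ≤ W →
      powSum l q u / W + c * ‖signedVec l q x - signedVec l q u‖
        ≤ powSum l q y / W + c * ‖signedVec l q x - signedVec l q y‖ := by
  have hcpt : IsCompact {y : E | powSum l q y ≤ W} := by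
    refine Metric.isCompact_of_isClosed_isBounded
      (isClosed_le (continuous_powSum hq) continuous_const) ?_
    refine (Metric.isBounded_closedBall (x := (0 : E)) (r := 1)).subset fun y hy => ?_
    rw [mem_closedBall_zero_iff]
    exact norm_le_of_powSum_le hW hq hlow zero_le_one (by rw [Real.one_rpow, mul_one]; exact hy)
  obtain ⟨u, hu, hmin⟩ := hcpt.exists_isMinOn ⟨x, hx⟩
    (f := fun y => powSum l q y / W + c * ‖signedVec l q x - signedVec l q y‖)
    ((((continuous_powSum hq).div_const W).add
      (continuous_const.mul (continuous_const.sub (continuous_signedVec hq)).norm)).continuousOn)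
  exact ⟨u, hu, fun y hy => hmin hy⟩

/-- The midpoint of u and v competes in both minimizations. Clarkson's inequality lowers its power
sum by an amount governed by u-v, while each distance term grows by at most 2qc times the
signed-power distance of u and v. Minimality bounds the gain by the loss. -/
theorem powSum_sub_interpolant_le {W : ℝ} (hW : 0 < W) (hq : 2 ≤ q) {c : ℝ} (hc : 0 ≤ c)
    {x y u v : E} (hu : powSum l q u ≤ W) (hv : powSum l q v ≤ W)
    (hux : ∀ z, powSum l q z ≤ W → powSum l q u / W + c * ‖signedVec l q x - signedVec l q u‖
        ≤ powSum l q z / W + c * ‖signedVec l q x - signedVec l q z‖)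
    (hvy : ∀ z, powSum l q z ≤ W → powSum l q v / W + c * ‖signedVec l q y - signedVec l q v‖
        ≤ powSum l q z / W + c * ‖signedVec l q y - signedVec l q z‖) :
    powSum l q (u - v) ≤ W * (2 ^ (q + 1) * q * c * ‖signedVec l q u - signedVec l q v‖) := by
  set z := (1 / 2 : ℝ) • (u + v) with hz
  have hcl := powSum_clarkson (l := l) hq u v
  rw [← hz] at hcl
  have h0 := powSum_nonneg (l := l) (q := q) ((1 / 2 : ℝ) • (u - v))
  have hzW : powSum l q z ≤ W := by linarith
  have h1 := hux z hzW
  have h2 := hvy z hzW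
  have t1 : ‖signedVec l q x - signedVec l q z‖
      ≤ ‖signedVec l q x - signedVec l q u‖ + ‖signedVec l q u - signedVec l q z‖ :=
    norm_sub_le_norm_sub_add_norm_sub _ _ _
  have t2 : ‖signedVec l q y - signedVec l q z‖
      ≤ ‖signedVec l q y - signedVec l q v‖ + ‖signedVec l q v - signedVec l q z‖ :=
    norm_sub_le_norm_sub_add_norm_sub _ _ _
  have m1 := norm_signedVec_sub_midpoint_le (l := l) hq u v
  have m2 := norm_signedVec_sub_midpoint_le (l := l) hq v u
  rw [← hz] at m1
  rw [add_comm v u, ← hz, norm_sub_rev (signedVec l q v) (signedVec l q u)] at m2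
  set d := ‖signedVec l q u - signedVec l q v‖
  have k1 : c * ‖signedVec l q x - signedVec l q z‖
      ≤ c * ‖signedVec l q x - signedVec l q u‖ + c * (2 * q * d) := by
    rw [← mul_add]; exact mul_le_mul_of_nonneg_left (by linarith) hc
  have k2 : c * ‖signedVec l q y - signedVec l q z‖
      ≤ c * ‖signedVec l q y - signedVec l q v‖ + c * (2 * q * d) := by
    rw [← mul_add]; exact mul_le_mul_of_nonneg_left (by linarith) hc
  have k3 : (powSum l q u + powSum l q v) / W
      ≤ 2 * (powSum l q z / W) + 2 * (c * (2 * q * d)) := by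
    rw [add_div]; linarith
  have k4 : powSum l q u + powSum l q v ≤ 2 * powSum l q z + 2 * (c * (2 * q * d)) * W := by
    have := mul_le_mul_of_nonneg_right k3 hW.le
    rw [div_mul_cancel₀ _ hW.ne', add_mul, mul_assoc, div_mul_cancel₀ _ hW.ne'] at this
    exact this
  have k5 : powSum l q ((1 / 2 : ℝ) • (u - v)) ≤ c * (2 * q * d) * W := by linarith
  rw [powSum_smul, abs_of_pos (by norm_num), one_div, Real.inv_rpow (by norm_num),
    inv_mul_le_iff₀ (by positivity)] at k5
  refine k5.trans (le_of_eq ?_)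
  rw [Real.rpow_add_one (by norm_num)]; ring

/-- The hypothesis `hle` says that the interpolant of scale n+1 competes at scale n. Since √2 ≥ 4/3,
raising the weight from √2^m to √2^(m+1) leaves room for one more summand, so the bound propagates
by induction. -/
theorem sum_interpolation_le {c : ℝ} (hc : 0 ≤ c) (a s : ℕ → ℝ) (ha : ∀ n, 0 ≤ a n)
    (hs : ∀ n, 0 ≤ s n) (hle : ∀ n, a n + c * √2 ^ n * s n ≤ a (n + 1) + c * √2 ^ n * s (n + 1))
    (m : ℕ) : c * ∑ n ∈ Finset.range (m + 1), √2 ^ n * s n ≤ 4 * (a m + c * √2 ^ m * s m) := by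
  have h2 : (4 : ℝ) / 3 ≤ √2 := by
    apply Real.le_sqrt_of_sq_le; norm_num
  induction m with
  | zero =>
    have := mul_nonneg hc (hs 0)
    simp only [zero_add, Finset.range_one, Finset.sum_singleton, pow_zero, one_mul, mul_one]
    linarith [ha 0]
  | succ m ih =>
    rw [Finset.sum_range_succ, mul_add]
    have h3 := hle m
    have h4 : 0 ≤ c * √2 ^ m * s (m + 1) := mul_nonneg (by positivity) (hs _)
    have h5 : c * √2 ^ m * s (m + 1) * (4 / 3) ≤ c * √2 ^ (m + 1) * s (m + 1) := by
      rw [pow_succ]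
      have := mul_le_mul_of_nonneg_left h2 h4
      linarith
    linarith

/-- The power 2q-2 splits as (q-2) + q; the first factor is bounded uniformly by √D·r, the second
summed. -/
theorem sum_rpow_two_mul_sub_two_le {W D : ℝ} (hW : 0 < W) (hq : 2 ≤ q)
    (hl : ∀ j x, ‖l j x‖ ≤ √D * ‖x‖)
    (hlow : ∀ x, W * ‖x‖ ^ q ≤ powSum l q x) {r : ℝ} (hr : 0 ≤ r) {x : E}
    (hx : powSum l q x ≤ W * r ^ q) :
    ∑ j, (‖l j x‖ ^ (q - 1)) ^ 2 ≤ (√D * r) ^ (q - 2) * (W * r ^ q) := by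
  have hn := norm_le_of_powSum_le hW hq hlow hr hx
  calc ∑ j, (‖l j x‖ ^ (q - 1)) ^ 2 ≤ ∑ j, (√D * r) ^ (q - 2) * ‖l j x‖ ^ q := by
        refine Finset.sum_le_sum fun j _ => ?_
        have e : (‖l j x‖ ^ (q - 1)) ^ 2 = ‖l j x‖ ^ (q - 2) * ‖l j x‖ ^ q := by
          rw [← Real.rpow_natCast, ← Real.rpow_mul (norm_nonneg _),
            ← Real.rpow_add_of_nonneg (norm_nonneg _) (by linarith) (by linarith)]
          congr 1; push_cast; ring
        rw [e]
        apply mul_le_mul_of_nonneg_right _ (by positivity)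
        apply Real.rpow_le_rpow (norm_nonneg _) _ (by linarith)
        exact (hl j x).trans (mul_le_mul_of_nonneg_left hn (Real.sqrt_nonneg _))
    _ = (√D * r) ^ (q - 2) * powSum l q x := by rw [← Finset.mul_sum, powSum]
    _ ≤ _ := mul_le_mul_of_nonneg_left hx (by positivity)

/-- Signed-power distance is a weighted ℓ₂ distance whose weights depend on u and u'. Expanding
around the fixed centre u₀ separates the fixed weights |l_j u₀|^(q-1), handled by `h2` and giving
the term r, from the deviations |l_j(u-u₀)|^(q-1). The latter have small square sum and are paired
with the supremum bound `hinf`, giving √L·r^q. -/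
theorem norm_signedVec_sub_le_of_cell {W D Γ L p : ℝ} (hW : 0 < W) (hD : 0 < D) (hq : 2 ≤ q)
    (hΓ : 0 ≤ Γ) (hL : 0 ≤ L) (hΓ2 : Γ ^ 2 = D ^ (q / 2) * W)
    (hl : ∀ j x, ‖l j x‖ ≤ √D * ‖x‖)
    (hlow : ∀ x, W * ‖x‖ ^ q ≤ powSum l q x) {r : ℝ} (hr : 0 ≤ r) (hp : 0 ≤ p) {u u' u₀ : E}
    (hu : powSum l q (u - u₀) ≤ W * r ^ q) (hu' : powSum l q (u' - u₀) ≤ W * r ^ q)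
    (h2 : ∑ j, (‖l j u₀‖ ^ (q - 1)) ^ 2 * ‖l j (u - u')‖ ^ 2 ≤ 32 * Γ ^ 2 * (4 * r * p) ^ 2)
    (hinf : ∀ j, ‖l j (u - u')‖ ≤ √(40 * D * L) * (4 * r * p)) :
    ‖signedVec l q u - signedVec l q u'‖
      ≤ 20 * q * 2 ^ q * (p * Γ * (r + √L * r ^ q)) := by
  set b : J → ℝ := fun j => ‖l j u₀‖ ^ (q - 1) with hb
  set h : J → ℝ := fun j => ‖l j (u - u₀)‖ ^ (q - 1) with hh
  set h' : J → ℝ := fun j => ‖l j (u' - u₀)‖ ^ (q - 1) with hh'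
  have hb0 : ∀ j, 0 ≤ b j := fun j => by positivity
  have hh0 : ∀ j, 0 ≤ h j := fun j => by positivity
  have hh0' : ∀ j, 0 ≤ h' j := fun j => by positivity
  set A : ℝ := q * 2 ^ (q - 2) with hA
  have hA0 : 0 ≤ A := by positivity
  have hgrow : ∀ j (w : E), ‖l j w‖ ^ (q - 1)
      ≤ 2 ^ (q - 2) * (b j + ‖l j (w - u₀)‖ ^ (q - 1)) := by
    intro j w
    have e : ‖l j w‖ ≤ ‖l j u₀‖ + ‖l j (w - u₀)‖ := by
      have : l j w = l j u₀ + l j (w - u₀) := by rw [← map_add]; congr 1; abel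
      rw [this]; exact norm_add_le _ _
    refine (Real.rpow_le_rpow (norm_nonneg _) e (by linarith)).trans ?_
    have := add_rpow_le_two_rpow (p := q - 1) (by linarith) (norm_nonneg (l j u₀))
      (norm_nonneg (l j (w - u₀)))
    rwa [show q - 1 - 1 = q - 2 by ring] at this
  have hpt : ∀ j, ‖signedPow q (l j u) - signedPow q (l j u')‖ ^ 2
      ≤ A ^ 2 * (12 * (b j ^ 2 * ‖l j (u - u')‖ ^ 2) +
        3 * ((h j ^ 2 + h' j ^ 2) * ‖l j (u - u')‖ ^ 2)) := by
    intro j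
    have e1 := norm_signedPow_sub_le hq (l j u) (l j u')
    rw [← map_sub] at e1
    have e2 : ‖signedPow q (l j u) - signedPow q (l j u')‖
        ≤ A * ((2 * b j + h j + h' j) * ‖l j (u - u')‖) := by
      refine e1.trans ?_
      rw [← mul_assoc, hA]
      apply mul_le_mul_of_nonneg_right _ (norm_nonneg _)
      rw [mul_assoc q]
      apply mul_le_mul_of_nonneg_left _ (by linarith)
      have := hgrow j u
      have := hgrow j u'
      simp only [hh, hh']
      linarith
    calc _ ≤ (A * ((2 * b j + h j + h' j) * ‖l j (u - u')‖)) ^ 2 := by gcongr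
      _ = A ^ 2 * ((2 * b j + h j + h' j) ^ 2 * ‖l j (u - u')‖ ^ 2) := by ring
      _ ≤ A ^ 2 * ((12 * b j ^ 2 + 3 * (h j ^ 2 + h' j ^ 2)) * ‖l j (u - u')‖ ^ 2) := by
          apply mul_le_mul_of_nonneg_left _ (by positivity)
          apply mul_le_mul_of_nonneg_right _ (by positivity)
          nlinarith [sq_nonneg (2 * b j - h j), sq_nonneg (2 * b j - h' j),
            sq_nonneg (h j - h' j)]
      _ = _ := by ring
  have hs1 := sum_rpow_two_mul_sub_two_le hW hq hl hlow hr hu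
  have hs2 := sum_rpow_two_mul_sub_two_le hW hq hl hlow hr hu'
  have hS : ∑ j, (h j ^ 2 + h' j ^ 2) ≤ 2 * ((√D * r) ^ (q - 2) * (W * r ^ q)) := by
    rw [Finset.sum_add_distrib]; linarith
  have hinf2 : ∀ j, ‖l j (u - u')‖ ^ 2 ≤ 40 * D * L * (4 * r * p) ^ 2 := by
    intro j
    calc _ ≤ (√(40 * D * L) * (4 * r * p)) ^ 2 := by
          have := hinf j
          gcongr
      _ = _ := by rw [mul_pow, Real.sq_sqrt (by positivity)]
  have hsecond : ∑ j, (h j ^ 2 + h' j ^ 2) * ‖l j (u - u')‖ ^ 2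
      ≤ 1280 * L * p ^ 2 * Γ ^ 2 * (r ^ q) ^ 2 := by
    calc _ ≤ ∑ j, (h j ^ 2 + h' j ^ 2) * (40 * D * L * (4 * r * p) ^ 2) := by
          refine Finset.sum_le_sum fun j _ => ?_
          exact mul_le_mul_of_nonneg_left (hinf2 j) (by positivity)
      _ ≤ 2 * ((√D * r) ^ (q - 2) * (W * r ^ q)) * (40 * D * L * (4 * r * p) ^ 2) := by
          rw [← Finset.sum_mul]
          exact mul_le_mul_of_nonneg_right hS (by positivity)
      _ = 1280 * L * p ^ 2 * (((√D) ^ (q - 2) * √D ^ 2) * W) * ((r ^ (q - 2) * r ^ 2) * r ^ q) := by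
          rw [Real.mul_rpow (Real.sqrt_nonneg _) hr, Real.sq_sqrt hD.le]; ring
      _ = _ := by
          have e1 : ∀ y : ℝ, 0 ≤ y → y ^ (q - 2) * y ^ 2 = y ^ q := by
            intro y hy
            rw [← Real.rpow_natCast y 2, ← Real.rpow_add_of_nonneg hy (by linarith) (by norm_num)]
            congr 1; push_cast; ring
          rw [e1 _ (Real.sqrt_nonneg _), e1 _ hr, hΓ2, ← rpow_half_sq (Real.sqrt_nonneg _),
            Real.sq_sqrt hD.le]
          ring
  have htot : ‖signedVec l q u - signedVec l q u'‖ ^ 2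
      ≤ A ^ 2 * (6400 * (p * Γ) ^ 2 * (r ^ 2 + L * (r ^ q) ^ 2)) := by
    rw [EuclideanSpace.norm_sq_eq]
    calc _ ≤ ∑ j, A ^ 2 * (12 * (b j ^ 2 * ‖l j (u - u')‖ ^ 2) +
        3 * ((h j ^ 2 + h' j ^ 2) * ‖l j (u - u')‖ ^ 2)) :=
          Finset.sum_le_sum fun j _ => hpt j
      _ = A ^ 2 * (12 * ∑ j, (b j ^ 2 * ‖l j (u - u')‖ ^ 2) +
        3 * ∑ j, ((h j ^ 2 + h' j ^ 2) * ‖l j (u - u')‖ ^ 2)) := by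
          rw [← Finset.mul_sum, Finset.sum_add_distrib, Finset.mul_sum, Finset.mul_sum]
      _ ≤ _ := by
          apply mul_le_mul_of_nonneg_left _ (by positivity)
          have e1 : 0 ≤ (p * Γ) ^ 2 * r ^ 2 := by positivity
          have e2 : 0 ≤ (p * Γ) ^ 2 * (L * (r ^ q) ^ 2) := by positivity
          nlinarith
  refine (abs_le_of_sq_le_sq' ?_ (by positivity)).2
  refine htot.trans ?_
  have hA2 : 20 * q * 2 ^ q = 80 * A := by
    rw [hA, Real.rpow_sub (by norm_num)]
    norm_num; ring
  rw [hA2]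
  have e3 : (r + √L * r ^ q) ^ 2 = r ^ 2 + L * (r ^ q) ^ 2 + 2 * (r * (√L * r ^ q)) := by
    have : √L ^ 2 = L := Real.sq_sqrt hL
    calc _ = r ^ 2 + √L ^ 2 * (r ^ q) ^ 2 + 2 * (r * (√L * r ^ q)) := by ring
      _ = _ := by rw [this]
  have e4 : 0 ≤ r * (√L * r ^ q) := by positivity
  calc _ ≤ A ^ 2 * (6400 * (p * Γ) ^ 2 * (r + √L * r ^ q) ^ 2) := by
        rw [e3]
        apply mul_le_mul_of_nonneg_left _ (by positivity)
        apply mul_le_mul_of_nonneg_left _ (by positivity)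
        linarith
    _ = _ := by ring

theorem norm_signedVec_le {W D Γ : ℝ} (hW : 0 < W) (hD : 0 < D) (hq : 2 ≤ q) (hΓ : 0 < Γ)
    (hΓ2 : Γ ^ 2 = D ^ (q / 2) * W) (hl : ∀ j x, ‖l j x‖ ≤ √D * ‖x‖)
    (hlow : ∀ x, W * ‖x‖ ^ q ≤ powSum l q x) {x : E} (hx : powSum l q x ≤ W) :
    ‖signedVec l q x‖ ≤ Γ := by
  have hn := norm_le_of_powSum_le hW hq hlow zero_le_one (x := x)
      (by rw [Real.one_rpow, mul_one]; exact hx)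
  refine (abs_le_of_sq_le_sq' ?_ hΓ.le).2
  rw [EuclideanSpace.norm_sq_eq, hΓ2]
  calc _ ≤ ∑ j, D ^ (q / 2) * ‖l j x‖ ^ q := by
        refine Finset.sum_le_sum fun j _ => ?_
        simp only [signedVec]
        rw [norm_signedPow hq, sq]
        apply mul_le_mul_of_nonneg_right _ (by positivity)
        rw [← Real.sq_sqrt hD.le, rpow_half_sq (Real.sqrt_nonneg _)]
        apply Real.rpow_le_rpow (norm_nonneg _) _ (by linarith)
        exact (hl j x).trans (mul_le_of_le_one_right (Real.sqrt_nonneg _) hn)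
    _ = D ^ (q / 2) * powSum l q x := by rw [← Finset.mul_sum, powSum]
    _ ≤ _ := mul_le_mul_of_nonneg_left hx (by positivity)

/-- The balance that fixes the exponent 1-1/q. With Y = pΓL^(-1/q) one has (pΓr)^q = τXY^(q-1) ≤
τ(X+Y)^q, which controls the linear term; the other is at most τX because √L ≤ L^(1-1/q), where q ≥
2 enters. -/
theorem cell_radius_le {C Γ L p X τ r : ℝ} (hC : 1 ≤ C) (hq : 2 ≤ q) (hΓ : 0 < Γ) (hL : 1 ≤ L)
    (hp : 0 < p) (hX : 0 ≤ X) (hτ : τ = (1 / (16 * C)) ^ q) (hr : 0 ≤ r)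
    (hrq : r ^ q = τ * X / (p * Γ * L ^ (1 - 1 / q))) :
    C * (p * Γ * (r + √L * r ^ q)) ≤ (X + p * Γ * L ^ (-(1 / q))) / 8 := by
  set Y := p * Γ * L ^ (-(1 / q)) with hY
  have hY0 : 0 < Y := by positivity
  have hLq : √L ≤ L ^ (1 - 1 / q) := by
    rw [Real.sqrt_eq_rpow]
    apply Real.rpow_le_rpow_of_exponent_le hL
    have : 1 / q ≤ 1 / 2 := one_div_le_one_div_of_le (by norm_num) hq
    linarith
  have hLp : 0 < L ^ (1 - 1 / q) := by positivity
  have ht1 : τ ≤ 1 / (16 * C) := by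
    rw [hτ]
    calc (1 / (16 * C)) ^ q ≤ (1 / (16 * C)) ^ (1 : ℝ) := by
          apply Real.rpow_le_rpow_of_exponent_ge (by positivity) _ (by linarith)
          rw [div_le_one (by positivity)]; linarith
      _ = _ := Real.rpow_one _
  have hτ0 : 0 ≤ τ := by rw [hτ]; positivity
  have e1 : p * Γ * (√L * r ^ q) ≤ τ * X := by
    rw [hrq]
    calc p * Γ * (√L * (τ * X / (p * Γ * L ^ (1 - 1 / q))))
        = τ * X * (√L / L ^ (1 - 1 / q)) := by field_simp
      _ ≤ τ * X * 1 := by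
          apply mul_le_mul_of_nonneg_left _ (by positivity)
          rwa [div_le_one hLp]
      _ = _ := mul_one _
  have e2 : p * Γ * r ≤ 1 / (16 * C) * (X + Y) := by
    refine (Real.rpow_le_rpow_iff (z := q) (by positivity) (by positivity) (by linarith)).1 ?_
    rw [Real.mul_rpow (x := p * Γ) (by positivity) hr,
      Real.mul_rpow (x := 1 / (16 * C)) (by positivity) (by positivity), ← hτ, hrq]
    have e3 : (p * Γ) ^ q / (p * Γ * L ^ (1 - 1 / q)) = Y ^ (q - 1) := by
      rw [hY, Real.mul_rpow (x := p * Γ) (z := q - 1) (by positivity) (by positivity),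
        ← Real.rpow_mul (by linarith),
        Real.rpow_sub_one (by positivity) q]
      have : -(1 / q) * (q - 1) = -(1 - 1 / q) := by field_simp
      rw [this, Real.rpow_neg (by linarith)]
      field_simp
    calc (p * Γ) ^ q * (τ * X / (p * Γ * L ^ (1 - 1 / q)))
        = τ * (X * ((p * Γ) ^ q / (p * Γ * L ^ (1 - 1 / q)))) := by ring
      _ = τ * (X * Y ^ (q - 1)) := by rw [e3]
      _ ≤ τ * ((X + Y) * (X + Y) ^ (q - 1)) := by
          apply mul_le_mul_of_nonneg_left _ hτ0
          apply mul_le_mul (by linarith) _ (by positivity) (by linarith)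
          apply Real.rpow_le_rpow hY0.le (by linarith) (by linarith)
      _ = τ * (X + Y) ^ q := by
          rw [Real.rpow_sub_one (by positivity)]; field_simp
  have e5 : p * Γ * (r + √L * r ^ q) ≤ 1 / (16 * C) * (X + Y) + 1 / (16 * C) * X := by
    rw [mul_add]
    have := mul_le_mul_of_nonneg_right ht1 hX
    linarith
  calc _ ≤ C * (1 / (16 * C) * (X + Y) + 1 / (16 * C) * X) :=
        mul_le_mul_of_nonneg_left e5 (by linarith)
    _ = (2 * X + Y) / 16 := by field_simp; ring
    _ ≤ _ := by linarith

end Interpolation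

/-! ### Refining cells and selecting signs -/

section SignSelection

variable {E : Type*} [NormedAddCommGroup E] [InnerProductSpace ℝ E] [FiniteDimensional ℝ E]
  [MeasurableSpace E] [BorelSpace E] {J : Type*} [Fintype J] {l : J → E →L[ℝ] ℂ} {q : ℝ}

/-- The small constant in the interpolation functional. -/
noncomputable def interpTau (q : ℝ) : ℝ := (1 / (16 * (20 * q * 2 ^ q))) ^ q

/-- The small constant in the interpolation functional, normalized. -/
noncomputable def interpKappa (q : ℝ) : ℝ := interpTau q / (2 ^ (q + 1) * q)

theorem interpTau_pos {q : ℝ} (hq : 2 ≤ q) : 0 < interpTau q := by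
  unfold interpTau; positivity

theorem interpKappa_pos {q : ℝ} (hq : 2 ≤ q) : 0 < interpKappa q :=
  div_pos (interpTau_pos hq) (by positivity)

theorem sq_mul_rpow_sub_two {q y : ℝ} (hq : 2 ≤ q) (hy : 0 ≤ y) :
    y ^ 2 * y ^ (q - 2) = y ^ q := by
  rw [← Real.rpow_natCast y 2, ← Real.rpow_add_of_nonneg hy (by norm_num) (by linarith)]
  congr 1; push_cast; ring

/-- One refinement step. In a cell of diameter δ whose points are within σ of their interpolants,
the interpolants are δ+2σ close and hence, by uniform convexity, lie in a small ball. Cutting that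
ball contracts their distance to one eighth; returning to the points costs 2σ. -/
theorem exists_labelling_of_interpolants {W D Γ : ℝ} (hW : 0 < W) (hD : 0 < D) (hq : 2 ≤ q)
    (hΓ : 0 < Γ) {L : ℕ} (hL : 1 ≤ L) (hJ : Fintype.card J ≤ 2 ^ L)
    (hΓ2 : Γ ^ 2 = D ^ (q / 2) * W) (hl : ∀ j x, ‖l j x‖ ≤ √D * ‖x‖)
    (hlow : ∀ x, W * ‖x‖ ^ q ≤ powSum l q x) (n : ℕ) (π : E → E) (A : Set E) {δ σ : ℝ}
    (hπW : ∀ x ∈ A, powSum l q (π x) ≤ W)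
    (hπ : ∀ x ∈ A, ∀ z, powSum l q z ≤ W →
      powSum l q (π x) / W + interpKappa q / (Γ * (L : ℝ) ^ (1 - 1 / q)) * √2 ^ n *
          ‖signedVec l q x - signedVec l q (π x)‖
        ≤ powSum l q z / W + interpKappa q / (Γ * (L : ℝ) ^ (1 - 1 / q)) * √2 ^ n *
          ‖signedVec l q x - signedVec l q z‖)
    (hδ : ∀ x ∈ A, ∀ y ∈ A, ‖signedVec l q x - signedVec l q y‖ ≤ δ)
    (hσ : ∀ x ∈ A, ‖signedVec l q x - signedVec l q (π x)‖ ≤ σ) :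
    ∃ f : E → Fin (4 ^ 2 ^ n), ∀ x ∈ A, ∀ y ∈ A, f x = f y →
      ‖signedVec l q x - signedVec l q y‖
        ≤ δ / 8 + 3 * σ + Γ * (L : ℝ) ^ (-(1 / q)) / √2 ^ n / 8 := by
  rcases A.eq_empty_or_nonempty with rfl | ⟨x₀, hx₀⟩
  · exact ⟨fun _ => ⟨0, by positivity⟩, by simp⟩
  have hL' : (1 : ℝ) ≤ L := by exact_mod_cast hL
  have hL0 : (0 : ℝ) < L := by linarith
  have hρ : (0 : ℝ) < √2 ^ n := by positivity
  have hκ := interpKappa_pos hq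
  set c := interpKappa q / (Γ * (L : ℝ) ^ (1 - 1 / q)) * √2 ^ n with hc
  have hc0 : 0 < c := by positivity
  have hδ0 : 0 ≤ δ := (norm_nonneg _).trans (hδ x₀ hx₀ x₀ hx₀)
  have hσ0 : 0 ≤ σ := (norm_nonneg _).trans (hσ x₀ hx₀)
  have htri : ∀ x ∈ A, ∀ y ∈ A,
      ‖signedVec l q (π x) - signedVec l q (π y)‖ ≤ δ + 2 * σ := by
    intro x hx y hy
    have e : signedVec l q (π x) - signedVec l q (π y)
        = (signedVec l q x - signedVec l q y) - (signedVec l q x - signedVec l q (π x))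
          + (signedVec l q y - signedVec l q (π y)) := by abel
    rw [e]
    have h1 := norm_add_le ((signedVec l q x - signedVec l q y)
      - (signedVec l q x - signedVec l q (π x))) (signedVec l q y - signedVec l q (π y))
    have h2 := norm_sub_le (signedVec l q x - signedVec l q y)
      (signedVec l q x - signedVec l q (π x))
    linarith [hδ x hx y hy, hσ x hx, hσ y hy]
  -- r^q = R is the radius supplied by `powSum_sub_interpolant_le`; `interpKappa` is normalized so
  -- that `cell_radius_le` applies with X = δ+2σ.
  set R := 2 ^ (q + 1) * q * c * (δ + 2 * σ) with hR
  have hR0 : 0 ≤ R := by positivity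
  set r := R ^ (1 / q) with hr
  have hr0 : 0 ≤ r := by positivity
  have hrq : r ^ q = R := by
    rw [hr, ← Real.rpow_mul hR0, one_div_mul_cancel (by linarith), Real.rpow_one]
  have hNle : ∀ x ∈ A, ∀ y ∈ A, powSum l q (π x - π y) ≤ W * r ^ q := by
    intro x hx y hy
    refine (powSum_sub_interpolant_le hW hq hc0.le (hπW x hx) (hπW y hy) (hπ x hx)
      (hπ y hy)).trans ?_
    rw [hrq, hR]
    apply mul_le_mul_of_nonneg_left _ hW.le
    exact mul_le_mul_of_nonneg_left (htri x hx y hy) (by positivity)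
  set u₀ := π x₀ with hu₀
  have hb : D * ∑ j, (‖l j u₀‖ ^ (q - 1)) ^ 2 ≤ Γ ^ 2 := by
    have := sum_rpow_two_mul_sub_two_le hW hq hl hlow zero_le_one (x := u₀)
      (by rw [Real.one_rpow, mul_one]; exact hπW x₀ hx₀)
    rw [mul_one, Real.one_rpow, mul_one] at this
    rw [hΓ2]
    calc _ ≤ D * ((√D) ^ (q - 2) * W) := mul_le_mul_of_nonneg_left this hD.le
      _ = (√D ^ 2 * (√D) ^ (q - 2)) * W := by rw [Real.sq_sqrt hD.le]; ring
      _ = _ := by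
        rw [sq_mul_rpow_sub_two hq (Real.sqrt_nonneg _), ← rpow_half_sq (Real.sqrt_nonneg _),
          Real.sq_sqrt hD.le]
  obtain ⟨f, hf⟩ := exists_labelling_of_eval l hD hl hL hJ (fun j => ‖l j u₀‖ ^ (q - 1)) hΓ hb n
    u₀ r (π '' A) (by
      rintro _ ⟨x, hx, rfl⟩
      exact norm_le_of_powSum_le hW hq hlow hr0 (hNle x hx x₀ hx₀))
  refine ⟨f ∘ π, fun x hx y hy hxy => ?_⟩
  obtain ⟨h1, h2⟩ := hf _ ⟨x, hx, rfl⟩ _ ⟨y, hy, rfl⟩ hxy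
  have hcell := norm_signedVec_sub_le_of_cell (L := L) (p := (√2 ^ n)⁻¹) hW hD hq hΓ.le hL0.le hΓ2 hl
    hlow hr0 (by positivity) (hNle x hx x₀ hx₀) (hNle y hy x₀ hx₀)
    (by rwa [div_eq_mul_inv] at h1) (by intro j; have := h2 j; rwa [div_eq_mul_inv] at this)
  have h2q : (1 : ℝ) ≤ 2 ^ q := Real.one_le_rpow (by norm_num) (by linarith)
  have harith := cell_radius_le (C := 20 * q * 2 ^ q) (Γ := Γ) (L := L) (p := (√2 ^ n)⁻¹)
    (X := δ + 2 * σ) (τ := interpTau q) (r := r) (by nlinarith) hq hΓ hL'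
    (by positivity) (by positivity) rfl hr0 (by
      rw [hrq, hR, hc, interpKappa]
      have : (0 : ℝ) < (L : ℝ) ^ (1 - 1 / q) := by positivity
      have : (0 : ℝ) < 2 ^ (q + 1) := by positivity
      field_simp)
  have e : signedVec l q x - signedVec l q y
      = (signedVec l q x - signedVec l q (π x)) + (signedVec l q (π x) - signedVec l q (π y))
        - (signedVec l q y - signedVec l q (π y)) := by abel
  have n1 := norm_sub_le ((signedVec l q x - signedVec l q (π x))
    + (signedVec l q (π x) - signedVec l q (π y))) (signedVec l q y - signedVec l q (π y))
  have n2 := norm_add_le (signedVec l q x - signedVec l q (π x))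
    (signedVec l q (π x) - signedVec l q (π y))
  rw [← e] at n1
  have e2 : (√2 ^ n)⁻¹ * Γ * (L : ℝ) ^ (-(1 / q)) = Γ * (L : ℝ) ^ (-(1 / q)) / √2 ^ n := by
    field_simp
  rw [e2] at harith
  linarith [hσ x hx, hσ y hy]

/-- After weighting by √2^n the recursion still contracts, by 3/16 per step. Its three sources sum
to order ΓΛ: interpolation distances by `hsum`, quantization errors geometrically, and the residual
Γa because it occurs at most L times and La = Λ. -/
theorem sum_recursion_le {Δ Γ κ Λ a : ℝ} (hΔ : Δ = 3 * Γ) (hΓ : 0 < Γ) (hκ : 0 < κ)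
    (hΛ : 1 ≤ Λ) (ha : 0 ≤ a) (L : ℕ) (hLa : L * a = Λ) (s δ : ℕ → ℝ) (hs : ∀ n, 0 ≤ s n)
    (hδ0 : δ 0 = Δ)
    (hδ : ∀ n, δ (n + 1) = δ n / 8 + 3 * (s n + Δ / 2 ^ 2 ^ n) + Γ * a / √2 ^ n / 8)
    (hsum : κ / (Γ * Λ) * ∑ n ∈ Finset.range (L + 1), √2 ^ n * s n ≤ 4) :
    ∑ n ∈ Finset.range (L + 1), √2 ^ n * δ n ≤ (40 + 24 / κ) * (Γ * Λ) := by
  have hΔ0 : 0 < Δ := by rw [hΔ]; positivity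
  have h2 : √2 ≤ (3 : ℝ) / 2 := by
    rw [Real.sqrt_le_left (by norm_num)]; norm_num
  have hδn : ∀ n, 0 ≤ δ n := by
    intro n
    induction n with
    | zero => rw [hδ0]; exact hΔ0.le
    | succ n ih =>
      rw [hδ]
      have := hs n
      positivity
  set Y := ∑ n ∈ Finset.range (L + 1), √2 ^ n * δ n with hY
  set S := ∑ n ∈ Finset.range (L + 1), √2 ^ n * s n with hS
  have hstep : ∀ n ∈ Finset.range L, √2 ^ (n + 1) * δ (n + 1)
      ≤ 3 / 16 * (√2 ^ n * δ n) + 9 / 2 * (√2 ^ n * s n)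
        + 9 / 4 * Δ * (3 / 4) ^ n + 3 / 16 * (Γ * a) := by
    intro n _
    have hp : (0 : ℝ) < √2 ^ n := by positivity
    have e1 : √2 ^ n / 2 ^ 2 ^ n ≤ 1 / 2 * (3 / 4) ^ n := by
      calc √2 ^ n / 2 ^ 2 ^ n ≤ (3 / 2) ^ n / 2 ^ (n + 1) := by
            apply div_le_div₀ (by positivity) (by gcongr) (by positivity)
            exact pow_le_pow_right₀ (by norm_num) Nat.lt_two_pow_self
        _ = _ := by
            rw [pow_succ, show (3 / 4 : ℝ) = (3 / 2) / 2 by norm_num, div_pow (3 / 2 : ℝ) 2]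
            ring
    have e2 : √2 ^ n * δ (n + 1) = 1 / 8 * (√2 ^ n * δ n) + 3 * (√2 ^ n * s n)
        + 3 * Δ * (√2 ^ n / 2 ^ 2 ^ n) + 1 / 8 * (Γ * a) := by
      rw [hδ]; field_simp; ring
    have e3 : √2 ^ (n + 1) * δ (n + 1) ≤ 3 / 2 * (√2 ^ n * δ (n + 1)) := by
      rw [pow_succ]
      have := mul_le_mul_of_nonneg_left h2 (mul_nonneg hp.le (hδn (n + 1)))
      linarith
    have e4 := mul_le_mul_of_nonneg_left e1 hΔ0.le
    linarith
  have hYs : Y = ∑ n ∈ Finset.range L, √2 ^ (n + 1) * δ (n + 1) + Δ := by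
    rw [hY, Finset.sum_range_succ', hδ0, pow_zero, one_mul]
  have hgeo : ∑ n ∈ Finset.range L, (3 / 4 : ℝ) ^ n ≤ 4 := by
    calc _ ≤ ∑' n : ℕ, (3 / 4 : ℝ) ^ n := Summable.sum_le_tsum _ (fun _ _ => by positivity)
              (summable_geometric_of_lt_one (by norm_num) (by norm_num))
      _ = 4 := by rw [tsum_geometric_of_lt_one (by norm_num) (by norm_num)]; norm_num
  have hYle : ∑ n ∈ Finset.range L, √2 ^ n * δ n ≤ Y := by
    rw [hY, Finset.sum_range_succ]
    have := hδn L
    have : 0 ≤ √2 ^ L * δ L := by positivity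
    linarith
  have hSle : ∑ n ∈ Finset.range L, √2 ^ n * s n ≤ S := by
    rw [hS, Finset.sum_range_succ]
    have := hs L
    have : 0 ≤ √2 ^ L * s L := by positivity
    linarith
  have h3 := Finset.sum_le_sum hstep
  simp only [Finset.sum_add_distrib, ← Finset.mul_sum, Finset.sum_const, Finset.card_range,
    nsmul_eq_mul] at h3
  have hS4 : S ≤ 4 / κ * (Γ * Λ) := by
    rw [div_mul_eq_mul_div, div_le_iff₀ (by positivity)] at hsum
    rw [div_mul_eq_mul_div, le_div_iff₀ hκ]; linarith
  have h6 := mul_le_mul_of_nonneg_left hgeo hΔ0.le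
  have h7 : Γ ≤ Γ * Λ := le_mul_of_one_le_right hΓ.le hΛ
  have h8 : (40 + 24 / κ) * (Γ * Λ) = 40 * (Γ * Λ) + 6 * (4 / κ * (Γ * Λ)) := by ring
  rw [h8]
  have h5 : Γ * (L * a) = Γ * Λ := by rw [hLa]
  have h9 : 0 ≤ 4 / κ * (Γ * Λ) := by positivity
  linarith


/-- The refinement needs one bound σ per cell, whereas the distance to the interpolant varies with
the point. Cells are therefore first split by the quantized value of this distance, which keeps the
radius a function of the label and within the point-dependent recursion for δ. -/
theorem exists_labelling_sequence {W D Γ : ℝ} (hW : 0 < W) (hD : 0 < D) (hq : 2 ≤ q)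
    (hΓ : 0 < Γ) {L : ℕ} (hL : 1 ≤ L) (hJ : Fintype.card J ≤ 2 ^ L)
    (hΓ2 : Γ ^ 2 = D ^ (q / 2) * W) (hl : ∀ j x, ‖l j x‖ ≤ √D * ‖x‖)
    (hlow : ∀ x, W * ‖x‖ ^ q ≤ powSum l q x) (π : ℕ → E → E)
    (hπW : ∀ n x, powSum l q x ≤ W → powSum l q (π n x) ≤ W)
    (hπ : ∀ n x, powSum l q x ≤ W → ∀ z, powSum l q z ≤ W →
      powSum l q (π n x) / W + interpKappa q / (Γ * (L : ℝ) ^ (1 - 1 / q)) * √2 ^ n *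
          ‖signedVec l q x - signedVec l q (π n x)‖
        ≤ powSum l q z / W + interpKappa q / (Γ * (L : ℝ) ^ (1 - 1 / q)) * √2 ^ n *
          ‖signedVec l q x - signedVec l q z‖)
    (δ : ℕ → E → ℝ) (hδ0 : ∀ x, δ 0 x = 3 * Γ)
    (hδ : ∀ n x, δ (n + 1) x = δ n x / 8
      + 3 * (‖signedVec l q x - signedVec l q (π n x)‖ + 3 * Γ / 2 ^ 2 ^ n)
      + Γ * (L : ℝ) ^ (-(1 / q)) / √2 ^ n / 8) (n : ℕ) :
    ∃ (a : E → Fin (8 ^ 2 ^ n)) (d : Fin (8 ^ 2 ^ n) → ℝ),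
      (∀ x y, powSum l q x ≤ W → powSum l q y ≤ W → a x = a y →
        ‖signedVec l q x - signedVec l q y‖ ≤ d (a x)) ∧
      ∀ x, powSum l q x ≤ W → d (a x) ≤ δ n x := by
  have hnorm : ∀ x, powSum l q x ≤ W → ‖signedVec l q x‖ ≤ Γ := fun x hx =>
    norm_signedVec_le hW hD hq hΓ hΓ2 hl hlow hx
  have hdist : ∀ x y, powSum l q x ≤ W → powSum l q y ≤ W →
      ‖signedVec l q x - signedVec l q y‖ ≤ 2 * Γ := by
    intro x y hx hy
    have := norm_sub_le (signedVec l q x) (signedVec l q y)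
    linarith [hnorm x hx, hnorm y hy]
  induction n with
  | zero =>
    refine ⟨fun _ => ⟨0, by positivity⟩, fun _ => 3 * Γ, fun x y hx hy _ => ?_, fun x _ => ?_⟩
    · linarith [hdist x y hx hy]
    · exact (hδ0 x).ge
  | succ n ih =>
    obtain ⟨a, d, had, hdδ⟩ := ih
    set w : ℝ := 3 * Γ / 2 ^ 2 ^ n with hw
    have hw0 : 0 < w := by positivity
    set s : E → ℝ := fun x => ‖signedVec l q x - signedVec l q (π n x)‖ with hs
    have hs0 : ∀ x, 0 ≤ s x := fun x => norm_nonneg _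
    -- The remainder only makes the label total. On the ball the distance is at most 2Γ < 3Γ, so no
    -- wrap-around occurs.
    let lev : E → Fin (2 ^ 2 ^ n) := fun x =>
      ⟨⌊s x / w⌋₊ % 2 ^ 2 ^ n, Nat.mod_lt _ (by positivity)⟩
    have hlev : ∀ x, powSum l q x ≤ W → ((lev x : ℕ) : ℝ) = ⌊s x / w⌋₊ := by
      intro x hx
      have h1 : ⌊s x / w⌋₊ < 2 ^ 2 ^ n := by
        rw [Nat.floor_lt (by have := hs0 x; positivity), div_lt_iff₀ hw0, hw]
        push_cast
        have := hdist x (π n x) hx (hπW n x hx)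
        have e : (2 : ℝ) ^ 2 ^ n * (3 * Γ / 2 ^ 2 ^ n) = 3 * Γ := by field_simp
        rw [e]
        exact lt_of_le_of_lt this (by linarith)
      simp only [lev, Nat.mod_eq_of_lt h1]
    have hlev1 : ∀ x, powSum l q x ≤ W → s x ≤ ((lev x : ℕ) + 1 : ℝ) * w := by
      intro x hx
      rw [hlev x hx, ← div_le_iff₀ hw0]
      exact (Nat.lt_floor_add_one _).le
    have hlev2 : ∀ x, powSum l q x ≤ W → ((lev x : ℕ) + 1 : ℝ) * w ≤ s x + w := by
      intro x hx
      rw [hlev x hx, add_mul, one_mul]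
      have := Nat.floor_le (a := s x / w) (by have := hs0 x; positivity)
      rw [le_div_iff₀ hw0] at this
      linarith
    have hnet := fun (i : Fin (8 ^ 2 ^ n)) (k : Fin (2 ^ 2 ^ n)) =>
      exists_labelling_of_interpolants hW hD hq hΓ hL hJ hΓ2 hl hlow n (π n)
        {x | powSum l q x ≤ W ∧ a x = i ∧ lev x = k} (δ := d i)
        (σ := ((k : ℕ) + 1 : ℝ) * w)
        (fun x hx => hπW n x hx.1) (fun x hx => hπ n x hx.1)
        (fun x hx y hy => by
          have := had x y hx.1 hy.1 (hx.2.1.trans hy.2.1.symm)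
          rwa [hx.2.1] at this)
        (fun x hx => by
          have := hlev1 x hx.1
          rwa [hx.2.2] at this)
    choose f hf using hnet
    -- Old cells, distance levels and new pieces multiply to (8·2·4)^2^n = 64^2^n = 8^2^(n+1), which
    -- explains the base 8.
    let e : (Fin (8 ^ 2 ^ n) × Fin (2 ^ 2 ^ n)) × Fin (4 ^ 2 ^ n) ≃ Fin (8 ^ 2 ^ (n + 1)) :=
      Fintype.equivFinOfCardEq (by
        simp only [Fintype.card_prod, Fintype.card_fin]
        rw [← mul_pow, ← mul_pow, pow_succ 2 n, mul_comm (2 ^ n) 2, pow_mul 8]; norm_num)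
    refine ⟨fun x => e ((a x, lev x), f (a x) (lev x) x), fun p =>
      d (e.symm p).1.1 / 8 + 3 * (((e.symm p).1.2 : ℕ) + 1 : ℝ) * w
        + Γ * (L : ℝ) ^ (-(1 / q)) / √2 ^ n / 8, fun x y hx hy hxy => ?_, fun x hx => ?_⟩
    · have h1 := e.injective hxy
      simp only [Prod.mk.injEq] at h1
      obtain ⟨⟨h2, h3⟩, h4⟩ := h1
      rw [← h2, ← h3] at h4
      have := hf (a x) (lev x) x ⟨hx, rfl, rfl⟩ y ⟨hy, h2.symm, h3.symm⟩ h4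
      simp only [Equiv.symm_apply_apply]
      linarith
    · simp only [Equiv.symm_apply_apply]
      rw [hδ]
      have h1 := hlev2 x hx
      have h2 := hdδ x hx
      have h3 : s x = ‖signedVec l q x - signedVec l q (π n x)‖ := rfl
      rw [← h3, ← hw]
      linarith

/-- The constant of the sign selection theorem. -/
noncomputable def signConst (q : ℝ) : ℝ := 11 * (40 + 24 / interpKappa q)

theorem signConst_pos {q : ℝ} (hq : 2 ≤ q) : 0 < signConst q := by
  have := interpKappa_pos hq
  unfold signConst; positivity

/-- Chaining is run with the signed-power metric, which dominates the ℓ₂ metric of the vectors of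
q-th powers. -/
theorem exists_signs_powSum_ball {W D Γ : ℝ} (hW : 0 < W) (hD : 0 < D) (hq : 2 ≤ q)
    (hΓ : 0 < Γ) {L : ℕ} (hL : 1 ≤ L) (hJ : Fintype.card J ≤ 2 ^ L)
    (hΓ2 : Γ ^ 2 = D ^ (q / 2) * W) (hl : ∀ j x, ‖l j x‖ ≤ √D * ‖x‖)
    (hlow : ∀ x, W * ‖x‖ ^ q ≤ powSum l q x) :
    ∃ σ : J → Bool, ∀ x, powSum l q x ≤ W →
      |∑ j, boolSign (σ j) * ‖l j x‖ ^ q| ≤ signConst q * (Γ * (L : ℝ) ^ (1 - 1 / q)) := by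
  have hL' : (1 : ℝ) ≤ L := by exact_mod_cast hL
  have hL0 : (0 : ℝ) < L := by linarith
  have hκ := interpKappa_pos hq
  have hΛ : 1 ≤ (L : ℝ) ^ (1 - 1 / q) := by
    apply Real.one_le_rpow hL'
    have : 1 / q ≤ 1 := by rw [div_le_one (by linarith)]; linarith
    linarith
  set c := interpKappa q / (Γ * (L : ℝ) ^ (1 - 1 / q)) with hc
  have hc0 : 0 < c := by positivity
  have hex := fun (n : ℕ) (x : E) (hx : powSum l q x ≤ W) =>
    exists_interpolant hW hq hlow (c * √2 ^ n) x hx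
  choose! π hπ using hex
  let δ : ℕ → E → ℝ := fun n x => Nat.rec (3 * Γ) (fun n δn => δn / 8
      + 3 * (‖signedVec l q x - signedVec l q (π n x)‖ + 3 * Γ / 2 ^ 2 ^ n)
      + Γ * (L : ℝ) ^ (-(1 / q)) / √2 ^ n / 8) n
  have hpart := exists_labelling_sequence hW hD hq hΓ hL hJ hΓ2 hl hlow π
    (fun n x hx => (hπ n x hx).1) (fun n x hx => (hπ n x hx).2) δ (fun _ => rfl)
    (fun _ _ => rfl)
  choose a d had hdδ using hpart
  have h0W : powSum l q (0 : E) = 0 := by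
    unfold powSum
    exact Finset.sum_eq_zero fun j _ => by
      rw [map_zero, norm_zero, Real.zero_rpow (by linarith)]
  let T := {x : E // powSum l q x ≤ W}
  have hXd : ∀ x y : E, ‖(WithLp.toLp 2 fun j => ‖l j x‖ ^ q : EuclideanSpace ℝ J)
      - WithLp.toLp 2 fun j => ‖l j y‖ ^ q‖ ≤ ‖signedVec l q x - signedVec l q y‖ := by
    intro x y
    refine (abs_le_of_sq_le_sq' ?_ (norm_nonneg _)).2
    rw [EuclideanSpace.norm_sq_eq, EuclideanSpace.norm_sq_eq]
    refine Finset.sum_le_sum fun j _ => ?_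
    have := abs_norm_rpow_sub_le hq (l j x) (l j y)
    simp only [signedVec, PiLp.sub_apply, Real.norm_eq_abs]
    gcongr
  obtain ⟨σ, hσ⟩ := exists_signs_of_labels (T := T)
    (fun x => WithLp.toLp 2 fun j => ‖l j x.1‖ ^ q) L hJ (fun n x => a n x.1)
    (fun n x => δ n x.1) ⟨0, by rw [h0W]; exact hW.le⟩
    (by ext j; simp [Real.zero_rpow (show q ≠ 0 by linarith)])
    (fun n x y hxy => (hXd x.1 y.1).trans ((had n x.1 y.1 x.2 y.2 hxy).trans (hdδ n x.1 x.2)))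
    (fun x y => by
      refine (hXd x.1 y.1).trans ?_
      have h1 := norm_signedVec_le hW hD hq hΓ hΓ2 hl hlow x.2
      have h2 := norm_signedVec_le hW hD hq hΓ hΓ2 hl hlow y.2
      have h3 := norm_sub_le (signedVec l q x.1) (signedVec l q y.1)
      change _ ≤ 3 * Γ
      linarith)
  refine ⟨σ, fun x hx => (hσ ⟨x, hx⟩).trans ?_⟩
  rw [signConst, mul_assoc]
  apply mul_le_mul_of_nonneg_left _ (by norm_num)
  refine sum_recursion_le (a := (L : ℝ) ^ (-(1 / q))) rfl hΓ hκ hΛ (by positivity) L ?_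
    (fun n => ‖signedVec l q x - signedVec l q (π n x)‖) (fun n => δ n x)
    (fun n => norm_nonneg _) rfl (fun n => rfl) ?_
  · rw [sub_eq_add_neg, Real.rpow_add hL0, Real.rpow_one]
  · refine (sum_interpolation_le hc0.le (fun n => powSum l q (π n x) / W)
      (fun n => ‖signedVec l q x - signedVec l q (π n x)‖)
      (fun n => div_nonneg (powSum_nonneg _) hW.le) (fun n => norm_nonneg _)
      (fun n => (hπ n x hx).2 _ (hπ (n + 1) x hx).1) L).trans ?_
    -- At the last scale x itself competes, with distance 0 and normalized power sum at most 1.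
    have h1 := (hπ L x hx).2 x hx
    rw [sub_self, norm_zero, mul_zero, add_zero] at h1
    have h2 : powSum l q x / W ≤ 1 := by rwa [div_le_one hW]
    linarith

/-- Sign selection: the signed sum of `q`-th powers is small relative to the full sum. -/
theorem exists_signs_powSum {W D : ℝ} (hW : 0 < W) (hD : 0 < D) (hq : 2 ≤ q)
    {L : ℕ} (hL : 1 ≤ L) (hJ : Fintype.card J ≤ 2 ^ L) (hl : ∀ j x, ‖l j x‖ ≤ √D * ‖x‖)
    (hlow : ∀ x, W * ‖x‖ ^ q ≤ powSum l q x) :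
    ∃ σ : J → Bool, ∀ x, |∑ j, boolSign (σ j) * ‖l j x‖ ^ q|
      ≤ signConst q * (√(D ^ (q / 2) / W) * (L : ℝ) ^ (1 - 1 / q)) * powSum l q x := by
  have hDq : 0 < D ^ (q / 2) := by positivity
  obtain ⟨σ, hσ⟩ := exists_signs_powSum_ball hW hD hq (Γ := √(D ^ (q / 2) * W)) (by positivity)
    hL hJ (Real.sq_sqrt (by positivity)) hl hlow
  refine ⟨σ, fun x => ?_⟩
  have hx0 := powSum_nonneg (l := l) (q := q) x
  rcases eq_or_lt_of_le hx0 with h | h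
  · have hz : ∀ j, ‖l j x‖ ^ q = 0 := fun j =>
      (Finset.sum_eq_zero_iff_of_nonneg (fun _ _ => by positivity)).1 h.symm j (Finset.mem_univ j)
    simp [hz, ← h]
  -- Both sides are homogeneous of degree q, so x may be scaled to the boundary of the ball.
  · set t := (W / powSum l q x) ^ (1 / q) with ht
    have ht0 : 0 ≤ t := by positivity
    have htq : |t| ^ q = W / powSum l q x := by
      rw [abs_of_nonneg ht0, ht, ← Real.rpow_mul (by positivity),
        one_div_mul_cancel (by linarith), Real.rpow_one]
    have h1 := hσ (t • x) (by rw [powSum_smul, htq, div_mul_cancel₀ _ h.ne'])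
    have h2 : ∑ j, boolSign (σ j) * ‖l j (t • x)‖ ^ q
        = W / powSum l q x * ∑ j, boolSign (σ j) * ‖l j x‖ ^ q := by
      rw [Finset.mul_sum]
      refine Finset.sum_congr rfl fun j _ => ?_
      rw [map_smul, norm_smul, Real.norm_eq_abs, Real.mul_rpow (abs_nonneg _) (norm_nonneg _),
        htq]
      ring
    rw [h2, abs_mul, abs_of_pos (by positivity), div_mul_eq_mul_div, div_le_iff₀ h] at h1
    have h3 : √(D ^ (q / 2) * W) = √(D ^ (q / 2) / W) * W := by
      rw [show D ^ (q / 2) * W = D ^ (q / 2) / W * W ^ 2 by field_simp,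
        Real.sqrt_mul (by positivity), Real.sqrt_sq hW.le]
    rw [h3] at h1
    refine le_of_mul_le_mul_left ?_ hW
    linarith

end SignSelection

/-! ### Discretization by thinning out large samples -/

section Thinning

variable {E : Type*} [NormedAddCommGroup E] [InnerProductSpace ℝ E] [FiniteDimensional ℝ E]
  [MeasurableSpace E] [BorelSpace E]

/-- The sum over either sign class is half of the full sum plus or minus the signed sum, so both
classes inherit the bound and the smaller may be kept. Here n is the nominal size used for
normalization, not the cardinality, which may have dropped further. -/
theorem exists_half_subset {ι : Type*} (l : ι → E →L[ℝ] ℂ) {q D n : ℝ} (hq : 2 ≤ q) (hD : 0 < D)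
    (hl : ∀ j x, ‖l j x‖ ≤ √D * ‖x‖) (Q : E → ℝ) (hQ : ∀ x, ‖x‖ ^ q ≤ Q x) (s : Finset ι)
    {L : ℕ} (hL : 1 ≤ L) (hsL : s.card ≤ 2 ^ L) (hn : 0 < n) {τ : ℝ} (hτ : τ ≤ 1 / 2)
    (hs : ∀ x, |(∑ j ∈ s, ‖l j x‖ ^ q) / n - Q x| ≤ τ * Q x) :
    ∃ s' ⊆ s, 2 * s'.card ≤ s.card ∧
      ∀ x, |(∑ j ∈ s', ‖l j x‖ ^ q) / (n / 2) - Q x|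
        ≤ (τ + 3 / 2 * signConst q * (√(D ^ (q / 2) / (n / 2)) * (L : ℝ) ^ (1 - 1 / q))) * Q x := by
  classical
  have hQ0 : ∀ x, 0 ≤ Q x := fun x => le_trans (by positivity) (hQ x)
  have hC := signConst_pos hq
  -- An error of at most 1/2 keeps the power sum comparable to nQ: the lower bound lets W = n/2 in
  -- the sign theorem, the upper one produces the factor 3/2.
  have hbd : ∀ x, n / 2 * Q x ≤ ∑ j ∈ s, ‖l j x‖ ^ q ∧ ∑ j ∈ s, ‖l j x‖ ^ q ≤ 3 / 2 * n * Q x := by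
    intro x
    have h1 := abs_le.1 ((hs x).trans (mul_le_mul_of_nonneg_right hτ (hQ0 x)))
    have h2 : 1 / 2 * Q x ≤ (∑ j ∈ s, ‖l j x‖ ^ q) / n := by linarith [h1.1]
    have h3 : (∑ j ∈ s, ‖l j x‖ ^ q) / n ≤ 3 / 2 * Q x := by linarith [h1.2]
    rw [le_div_iff₀ hn] at h2
    rw [div_le_iff₀ hn] at h3
    constructor <;> linarith
  have hpow : ∀ x, powSum (fun j : s => l j) q x = ∑ j ∈ s, ‖l j x‖ ^ q := fun x =>
    Finset.sum_coe_sort s fun j => ‖l j x‖ ^ q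
  obtain ⟨σ, hσ⟩ := exists_signs_powSum (l := fun j : s => l j) (W := n / 2) (by positivity) hD hq hL
    (by rwa [Fintype.card_coe]) (fun j x => hl j x) (fun x => by
      rw [hpow]
      exact (mul_le_mul_of_nonneg_left (hQ x) (by positivity)).trans (hbd x).1)
  let τσ : ι → Bool := fun j => if h : j ∈ s then σ ⟨j, h⟩ else true
  have hsum : ∀ x, ∑ j : s, boolSign (σ j) * ‖l j x‖ ^ q
      = ∑ j ∈ s, boolSign (τσ j) * ‖l j x‖ ^ q := by
    intro x
    rw [← Finset.sum_coe_sort s]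
    exact Finset.sum_congr rfl fun j _ => by simp [τσ]
  have hfin : ∀ b : Bool, ∀ x, |(∑ j ∈ s with τσ j = b, ‖l j x‖ ^ q) / (n / 2) - Q x|
      ≤ (τ + 3 / 2 * signConst q * (√(D ^ (q / 2) / (n / 2)) * (L : ℝ) ^ (1 - 1 / q))) * Q x := by
    intro b x
    have h1 : 2 * ∑ j ∈ s with τσ j = b, ‖l j x‖ ^ q
        = ∑ j ∈ s, ‖l j x‖ ^ q + boolSign b * ∑ j ∈ s, boolSign (τσ j) * ‖l j x‖ ^ q := by
      rw [Finset.sum_filter, Finset.mul_sum, Finset.mul_sum, ← Finset.sum_add_distrib]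
      refine Finset.sum_congr rfl fun j _ => ?_
      cases b <;> cases τσ j <;> simp [boolSign] <;> ring
    have h2 : (∑ j ∈ s with τσ j = b, ‖l j x‖ ^ q) / (n / 2) - Q x
        = ((∑ j ∈ s, ‖l j x‖ ^ q) / n - Q x)
          + boolSign b * (∑ j ∈ s, boolSign (τσ j) * ‖l j x‖ ^ q) / n := by
      rw [div_div_eq_mul_div, mul_comm _ (2 : ℝ), h1]; ring
    have h3 := hσ x
    rw [hsum, hpow] at h3
    have h4 : |boolSign b * (∑ j ∈ s, boolSign (τσ j) * ‖l j x‖ ^ q) / n|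
        ≤ 3 / 2 * signConst q * (√(D ^ (q / 2) / (n / 2)) * (L : ℝ) ^ (1 - 1 / q)) * Q x := by
      rw [abs_div, abs_mul, abs_boolSign, one_mul, abs_of_pos hn, div_le_iff₀ hn]
      refine h3.trans ?_
      have := mul_le_mul_of_nonneg_left (hbd x).2
        (show 0 ≤ signConst q * (√(D ^ (q / 2) / (n / 2)) * (L : ℝ) ^ (1 - 1 / q)) by positivity)
      linarith
    rw [h2, add_mul]
    exact (abs_add_le _ _).trans (add_le_add (hs x) h4)
  have hcard := Finset.card_filter_add_card_filter_not (s := s) (fun j => τσ j = true)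
  rcases le_total (s.filter fun j => τσ j = true).card (s.filter fun j => ¬ τσ j = true).card
    with h | h
  · exact ⟨_, Finset.filter_subset _ _, by omega, hfin true⟩
  · refine ⟨s.filter fun j => τσ j = false, Finset.filter_subset _ _, ?_, hfin false⟩
    simp only [Bool.not_eq_true] at h hcard
    omega

/-- The error of the halving that leads down to m·2^i nodes decays like 2^(-i/2), up to a
logarithmic factor growing at most linearly in i. The total is a convergent series times the last
error, with no dependence on the starting size. -/
theorem exists_thinning {ι : Type*} (l : ι → E →L[ℝ] ℂ) {q D A : ℝ} (hq : 2 ≤ q) (hD : 0 < D)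
    (hl : ∀ j x, ‖l j x‖ ≤ √D * ‖x‖) (Q : E → ℝ) (hQ : ∀ x, ‖x‖ ^ q ≤ Q x)
    {m L : ℕ} (hm : 1 ≤ m) (hL : 1 ≤ L) (hmL : m ≤ 2 ^ L)
    (hA : A = 3 * signConst q * (√(D ^ (q / 2) / m) * (L : ℝ) ^ (1 - 1 / q))) (k : ℕ)
    (s : Finset ι) (hsm : s.card ≤ m * 2 ^ k) {τ : ℝ}
    (hτ : τ + A * ∑ i ∈ Finset.range k, (i + 1 : ℝ) * (3 / 4) ^ i ≤ 1 / 2)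
    (hs : ∀ x, |(∑ j ∈ s, ‖l j x‖ ^ q) / (m * 2 ^ k) - Q x| ≤ τ * Q x) :
    ∃ s' ⊆ s, s'.card ≤ m ∧ ∀ x, |(∑ j ∈ s', ‖l j x‖ ^ q) / m - Q x|
      ≤ (τ + A * ∑ i ∈ Finset.range k, (i + 1 : ℝ) * (3 / 4) ^ i) * Q x := by
  have hC := signConst_pos hq
  have hm0 : (0 : ℝ) < m := by exact_mod_cast hm
  have hL' : (1 : ℝ) ≤ L := by exact_mod_cast hL
  have hA0 : 0 ≤ A := by rw [hA]; positivity
  have hQ0 : ∀ x, 0 ≤ Q x := fun x => le_trans (by positivity) (hQ x)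
  induction k generalizing s τ with
  | zero =>
    refine ⟨s, subset_rfl, by simpa using hsm, fun x => ?_⟩
    simpa using hs x
  | succ k ih =>
    rw [Finset.sum_range_succ, mul_add] at hτ ⊢
    have hsum0 : 0 ≤ A * ∑ i ∈ Finset.range k, (i + 1 : ℝ) * (3 / 4) ^ i :=
      mul_nonneg hA0 (Finset.sum_nonneg fun i _ => by positivity)
    have hterm0 : 0 ≤ A * (((k : ℕ) + 1 : ℝ) * (3 / 4) ^ k) := by positivity
    have hcardL : s.card ≤ 2 ^ (L + (k + 1)) := by
      rw [pow_add]; exact hsm.trans (Nat.mul_le_mul_right _ hmL)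
    obtain ⟨s', hss, hc, he⟩ := exists_half_subset l hq hD hl Q hQ s (L := L + (k + 1)) (by omega)
      hcardL (n := m * 2 ^ (k + 1)) (by positivity) (τ := τ) (by linarith) hs
    have hhalf : (m : ℝ) * 2 ^ (k + 1) / 2 = m * 2 ^ k := by rw [pow_succ]; ring
    rw [hhalf] at he
    have hθ : 0 ≤ 1 - 1 / q := by
      have : 1 / q ≤ 1 := by rw [div_le_one (by linarith)]; linarith
      linarith
    -- Uses 2^(-1/2) ≤ 3/4 and L+k+1 ≤ 2L(k+1); the factor 2 turns 3/2 into the 3 in `A`.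
    have hstep : 3 / 2 * signConst q * (√(D ^ (q / 2) / (m * 2 ^ k)) *
        ((L + (k + 1) : ℕ) : ℝ) ^ (1 - 1 / q)) ≤ A * (((k : ℕ) + 1 : ℝ) * (3 / 4) ^ k) := by
      have e1 : √(D ^ (q / 2) / (m * 2 ^ k)) ≤ √(D ^ (q / 2) / m) * (3 / 4) ^ k := by
        rw [Real.sqrt_le_left (by positivity), mul_pow, Real.sq_sqrt (by positivity), ← div_div,
          div_eq_mul_inv _ ((2 : ℝ) ^ k)]
        apply mul_le_mul_of_nonneg_left _ (by positivity)
        rw [← pow_mul, mul_comm k 2, pow_mul, ← inv_pow]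
        exact pow_le_pow_left₀ (by norm_num) (by norm_num) _
      have e2 : ((L + (k + 1) : ℕ) : ℝ) ^ (1 - 1 / q)
          ≤ (L : ℝ) ^ (1 - 1 / q) * (2 * (k + 1)) := by
        calc _ ≤ ((L : ℝ) * (2 * (k + 1))) ^ (1 - 1 / q) := by
              apply Real.rpow_le_rpow (by positivity) _ hθ
              push_cast
              have : (0 : ℝ) ≤ k := by positivity
              nlinarith
          _ = (L : ℝ) ^ (1 - 1 / q) * (2 * (k + 1) : ℝ) ^ (1 - 1 / q) :=
              Real.mul_rpow (by positivity) (by positivity)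
          _ ≤ _ := by
              apply mul_le_mul_of_nonneg_left _ (by positivity)
              have hk : (0 : ℝ) ≤ k := by positivity
              calc (2 * (k + 1) : ℝ) ^ (1 - 1 / q) ≤ (2 * (k + 1) : ℝ) ^ (1 : ℝ) := by
                    apply Real.rpow_le_rpow_of_exponent_le (by linarith)
                    have : 0 ≤ 1 / q := by positivity
                    linarith
                _ = _ := Real.rpow_one _
      calc _ ≤ 3 / 2 * signConst q * ((√(D ^ (q / 2) / m) * (3 / 4) ^ k) *
            ((L : ℝ) ^ (1 - 1 / q) * (2 * (k + 1)))) := by gcongr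
        _ = _ := by rw [hA]; ring
    obtain ⟨s'', h1, h2, h3⟩ := ih s' (by
        rw [pow_succ] at hsm
        have e : m * (2 ^ k * 2) = 2 * (m * 2 ^ k) := by ring
        omega)
      (τ := τ + A * (((k : ℕ) + 1 : ℝ) * (3 / 4) ^ k)) (by linarith) (fun x =>
        (he x).trans (mul_le_mul_of_nonneg_right (by linarith) (hQ0 x)))
    refine ⟨s'', h1.trans hss, h2, fun x => (h3 x).trans (le_of_eq ?_)⟩
    ring

end Thinning

/-! ### Large random samples and equal-weight discretization -/

section LargeSample

variable {E : Type*} [NormedAddCommGroup E] [InnerProductSpace ℝ E] [FiniteDimensional ℝ E]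
  {Ω : Type*} [MeasurableSpace Ω]

theorem abs_norm_rpow_sub_norm_rpow_le {q B : ℝ} (hq : 2 ≤ q) {a b : ℂ} (ha : ‖a‖ ≤ B)
    (hb : ‖b‖ ≤ B) : |‖a‖ ^ q - ‖b‖ ^ q| ≤ 2 * q * B ^ (q - 1) * ‖a - b‖ := by
  refine (abs_norm_rpow_sub_le hq a b).trans ((norm_signedPow_sub_le hq a b).trans ?_)
  apply mul_le_mul_of_nonneg_right _ (norm_nonneg _)
  have h1 := Real.rpow_le_rpow (norm_nonneg _) ha (by linarith : 0 ≤ q - 1)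
  have h2 := Real.rpow_le_rpow (norm_nonneg _) hb (by linarith : 0 ≤ q - 1)
  nlinarith

theorem ae_tendsto_average (ν : Measure Ω) [IsProbabilityMeasure ν] {g : Ω → ℝ}
    (hg : Measurable g) (hi : Integrable g ν) :
    ∀ᵐ ω ∂(Measure.infinitePi fun _ : ℕ => ν), Filter.Tendsto
      (fun n : ℕ => (∑ i ∈ Finset.range n, g (ω i)) / n) Filter.atTop (nhds (∫ x, g x ∂ν)) := by
  have hmp : ∀ i : ℕ, MeasurePreserving (fun ω : ℕ → Ω => ω i)
      (Measure.infinitePi fun _ : ℕ => ν) ν := fun i =>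
    measurePreserving_eval_infinitePi (fun _ : ℕ => ν) i
  have hind : ProbabilityTheory.iIndepFun (fun (i : ℕ) (ω : ℕ → Ω) => g (ω i))
      (Measure.infinitePi fun _ : ℕ => ν) :=
    ProbabilityTheory.iIndepFun_infinitePi (X := fun _ => g) fun _ => hg
  have hident : ∀ i : ℕ, ProbabilityTheory.IdentDistrib (fun ω : ℕ → Ω => g (ω i))
      (fun ω : ℕ → Ω => g (ω 0)) (Measure.infinitePi fun _ : ℕ => ν)
      (Measure.infinitePi fun _ : ℕ => ν) := by
    intro i
    refine ⟨(hg.comp (measurable_pi_apply i)).aemeasurable,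
      (hg.comp (measurable_pi_apply 0)).aemeasurable, ?_⟩
    change Measure.map (g ∘ fun ω : ℕ → Ω => ω i) _
      = Measure.map (g ∘ fun ω : ℕ → Ω => ω 0) _
    rw [← Measure.map_map hg (hmp i).measurable, ← Measure.map_map hg (hmp 0).measurable,
      (hmp i).map_eq, (hmp 0).map_eq]
  have h := ProbabilityTheory.strong_law_ae_real (fun (i : ℕ) (ω : ℕ → Ω) => g (ω i))
    ((hmp 0).integrable_comp_of_integrable hi) (fun i j hij => hind.indepFun hij) hident
  have hE : ∫ ω, g (ω 0) ∂(Measure.infinitePi fun _ : ℕ => ν) = ∫ x, g x ∂ν := by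
    have := integral_map (μ := Measure.infinitePi fun _ : ℕ => ν)
      (hmp 0).measurable.aemeasurable (f := g) hg.aestronglyMeasurable
    rw [(hmp 0).map_eq] at this
    exact this.symm
  rwa [hE] at h

/-- The strong law on a finite net of the sphere, extended by a Lipschitz bound and homogeneity. On
the sphere the integral is at least 1, so an absolute error is also a relative one. Almost surely
all sample points satisfy P as well. -/
theorem exists_large_sample (ν : Measure Ω) [IsProbabilityMeasure ν] (f : Ω → E →L[ℝ] ℂ)
    {q D : ℝ} (hq : 2 ≤ q) (hD : 0 < D) (hfm : ∀ x, Measurable fun ω => f ω x)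
    (hf : ∀ ω x, ‖f ω x‖ ≤ √D * ‖x‖) (hlow : ∀ x, ‖x‖ ^ q ≤ ∫ ω, ‖f ω x‖ ^ q ∂ν)
    {P : Ω → Prop} (hP : ∀ᵐ ω ∂ν, P ω) {τ : ℝ} (hτ : 0 < τ) :
    ∃ ξ : ℕ → Ω, (∀ i, P (ξ i)) ∧ ∃ n₀ : ℕ, ∀ n ≥ n₀, ∀ x,
      |(∑ i ∈ Finset.range n, ‖f (ξ i) x‖ ^ q) / n - ∫ ω, ‖f ω x‖ ^ q ∂ν|
        ≤ τ * ∫ ω, ‖f ω x‖ ^ q ∂ν := by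
  set K : ℝ := 2 * q * √D ^ (q - 1) * √D with hK
  have hK0 : 0 < K := by positivity
  have hpm : ∀ x, Measurable fun ω => ‖f ω x‖ ^ q := fun x => (hfm x).norm.pow_const q
  have hint : ∀ x, Integrable (fun ω => ‖f ω x‖ ^ q) ν := by
    intro x
    refine Integrable.of_bound (hpm x).aestronglyMeasurable ((√D * ‖x‖) ^ q)
      (Filter.Eventually.of_forall fun ω => ?_)
    rw [Real.norm_of_nonneg (by positivity)]
    exact Real.rpow_le_rpow (norm_nonneg _) (hf ω x) (by linarith)
  -- At this mesh, passing to the net costs τ/4 in the average and τ/4 in the integral; the strong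
  -- law supplies the remaining τ/2.
  obtain ⟨t, htS, htf, htc⟩ := (isCompact_sphere (0 : E) 1).finite_cover_balls
    (show 0 < τ / (4 * K) by positivity)
  have hae : ∀ᵐ ω ∂(Measure.infinitePi fun _ : ℕ => ν), (∀ i, P (ω i)) ∧ ∀ x ∈ t, Filter.Tendsto
      (fun n : ℕ => (∑ i ∈ Finset.range n, ‖f (ω i) x‖ ^ q) / n) Filter.atTop
      (nhds (∫ ω, ‖f ω x‖ ^ q ∂ν)) := by
    refine Filter.Eventually.and ?_ ((Filter.eventually_all_finite htf).2 fun x _ =>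
      ae_tendsto_average ν (hpm x) (hint x))
    rw [ae_all_iff]
    intro i
    exact (measurePreserving_eval_infinitePi (fun _ : ℕ => ν) i).quasiMeasurePreserving.ae hP
  obtain ⟨ξ, hξP, hξ⟩ := hae.exists
  refine ⟨ξ, hξP, ?_⟩
  have hev : ∀ᶠ n : ℕ in Filter.atTop, ∀ x ∈ t,
      |(∑ i ∈ Finset.range n, ‖f (ξ i) x‖ ^ q) / n - ∫ ω, ‖f ω x‖ ^ q ∂ν| < τ / 2 := by
    refine (Filter.eventually_all_finite htf).2 fun x hx => ?_
    have := Metric.tendsto_nhds.1 (hξ x hx) (τ / 2) (by positivity)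
    simpa only [Real.dist_eq] using this
  obtain ⟨n₀, hn₀⟩ := Filter.eventually_atTop.1 hev
  refine ⟨n₀ + 1, fun n hn x => ?_⟩
  have hn0 : (0 : ℝ) < n := by
    have : 0 < n := by omega
    exact_mod_cast this
  have hlip : ∀ ω, ∀ x y : E, ‖x‖ = 1 → ‖y‖ = 1 →
      |‖f ω x‖ ^ q - ‖f ω y‖ ^ q| ≤ K * ‖x - y‖ := by
    intro ω x y hx hy
    have h1 := hf ω x
    have h2 := hf ω y
    rw [hx, mul_one] at h1
    rw [hy, mul_one] at h2
    refine (abs_norm_rpow_sub_norm_rpow_le hq h1 h2).trans ?_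
    rw [← map_sub, hK, mul_assoc _ (√D)]
    exact mul_le_mul_of_nonneg_left (hf ω _) (by positivity)
  have hunit : ∀ x : E, ‖x‖ = 1 →
      |(∑ i ∈ Finset.range n, ‖f (ξ i) x‖ ^ q) / n - ∫ ω, ‖f ω x‖ ^ q ∂ν| ≤ τ := by
    intro x hx
    obtain ⟨y, hy, hxy⟩ := Set.mem_iUnion₂.1 (htc (mem_sphere_zero_iff_norm.2 hx))
    rw [Metric.mem_ball, dist_eq_norm] at hxy
    have hy1 : ‖y‖ = 1 := mem_sphere_zero_iff_norm.1 (htS hy)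
    have hKxy : K * ‖x - y‖ ≤ τ / 4 := by
      calc K * ‖x - y‖ ≤ K * (τ / (4 * K)) := mul_le_mul_of_nonneg_left hxy.le hK0.le
        _ = τ / 4 := by field_simp
    have e1 : |(∑ i ∈ Finset.range n, ‖f (ξ i) x‖ ^ q) / n
        - (∑ i ∈ Finset.range n, ‖f (ξ i) y‖ ^ q) / n| ≤ τ / 4 := by
      rw [← sub_div, ← Finset.sum_sub_distrib, abs_div, abs_of_pos hn0, div_le_iff₀ hn0]
      refine (Finset.abs_sum_le_sum_abs _ _).trans ?_
      refine (Finset.sum_le_sum fun i _ => (hlip (ξ i) x y hx hy1).trans hKxy).trans ?_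
      simp [mul_comm]
    have e2 : |∫ ω, ‖f ω x‖ ^ q ∂ν - ∫ ω, ‖f ω y‖ ^ q ∂ν| ≤ τ / 4 := by
      rw [← integral_sub (hint x) (hint y)]
      have := norm_integral_le_of_norm_le_const (μ := ν) (C := τ / 4)
        (f := fun ω => ‖f ω x‖ ^ q - ‖f ω y‖ ^ q)
        (Filter.Eventually.of_forall fun ω => (hlip ω x y hx hy1).trans hKxy)
      simpa using this
    have e3 := hn₀ n (by omega) y hy
    rw [abs_le] at *
    rw [abs_lt] at e3
    constructor <;> linarith [e1.1, e1.2, e2.1, e2.2, e3.1, e3.2]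
  rcases eq_or_ne x 0 with rfl | hx
  · simp [Real.zero_rpow (show q ≠ 0 by linarith)]
  · have hxn : 0 < ‖x‖ := norm_pos_iff.2 hx
    set y : E := ‖x‖⁻¹ • x with hy
    have hy1 : ‖y‖ = 1 := norm_smul_inv_norm (𝕜 := ℝ) hx
    have hpow : ∀ ω, ‖f ω x‖ ^ q = ‖x‖ ^ q * ‖f ω y‖ ^ q := by
      intro ω
      have : x = ‖x‖ • y := by rw [hy, smul_inv_smul₀ hxn.ne']
      conv_lhs => rw [this]
      rw [map_smul, norm_smul, norm_norm, Real.mul_rpow hxn.le (norm_nonneg _)]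
    have h1 := hunit y hy1
    have h2 := hlow y
    rw [hy1, Real.one_rpow] at h2
    simp_rw [hpow]
    rw [← Finset.mul_sum, integral_const_mul, mul_div_assoc, ← mul_sub, abs_mul,
      abs_of_pos (by positivity), mul_left_comm]
    apply mul_le_mul_of_nonneg_left _ (by positivity)
    nlinarith


theorem sum_range_succ_mul_pow_le (k : ℕ) :
    ∑ i ∈ Finset.range k, (i + 1 : ℝ) * (3 / 4) ^ i ≤ 16 := by
  have h : ∑ i ∈ Finset.range k, (i + 1 : ℝ) * (3 / 4) ^ i
      = 16 - (4 * k + 16) * (3 / 4) ^ k := by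
    induction k with
    | zero => simp
    | succ k ih => rw [Finset.sum_range_succ, ih, pow_succ]; push_cast; ring
  rw [h]
  have : (0 : ℝ) ≤ (4 * k + 16) * (3 / 4) ^ k := by positivity
  linarith

/-- Discretization of a bounded system by at most `m` equally weighted nodes. -/
theorem exists_discretization [MeasurableSpace E] [BorelSpace E] (ν : Measure Ω)
    [IsProbabilityMeasure ν] (f : Ω → E →L[ℝ] ℂ)
    {q D : ℝ} (hq : 2 ≤ q) (hD : 0 < D) (hfm : ∀ x, Measurable fun ω => f ω x)
    (hf : ∀ ω x, ‖f ω x‖ ≤ √D * ‖x‖) (hlow : ∀ x, ‖x‖ ^ q ≤ ∫ ω, ‖f ω x‖ ^ q ∂ν)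
    {P : Ω → Prop} (hP : ∀ᵐ ω ∂ν, P ω) {ε : ℝ} (hε0 : 0 < ε) (hε1 : ε < 1) {m L : ℕ}
    (hm : 1 ≤ m) (hL : 1 ≤ L) (hmL : m ≤ 2 ^ L)
    (hε : 100 * signConst q * (√(D ^ (q / 2) / m) * (L : ℝ) ^ (1 - 1 / q)) ≤ ε) :
    ∃ (s : Finset ℕ) (ξ : ℕ → Ω), s.card ≤ m ∧ (∀ i, P (ξ i)) ∧ ∀ x,
      |(∑ i ∈ s, ‖f (ξ i) x‖ ^ q) / m - ∫ ω, ‖f ω x‖ ^ q ∂ν| ≤ ε * ∫ ω, ‖f ω x‖ ^ q ∂ν := by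
  have hC := signConst_pos hq
  obtain ⟨ξ, hξP, n₀, hn₀⟩ := exists_large_sample ν f hq hD hfm hf hlow hP
    (show 0 < ε / 50 by positivity)
  -- Taking n₀ halvings is wasteful but harmless. The errors add up to ε/50 + 16·3ε/100 = ε/2, also
  -- below the 1/2 required throughout the thinning.
  have hk : n₀ ≤ m * 2 ^ n₀ := by
    calc n₀ ≤ 2 ^ n₀ := Nat.lt_two_pow_self.le
      _ ≤ m * 2 ^ n₀ := Nat.le_mul_of_pos_left _ hm
  set A := 3 * signConst q * (√(D ^ (q / 2) / m) * (L : ℝ) ^ (1 - 1 / q)) with hA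
  have hA0 : 0 ≤ A := by positivity
  have hA1 : A ≤ 3 * ε / 100 := by rw [hA]; linarith
  have hsum := mul_le_mul_of_nonneg_left (sum_range_succ_mul_pow_le n₀) hA0
  obtain ⟨s, _, hs2, hs3⟩ := exists_thinning (fun i : ℕ => f (ξ i)) hq hD (fun i x => hf _ x)
    (fun x => ∫ ω, ‖f ω x‖ ^ q ∂ν) hlow hm hL hmL hA n₀ (Finset.range (m * 2 ^ n₀))
    (by rw [Finset.card_range]) (τ := ε / 50) (by linarith) (fun x => by
      have := hn₀ _ hk x
      push_cast at this
      exact this)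
  refine ⟨s, ξ, hs2, hξP, fun x => (hs3 x).trans ?_⟩
  apply mul_le_mul_of_nonneg_right _ (le_trans (by positivity) (hlow x))
  linarith

end LargeSample

/-! ### Change of density -/

section Density

variable {Ω : Type*} {d : ℕ}

/-- The combination of the functions `v i` with coefficients `c i`. -/
noncomputable def lincomb (v : Fin d → Ω → ℂ) (c : Fin d → ℝ) (ω : Ω) : ℂ := ∑ i, c i • v i ω

/-- The functions obtained from `v` by the matrix `A`. -/
noncomputable def matComb (A : Matrix (Fin d) (Fin d) ℝ) (v : Fin d → Ω → ℂ) :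
    Fin d → Ω → ℂ := fun i => lincomb v fun k => A i k

/-- The square function of a finite system. -/
noncomputable def sqFun (v : Fin d → Ω → ℂ) (ω : Ω) : ℝ := ∑ i, ‖v i ω‖ ^ 2

theorem sqFun_nonneg (v : Fin d → Ω → ℂ) (ω : Ω) : 0 ≤ sqFun v ω :=
  Finset.sum_nonneg fun _ _ => by positivity

theorem lincomb_matComb (A : Matrix (Fin d) (Fin d) ℝ) (v : Fin d → Ω → ℂ) (c : Fin d → ℝ) :
    lincomb (matComb A v) c = lincomb v (Matrix.vecMul c A) := by
  ext ω
  simp only [lincomb, matComb, Matrix.vecMul, dotProduct, Finset.smul_sum, Finset.sum_smul,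
    smul_smul]
  exact Finset.sum_comm

theorem matComb_mul (B A : Matrix (Fin d) (Fin d) ℝ) (v : Fin d → Ω → ℂ) :
    matComb (B * A) v = matComb B (matComb A v) := by
  ext i ω
  exact (congrFun (lincomb_matComb A v fun k => B i k) ω).symm

theorem norm_lincomb_sq_le (v : Fin d → Ω → ℂ) (c : Fin d → ℝ) (ω : Ω) :
    ‖lincomb v c ω‖ ^ 2 ≤ (∑ i, c i ^ 2) * sqFun v ω := by
  have h1 : ‖lincomb v c ω‖ ≤ ∑ i, |c i| * ‖v i ω‖ := by
    refine (norm_sum_le _ _).trans (le_of_eq ?_)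
    exact Finset.sum_congr rfl fun i _ => by rw [norm_smul, Real.norm_eq_abs]
  calc _ ≤ (∑ i, |c i| * ‖v i ω‖) ^ 2 := by gcongr
    _ ≤ (∑ i, |c i| ^ 2) * ∑ i, ‖v i ω‖ ^ 2 := Finset.sum_mul_sq_le_sq_mul_sq _ _ _
    _ = _ := by simp only [sq_abs]; rfl

/-- The matrix 1 + cc^T doubles the component along the unit vector c, so the square of that
component is multiplied by 4. -/
theorem sqFun_rankOne (v : Fin d → Ω → ℂ) {c : Fin d → ℝ} (hc : ∑ i, c i ^ 2 = 1) (ω : Ω) :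
    sqFun (matComb (1 + Matrix.vecMulVec c c) v) ω = sqFun v ω + 3 * ‖lincomb v c ω‖ ^ 2 := by
  set w := lincomb v c ω with hw
  have h1 : ∀ i, matComb (1 + Matrix.vecMulVec c c) v i ω = v i ω + c i • w := by
    intro i
    simp only [matComb, lincomb, hw, Matrix.add_apply, Matrix.vecMulVec_apply, Matrix.one_apply,
      add_smul, Finset.sum_add_distrib, ite_smul, one_smul, zero_smul, Finset.sum_ite_eq,
      Finset.mem_univ, if_true, Finset.smul_sum, smul_smul]
  have h2 : ∑ i, inner ℝ (v i ω) (c i • w) = ‖w‖ ^ 2 := by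
    rw [← real_inner_self_eq_norm_sq]
    conv_rhs => rw [hw, lincomb, sum_inner]
    refine Finset.sum_congr rfl fun i _ => ?_
    rw [real_inner_smul_right, real_inner_smul_left]
    rfl
  unfold sqFun
  simp_rw [h1, norm_add_sq_real]
  rw [Finset.sum_add_distrib, Finset.sum_add_distrib, ← Finset.mul_sum, h2]
  have h3 : ∑ i, ‖c i • w‖ ^ 2 = ‖w‖ ^ 2 := by
    simp_rw [norm_smul, mul_pow, Real.norm_eq_abs, sq_abs]
    rw [← Finset.sum_mul, hc, one_mul]
  rw [h3]; ring

theorem det_one_add_vecMulVec_self {c : Fin d → ℝ} (hc : ∑ i, c i ^ 2 = 1) :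
    (1 + Matrix.vecMulVec c c).det = 2 := by
  rw [Matrix.vecMulVec_eq (Fin 1), Matrix.det_one_add_replicateCol_mul_replicateRow, dotProduct]
  have : ∑ i, c i * c i = 1 := by rw [← hc]; exact Finset.sum_congr rfl fun i _ => (sq _).symm
  rw [this]; norm_num

/-- With x = y/Φ in [0,1], the convex function t^(q/2) at 1+3x lies below its chord between 1 and 4.
-/
theorem add_rpow_le_add_mul {q Φ y : ℝ} (hq : 2 ≤ q) (hy : 0 ≤ y) (hyΦ : y ≤ Φ) :
    (Φ + 3 * y) ^ (q / 2) ≤ Φ ^ (q / 2) + 2 ^ q * (Φ ^ (q / 2 - 1) * y) := by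
  rcases eq_or_lt_of_le (hy.trans hyΦ) with h | h
  · have : y = 0 := le_antisymm (h ▸ hyΦ) hy
    simp [this]
  set x := y / Φ with hx
  have hx0 : 0 ≤ x := by positivity
  have hx1 : x ≤ 1 := by rwa [hx, div_le_one h]
  have hyx : y = Φ * x := by rw [hx]; field_simp
  have hconv := (convexOn_rpow (p := q / 2) (by linarith)).2
    (Set.mem_Ici.2 (by norm_num : (0 : ℝ) ≤ 1)) (Set.mem_Ici.2 (by norm_num : (0 : ℝ) ≤ 4))
    (sub_nonneg.2 hx1) hx0 (by ring)
  simp only [smul_eq_mul, Real.one_rpow] at hconv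
  have h4 : (4 : ℝ) ^ (q / 2) = 2 ^ q := by
    rw [show (4 : ℝ) = 2 ^ 2 by norm_num, rpow_half_sq (by norm_num)]
  rw [h4] at hconv
  have e1 : (1 - x) * 1 + x * 4 = 1 + 3 * x := by ring
  rw [e1] at hconv
  have e2 : Φ + 3 * y = Φ * (1 + 3 * x) := by rw [hyx]; ring
  have e3 : Φ ^ (q / 2 - 1) * y = Φ ^ (q / 2) * x := by
    rw [hyx, Real.rpow_sub_one h.ne']; field_simp
  rw [e2, e3, Real.mul_rpow h.le (by linarith)]
  have hΦ : 0 < Φ ^ (q / 2) := by positivity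
  nlinarith

theorem sqFun_smul (t : ℝ) (v : Fin d → Ω → ℂ) (A : Matrix (Fin d) (Fin d) ℝ) (ω : Ω) :
    sqFun (matComb (t • A) v) ω = t ^ 2 * sqFun (matComb A v) ω := by
  unfold sqFun matComb lincomb
  rw [Finset.mul_sum]
  refine Finset.sum_congr rfl fun i _ => ?_
  have : ∑ k, (t • A) i k • v k ω = t • ∑ k, A i k • v k ω := by
    rw [Finset.smul_sum]
    exact Finset.sum_congr rfl fun k _ => by
      rw [Matrix.smul_apply, smul_eq_mul, mul_smul]
  rw [this, norm_smul, mul_pow, Real.norm_eq_abs, sq_abs]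

variable [MeasurableSpace Ω]

theorem measurable_sqFun {v : Fin d → Ω → ℂ} (hv : ∀ i, Measurable (v i)) :
    Measurable (sqFun v) := by
  unfold sqFun
  exact Finset.measurable_fun_sum _ fun i _ => (hv i).norm.pow_const 2

theorem measurable_lincomb {v : Fin d → Ω → ℂ} (hv : ∀ i, Measurable (v i)) (c : Fin d → ℝ) :
    Measurable (lincomb v c) := by
  unfold lincomb
  exact Finset.measurable_fun_sum _ fun i _ => (hv i).const_smul (c i)

theorem memLp_lincomb {μ : Measure Ω} {p : ENNReal} {v : Fin d → Ω → ℂ}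
    (hv : ∀ i, MemLp (v i) p μ) (c : Fin d → ℝ) : MemLp (lincomb v c) p μ := by
  unfold lincomb
  exact memLp_finsetSum _ fun i _ => (hv i).const_smul (c i)

theorem integrable_sqFun_rpow {μ : Measure Ω} {q : ℝ} (hq : 2 ≤ q) {v : Fin d → Ω → ℂ}
    (hv : ∀ i, Measurable (v i)) (hvq : ∀ i, MemLp (v i) (ENNReal.ofReal q) μ) :
    Integrable (fun ω => sqFun v ω ^ (q / 2)) μ := by
  have h1 : MemLp (fun ω => √(sqFun v ω)) (ENNReal.ofReal q) μ := by
    refine (memLp_finsetSum Finset.univ fun i _ => (hvq i).norm).mono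
      (measurable_sqFun hv).sqrt.aestronglyMeasurable (Filter.Eventually.of_forall fun ω => ?_)
    rw [Real.norm_of_nonneg (Real.sqrt_nonneg _),
      Real.norm_of_nonneg (Finset.sum_nonneg fun _ _ => norm_nonneg _)]
    refine Real.sqrt_le_iff.2 ⟨Finset.sum_nonneg fun _ _ => norm_nonneg _, ?_⟩
    exact Finset.sum_sq_le_sq_sum_of_nonneg fun _ _ => norm_nonneg _
  have h2 := h1.integrable_norm_rpow (by simp; linarith) (by simp)
  refine h2.congr (Filter.Eventually.of_forall fun ω => ?_)
  simp only
  rw [ENNReal.toReal_ofReal (by linarith), Real.norm_of_nonneg (Real.sqrt_nonneg _),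
    ← rpow_half_sq (Real.sqrt_nonneg _), Real.sq_sqrt (sqFun_nonneg _ _)]

/-- Lewis' change of density, up to a constant, by nearly maximizing a determinant. -/
theorem exists_lewis_basis {μ : Measure Ω} {q κ : ℝ} (hq : 2 ≤ q) (hd : 1 ≤ d) (hκ : 0 < κ)
    {v : Fin d → Ω → ℂ} (hv : ∀ i, Measurable (v i))
    (hvq : ∀ i, MemLp (v i) (ENNReal.ofReal q) μ)
    (hlow : ∀ (c : Fin d → ℝ) (i : Fin d), κ * |c i| ^ q ≤ ∫ ω, ‖lincomb v c ω‖ ^ q ∂μ) :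
    ∃ A : Matrix (Fin d) (Fin d) ℝ, A.det ≠ 0 ∧
      ∫ ω, sqFun (matComb A v) ω ^ (q / 2) ∂μ = 1 ∧
      ∀ c : Fin d → ℝ, ∑ i, c i ^ 2 = 1 →
        q / (4 * 2 ^ q * d) ≤ ∫ ω, sqFun (matComb A v) ω ^ (q / 2 - 1) *
          ‖lincomb (matComb A v) c ω‖ ^ 2 ∂μ := by
  have hq0 : (0 : ℝ) < q := by linarith
  have hd0 : (0 : ℝ) < d := by exact_mod_cast hd
  have hAm : ∀ (A : Matrix (Fin d) (Fin d) ℝ) i, Measurable (matComb A v i) := fun A i =>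
    measurable_lincomb hv _
  have hAq : ∀ (A : Matrix (Fin d) (Fin d) ℝ) i, MemLp (matComb A v i) (ENNReal.ofReal q) μ :=
    fun A i => memLp_lincomb hvq _
  set S : Matrix (Fin d) (Fin d) ℝ → ℝ := fun A => ∫ ω, sqFun (matComb A v) ω ^ (q / 2) ∂μ with hS
  have hint : ∀ A, Integrable (fun ω => sqFun (matComb A v) ω ^ (q / 2)) μ := fun A =>
    integrable_sqFun_rpow hq (hAm A) (hAq A)
  have hrow : ∀ A i k, κ * |A i k| ^ q ≤ S A := by
    intro A i k
    refine (hlow (A i) k).trans ?_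
    refine integral_mono_of_nonneg (Filter.Eventually.of_forall fun ω => by positivity) (hint A)
      (Filter.Eventually.of_forall fun ω => ?_)
    simp only
    rw [← rpow_half_sq (norm_nonneg _)]
    apply Real.rpow_le_rpow (by positivity) _ (by linarith)
    exact Finset.single_le_sum (f := fun i => ‖matComb A v i ω‖ ^ 2) (fun i _ => by positivity)
      (Finset.mem_univ i)
  have hSsmul : ∀ (t : ℝ) A, 0 ≤ t → S (t • A) = t ^ q * S A := by
    intro t A ht
    simp only [hS]
    rw [← integral_const_mul]
    congr 1; ext ω
    rw [sqFun_smul, Real.mul_rpow (by positivity) (sqFun_nonneg _ _), rpow_half_sq ht]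
  have hnorm : ∀ A, 0 < S A → S ((S A ^ (-(1 / q))) • A) = 1 := by
    intro A hA
    rw [hSsmul _ _ (by positivity), ← Real.rpow_mul hA.le]
    have : -(1 / q) * q = -1 := by field_simp
    rw [this, Real.rpow_neg_one, inv_mul_cancel₀ hA.ne']
  -- The determinants of normalized systems are bounded, because `hrow` bounds every matrix entry.
  set U : Set ℝ := {r | ∃ A, S A = 1 ∧ |A.det| = r} with hU
  have hbdd : BddAbove U := by
    refine ⟨(Fintype.card (Fin d)).factorial • ((1 / κ) ^ (1 / q)) ^ Fintype.card (Fin d), ?_⟩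
    rintro _ ⟨A, hA, rfl⟩
    refine Matrix.det_le (abv := IsAbsoluteValue.toAbsoluteValue (abs : ℝ → ℝ)) fun i k => ?_
    have h1 := hrow A i k
    rw [hA] at h1
    have h2 : |A i k| ^ q ≤ 1 / κ := by rw [le_div_iff₀ hκ]; linarith
    change |A i k| ≤ _
    refine (Real.rpow_le_rpow_iff (abs_nonneg _) (by positivity) hq0).1 ?_
    rwa [← Real.rpow_mul (by positivity), one_div_mul_cancel hq0.ne', Real.rpow_one]
  have hS1 : 0 < S 1 := by
    have := hrow 1 ⟨0, hd⟩ ⟨0, hd⟩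
    rw [Matrix.one_apply_eq, abs_one, Real.one_rpow, mul_one] at this
    linarith
  set M := sSup U with hM
  have hMpos : 0 < M := by
    have hmem : |((S 1 ^ (-(1 / q))) • (1 : Matrix (Fin d) (Fin d) ℝ)).det| ∈ U :=
      ⟨_, hnorm 1 hS1, rfl⟩
    refine lt_of_lt_of_le ?_ (le_csSup hbdd hmem)
    rw [abs_pos, Matrix.det_smul, Matrix.det_one, mul_one]
    positivity
  -- A near-maximizer suffices, so attainment is not needed: doubling a determinant larger than 2/3
  -- of the supremum exceeds it by a factor 4/3.
  obtain ⟨_, ⟨A, hA1, rfl⟩, hAM⟩ := exists_lt_of_lt_csSup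
    (⟨_, _, hnorm 1 hS1, rfl⟩ : U.Nonempty) (show 2 / 3 * M < sSup U by rw [← hM]; linarith)
  refine ⟨A, ?_, hA1, fun c hc => ?_⟩
  · intro h
    rw [h, abs_zero] at hAM
    linarith
  set u := matComb A v with hu
  -- Stretching along c doubles the determinant, so S must grow by at least (4/3)^(q/d) ≥ 1 +
  -- q/(4d). It grows by at most 2^q times the integral in question, which is thereby bounded below.
  set T := (1 + Matrix.vecMulVec c c) * A with hT
  have hΦT : ∀ ω, sqFun (matComb T v) ω = sqFun u ω + 3 * ‖lincomb u c ω‖ ^ 2 := by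
    intro ω
    rw [hT, matComb_mul, sqFun_rankOne _ hc]
  have hdom : ∀ ω, ‖lincomb u c ω‖ ^ 2 ≤ sqFun u ω := by
    intro ω
    have := norm_lincomb_sq_le u c ω
    rwa [hc, one_mul] at this
  have hint2 : Integrable (fun ω => sqFun u ω ^ (q / 2 - 1) * ‖lincomb u c ω‖ ^ 2) μ := by
    refine (hint A).mono' ?_ (Filter.Eventually.of_forall fun ω => ?_)
    · exact (((measurable_sqFun (hAm A)).pow_const _).mul
        ((measurable_lincomb (hAm A) c).norm.pow_const 2)).aestronglyMeasurable
    · have h0 := sqFun_nonneg u ω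
      rw [Real.norm_of_nonneg (by positivity)]
      rcases eq_or_lt_of_le h0 with h | h
      · have h1 : ‖lincomb u c ω‖ ^ 2 = 0 := le_antisymm (h ▸ hdom ω) (by positivity)
        rw [h1, mul_zero]; positivity
      · calc _ ≤ sqFun u ω ^ (q / 2 - 1) * sqFun u ω :=
              mul_le_mul_of_nonneg_left (hdom ω) (by positivity)
          _ = _ := by rw [Real.rpow_sub_one h.ne']; field_simp; rfl
  have hup : S T ≤ S A + 2 ^ q * ∫ ω, sqFun u ω ^ (q / 2 - 1) * ‖lincomb u c ω‖ ^ 2 ∂μ := by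
    rw [← integral_const_mul]
    simp only [hS]
    rw [← integral_add (hint A) (hint2.const_mul _)]
    refine integral_mono (hint T) ((hint A).add (hint2.const_mul _)) fun ω => ?_
    simp only
    rw [hΦT]
    exact add_rpow_le_add_mul hq (by positivity) (hdom ω)
  rw [hA1] at hup
  have hST1 : 1 ≤ S T := by
    rw [← hA1]
    refine integral_mono (hint A) (hint T) fun ω => ?_
    simp only
    rw [hΦT]
    apply Real.rpow_le_rpow (sqFun_nonneg _ _) _ (by linarith)
    have : 0 ≤ ‖lincomb u c ω‖ ^ 2 := by positivity
    linarith
  have hST0 : 0 < S T := by linarith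
  have hdet : 2 * |A.det| ≤ M * S T ^ (d / q) := by
    have h1 := le_csSup hbdd (⟨_, hnorm T hST0, rfl⟩ : |((S T ^ (-(1 / q))) • T).det| ∈ U)
    rw [Matrix.det_smul, Fintype.card_fin, hT, Matrix.det_mul, det_one_add_vecMulVec_self hc,
      abs_mul, abs_mul, ← hT, abs_of_pos (by positivity), abs_two, ← Real.rpow_natCast,
      ← Real.rpow_mul hST0.le] at h1
    have e : S T ^ (-(1 / q) * (d : ℝ)) * S T ^ ((d : ℝ) / q) = 1 := by
      rw [← Real.rpow_add hST0]
      have : -(1 / q) * (d : ℝ) + d / q = 0 := by field_simp; ring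
      rw [this, Real.rpow_zero]
    calc 2 * |A.det| = S T ^ (-(1 / q) * (d : ℝ)) * (2 * |A.det|) * S T ^ ((d : ℝ) / q) := by
          rw [mul_comm (S T ^ (-(1 / q) * (d : ℝ))), mul_assoc, e, mul_one]
      _ ≤ _ := mul_le_mul_of_nonneg_right h1 (by positivity)
  have h43 : 4 / 3 ≤ S T ^ (d / q) := by
    by_contra! hcon
    nlinarith
  have hfin : 1 + q / d / 4 ≤ S T := by
    have h1 : (4 / 3 : ℝ) ^ (q / d) ≤ S T := by
      have := Real.rpow_le_rpow (by norm_num) h43 (show 0 ≤ q / d by positivity)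
      have e : (d : ℝ) / q * (q / d) = 1 := by field_simp
      rwa [← Real.rpow_mul hST0.le, e, Real.rpow_one] at this
    have h2 : 1 + q / d / 4 ≤ (4 / 3 : ℝ) ^ (q / d) := by
      rw [Real.rpow_def_of_pos (by norm_num)]
      have h3 := Real.add_one_le_exp (Real.log (4 / 3) * (q / d))
      have h4 := Real.one_sub_inv_le_log_of_pos (show (0 : ℝ) < 4 / 3 by norm_num)
      have h5 : 0 ≤ q / d := by positivity
      norm_num at h4
      nlinarith
    linarith
  have h2q : (0 : ℝ) < 2 ^ q := by positivity
  have e : q / (4 * 2 ^ q * d) = q / d / 4 / 2 ^ q := by field_simp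
  rw [e, div_le_iff₀ h2q]
  linarith

end Density

/-! ### Discretization after the change of density -/

section WeightedDiscretization

variable {Ω : Type*} {d : ℕ}

/-- Evaluation at `ω` of the combinations of `u`, normalized by the square function. -/
noncomputable def normalizedEval (D : ℝ) (u : Fin d → Ω → ℂ) (ω : Ω) :
    EuclideanSpace ℝ (Fin d) →L[ℝ] ℂ :=
  LinearMap.toContinuousLinearMap
    { toFun := fun x => (√D * (√(sqFun u ω))⁻¹) • lincomb u (fun i => x i) ω
      map_add' := fun x y => by
        simp only [lincomb, PiLp.add_apply, add_smul, Finset.sum_add_distrib, smul_add]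
      map_smul' := fun t x => by
        have : lincomb u (fun i => (t • x) i) ω = t • lincomb u (fun i => x i) ω := by
          simp only [lincomb, PiLp.smul_apply, smul_eq_mul, mul_smul, Finset.smul_sum]
        rw [this, smul_comm, RingHom.id_apply] }

theorem normalizedEval_apply (D : ℝ) (u : Fin d → Ω → ℂ) (ω : Ω) (x : EuclideanSpace ℝ (Fin d)) :
    normalizedEval D u ω x = (√D * (√(sqFun u ω))⁻¹) • lincomb u (fun i => x i) ω := rfl

theorem norm_normalizedEval (D : ℝ) (u : Fin d → Ω → ℂ) (ω : Ω) (x : EuclideanSpace ℝ (Fin d)) :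
    ‖normalizedEval D u ω x‖ = √D * (√(sqFun u ω))⁻¹ * ‖lincomb u (fun i => x i) ω‖ := by
  rw [normalizedEval_apply, norm_smul, Real.norm_of_nonneg (by positivity)]

theorem norm_lincomb_le (u : Fin d → Ω → ℂ) (ω : Ω) (x : EuclideanSpace ℝ (Fin d)) :
    ‖lincomb u (fun i => x i) ω‖ ≤ ‖x‖ * √(sqFun u ω) := by
  refine (abs_le_of_sq_le_sq' ?_ (by positivity)).2
  rw [mul_pow, Real.sq_sqrt (sqFun_nonneg _ _), EuclideanSpace.real_norm_sq_eq]
  exact norm_lincomb_sq_le u _ ω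

theorem norm_normalizedEval_le (D : ℝ) (u : Fin d → Ω → ℂ) (ω : Ω)
    (x : EuclideanSpace ℝ (Fin d)) : ‖normalizedEval D u ω x‖ ≤ √D * ‖x‖ := by
  rw [norm_normalizedEval]
  have h := norm_lincomb_le u ω x
  rcases eq_or_lt_of_le (Real.sqrt_nonneg (sqFun u ω)) with h0 | h0
  · rw [← h0, inv_zero, mul_zero, zero_mul]; positivity
  · calc _ ≤ √D * (√(sqFun u ω))⁻¹ * (‖x‖ * √(sqFun u ω)) :=
          mul_le_mul_of_nonneg_left h (by positivity)
      _ = _ := by field_simp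

theorem sqFun_rpow_mul_norm_normalizedEval_rpow {q D : ℝ} (hq : 2 ≤ q) (hD : 0 ≤ D)
    (u : Fin d → Ω → ℂ) (ω : Ω) (x : EuclideanSpace ℝ (Fin d)) :
    sqFun u ω ^ (q / 2) * ‖normalizedEval D u ω x‖ ^ q
      = D ^ (q / 2) * ‖lincomb u (fun i => x i) ω‖ ^ q := by
  have h := norm_lincomb_le u ω x
  have e : ∀ y : ℝ, 0 ≤ y → y ^ (q / 2) = √y ^ q := fun y hy => by
    rw [← rpow_half_sq (Real.sqrt_nonneg _), Real.sq_sqrt hy]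
  rw [e _ (sqFun_nonneg _ _), e _ hD, norm_normalizedEval]
  rcases eq_or_lt_of_le (Real.sqrt_nonneg (sqFun u ω)) with h0 | h0
  · rw [← h0, mul_zero] at h
    rw [le_antisymm h (norm_nonneg _), ← h0, Real.zero_rpow (by linarith)]; simp
  · rw [← Real.mul_rpow h0.le (by positivity), ← Real.mul_rpow (by positivity) (by positivity)]
    congr 1; field_simp

theorem sqFun_rpow_mul_norm_normalizedEval_sq {q D : ℝ} (hD : 0 ≤ D)
    (u : Fin d → Ω → ℂ) (ω : Ω) (x : EuclideanSpace ℝ (Fin d)) :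
    sqFun u ω ^ (q / 2) * ‖normalizedEval D u ω x‖ ^ 2
      = D * (sqFun u ω ^ (q / 2 - 1) * ‖lincomb u (fun i => x i) ω‖ ^ 2) := by
  have h := norm_lincomb_le u ω x
  rw [norm_normalizedEval, mul_pow, mul_pow, Real.sq_sqrt hD, inv_pow,
    Real.sq_sqrt (sqFun_nonneg _ _)]
  rcases eq_or_lt_of_le (sqFun_nonneg u ω) with h0 | h0
  · rw [← h0, Real.sqrt_zero, mul_zero] at h
    rw [le_antisymm h (norm_nonneg _)]; simp
  · rw [Real.rpow_sub_one h0.ne']; field_simp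

/-- The normalized evaluations meet the hypotheses of `exists_discretization` for the measure with
density Φ^(q/2). Both the normalization by √Φ and the factor D^(q/2) cancel from the q-th power
integrals, so the estimate returns to μ with the normalization absorbed into the weights. -/
theorem exists_weighted_discretization [MeasurableSpace Ω] {μ : Measure Ω}
    [IsProbabilityMeasure μ] {q κ : ℝ} (hq : 2 ≤ q) (hκ : 0 < κ)
    {v : Fin d → Ω → ℂ} (hv : ∀ i, Measurable (v i))
    (hvq : ∀ i, MemLp (v i) (ENNReal.ofReal q) μ)
    (hlow : ∀ (c : Fin d → ℝ) (i : Fin d), κ * |c i| ^ q ≤ ∫ ω, ‖lincomb v c ω‖ ^ q ∂μ)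
    {P : Ω → Prop} (hP : ∀ᵐ ω ∂μ, P ω) {ε : ℝ} (hε0 : 0 < ε) (hε1 : ε < 1) {N m L : ℕ}
    (hN : 1 ≤ N) (hdN : d ≤ 2 * N) (hm : 1 ≤ m) (hL : 1 ≤ L) (hmL : m ≤ 2 ^ L)
    (hε : 100 * signConst q *
      (√((2 ^ (q + 2) * N : ℝ) ^ (q / 2) / m) * (L : ℝ) ^ (1 - 1 / q)) ≤ ε) :
    ∃ (s : Finset ℕ) (ξ : ℕ → Ω) (w : ℕ → ℝ), s.card ≤ m ∧ (∀ i, P (ξ i)) ∧ ∀ a : Fin d → ℝ,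
      |∑ i ∈ s, w i * ‖lincomb v a (ξ i)‖ ^ q - ∫ ω, ‖lincomb v a ω‖ ^ q ∂μ|
        ≤ ε * ∫ ω, ‖lincomb v a ω‖ ^ q ∂μ := by
  have hq0 : (0 : ℝ) < q := by linarith
  rcases Nat.eq_zero_or_pos d with rfl | hd
  · obtain ⟨ω, hω⟩ := hP.exists
    refine ⟨∅, fun _ => ω, fun _ => 0, by simp, fun _ => hω, fun a => ?_⟩
    simp [lincomb, Real.zero_rpow hq0.ne']
  have hN0 : (0 : ℝ) < N := by exact_mod_cast hN
  have hd0 : (0 : ℝ) < d := by exact_mod_cast hd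
  obtain ⟨A, hAdet, hA1, hA2⟩ := exists_lewis_basis hq hd hκ hv hvq hlow
  set u := matComb A v with hu
  have hum : ∀ i, Measurable (u i) := fun i => measurable_lincomb hv _
  have huq : ∀ i, MemLp (u i) (ENNReal.ofReal q) μ := fun i => memLp_lincomb hvq _
  -- Chosen so that D times the lower bound q/(4·2^q·d) is at least 1, given d ≤ 2N and q ≥ 2.
  set D : ℝ := 2 ^ (q + 2) * N with hD
  have hD0 : 0 < D := by positivity
  have hΦint := integrable_sqFun_rpow hq hum huq
  have hΦm : Measurable fun ω => sqFun u ω ^ (q / 2) := (measurable_sqFun hum).pow_const _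
  have hΦ0 : ∀ ω, 0 ≤ sqFun u ω ^ (q / 2) := fun ω => by
    have := sqFun_nonneg u ω
    positivity
  set ν : Measure Ω := μ.withDensity fun ω => ENNReal.ofReal (sqFun u ω ^ (q / 2)) with hν
  have : IsProbabilityMeasure ν := by
    constructor
    rw [hν, withDensity_apply _ MeasurableSet.univ, Measure.restrict_univ,
      ← ofReal_integral_eq_lintegral_ofReal hΦint (Filter.Eventually.of_forall hΦ0), hA1,
      ENNReal.ofReal_one]
  have hνint : ∀ g : Ω → ℝ, ∫ ω, g ω ∂ν = ∫ ω, sqFun u ω ^ (q / 2) * g ω ∂μ := by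
    intro g
    rw [hν, integral_withDensity_eq_integral_toReal_smul hΦm.ennreal_ofReal
      (Filter.Eventually.of_forall fun ω => ENNReal.ofReal_lt_top)]
    congr 1; ext ω
    rw [ENNReal.toReal_ofReal (hΦ0 ω), smul_eq_mul]
  set f := normalizedEval D u with hf
  have hfm : ∀ x, Measurable fun ω => f ω x := fun x =>
    (((measurable_sqFun hum).sqrt.inv).const_mul (√D)).smul (measurable_lincomb hum _)
  have hfle := norm_normalizedEval_le D u
  have hfint : ∀ x, ∫ ω, ‖f ω x‖ ^ q ∂ν
      = D ^ (q / 2) * ∫ ω, ‖lincomb u (fun i => x i) ω‖ ^ q ∂μ := by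
    intro x
    rw [hνint, ← integral_const_mul]
    congr 1; ext ω
    exact sqFun_rpow_mul_norm_normalizedEval_rpow hq hD0.le u ω x
  have hunit : ∀ x : EuclideanSpace ℝ (Fin d), ‖x‖ = 1 → 1 ≤ ∫ ω, ‖f ω x‖ ^ q ∂ν := by
    intro x hx
    have hle1 : ∀ ω, ‖f ω x‖ ≤ √D := fun ω => by
      have := hfle ω x
      rwa [hx, mul_one] at this
    have i1 : Integrable (fun ω => ‖f ω x‖ ^ q) ν := by
      refine Integrable.of_bound ((hfm x).norm.pow_const q).aestronglyMeasurable (√D ^ q)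
        (Filter.Eventually.of_forall fun ω => ?_)
      rw [Real.norm_of_nonneg (by positivity)]
      exact Real.rpow_le_rpow (norm_nonneg _) (hle1 ω) hq0.le
    have i2 : Integrable (fun ω => ‖f ω x‖ ^ 2) ν := by
      refine Integrable.of_bound ((hfm x).norm.pow_const 2).aestronglyMeasurable (√D ^ 2)
        (Filter.Eventually.of_forall fun ω => ?_)
      rw [Real.norm_of_nonneg (by positivity)]
      have := hle1 ω
      gcongr
    have h2 : 1 ≤ ∫ ω, ‖f ω x‖ ^ 2 ∂ν := by
      rw [hνint]
      simp_rw [hf, sqFun_rpow_mul_norm_normalizedEval_sq hD0.le]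
      rw [integral_const_mul]
      have h3 := hA2 (fun i => x i) (by rw [← EuclideanSpace.real_norm_sq_eq, hx, one_pow])
      have h4 : 1 ≤ D * (q / (4 * 2 ^ q * d)) := by
        have h2q : (0 : ℝ) < 2 ^ q := by positivity
        rw [← mul_div_assoc, one_le_div (by positivity), hD, Real.rpow_add (by norm_num)]
        have : (d : ℝ) ≤ 2 * N := by exact_mod_cast hdN
        calc 4 * 2 ^ q * (d : ℝ) ≤ 4 * 2 ^ q * (2 * N) := by gcongr
          _ = 2 ^ q * 2 ^ (2 : ℝ) * N * 2 := by norm_num; ring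
          _ ≤ _ := by gcongr
      exact h4.trans (mul_le_mul_of_nonneg_left h3 hD0.le)
    -- Bernoulli's inequality for the power q/2 of |f|² passes from the second moment to the q-th: a
    -- mean square of at least 1 forces the q-th moment to be at least 1.
    have h5 : ∫ ω, (1 + q / 2 * (‖f ω x‖ ^ 2 - 1)) ∂ν ≤ ∫ ω, ‖f ω x‖ ^ q ∂ν := by
      refine integral_mono ((integrable_const _).add ((i2.sub (integrable_const _)).const_mul _))
        i1 fun ω => ?_
      have := one_add_mul_self_le_rpow_one_add (s := ‖f ω x‖ ^ 2 - 1) (p := q / 2)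
        (by have : 0 ≤ ‖f ω x‖ ^ 2 := by positivity
            linarith) (by linarith)
      rwa [add_sub_cancel, rpow_half_sq (norm_nonneg _)] at this
    have i3 : Integrable (fun ω => ‖f ω x‖ ^ 2 - 1) ν := i2.sub (integrable_const _)
    have h6 : ∫ ω, (‖f ω x‖ ^ 2 - 1) ∂ν = ∫ ω, ‖f ω x‖ ^ 2 ∂ν - 1 := by
      rw [integral_sub i2 (integrable_const _)]; simp
    rw [integral_add (integrable_const _) (i3.const_mul _), integral_const_mul, h6] at h5
    simp only [integral_const, probReal_univ, smul_eq_mul, mul_one] at h5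
    nlinarith
  have hlowf : ∀ x, ‖x‖ ^ q ≤ ∫ ω, ‖f ω x‖ ^ q ∂ν := by
    intro x
    rcases eq_or_ne x 0 with rfl | hx
    · rw [norm_zero, Real.zero_rpow hq0.ne']
      exact integral_nonneg fun ω => by positivity
    · have hxn : 0 < ‖x‖ := norm_pos_iff.2 hx
      have h1 := hunit (‖x‖⁻¹ • x) (norm_smul_inv_norm (𝕜 := ℝ) hx)
      have h2 : ∀ ω, ‖f ω x‖ ^ q = ‖x‖ ^ q * ‖f ω (‖x‖⁻¹ • x)‖ ^ q := by
        intro ω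
        rw [map_smul, norm_smul, norm_inv, norm_norm, ← Real.mul_rpow hxn.le (by positivity),
          mul_inv_cancel_left₀ hxn.ne']
      simp_rw [h2]
      rw [integral_const_mul]
      exact le_mul_of_one_le_right (by positivity) h1
  have hPν : ∀ᵐ ω ∂ν, P ω := (withDensity_absolutelyContinuous μ _).ae_le hP
  obtain ⟨s, ξ, hs1, hs2, hs3⟩ := exists_discretization ν f hq hD0 hfm hfle hlowf hPν hε0 hε1 hm
    hL hmL hε
  refine ⟨s, ξ, fun i => ((√(sqFun u (ξ i)))⁻¹) ^ q / m, hs1, hs2, fun a => ?_⟩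
  have hva : lincomb v a = lincomb u (Matrix.vecMul a A⁻¹) := by
    rw [hu, lincomb_matComb, Matrix.vecMul_vecMul, Matrix.nonsing_inv_mul _ (Ne.isUnit hAdet),
      Matrix.vecMul_one]
  have h := hs3 (WithLp.toLp 2 (Matrix.vecMul a A⁻¹))
  rw [hfint] at h
  simp only [hf, norm_normalizedEval, ← hva] at h
  have hDq : 0 < D ^ (q / 2) := by positivity
  have e1 : (∑ i ∈ s, (√D * (√(sqFun u (ξ i)))⁻¹ * ‖lincomb v a (ξ i)‖) ^ q) / m
      = D ^ (q / 2) * ∑ i ∈ s, ((√(sqFun u (ξ i)))⁻¹) ^ q / m * ‖lincomb v a (ξ i)‖ ^ q := by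
    rw [Finset.mul_sum, Finset.sum_div]
    refine Finset.sum_congr rfl fun i _ => ?_
    rw [Real.mul_rpow (by positivity) (norm_nonneg _), Real.mul_rpow (by positivity)
      (by positivity), ← rpow_half_sq (Real.sqrt_nonneg D), Real.sq_sqrt hD0.le]
    ring
  rw [e1, ← mul_sub, abs_mul, abs_of_pos hDq, mul_left_comm] at h
  exact le_of_mul_le_mul_left h hDq

end WeightedDiscretization

/-! ### A measurable real basis modulo null sets -/

section RealBasis

variable {Ω : Type*} [MeasurableSpace Ω] {μ : Measure Ω}

theorem lpNorm_ofReal_rpow {E : Type*} [NormedAddCommGroup E] {q : ℝ} (hq : 0 < q) {f : Ω → E}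
    (hf : AEStronglyMeasurable f μ) :
    lpNorm f (ENNReal.ofReal q) μ ^ q = ∫ ω, ‖f ω‖ ^ q ∂μ := by
  rw [lpNorm_eq_integral_norm_rpow_toReal (by simpa using hq) ENNReal.ofReal_ne_top hf,
    ENNReal.toReal_ofReal hq.le, Real.rpow_inv_rpow (integral_nonneg fun ω => by positivity) hq.ne']

/-- The basis is taken in L_q, because functions independent pointwise may be dependent almost
everywhere. Equivalence of norms in finite dimension gives κ. The representation holds only almost
everywhere; this is the property later required of all nodes. -/
theorem exists_measurable_real_basis {ι : Type*} [Fintype ι] {q : ℝ} (hq : 1 ≤ q)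
    {g : ι → Ω → ℂ} (hg : ∀ i, MemLp (g i) (ENNReal.ofReal q) μ) :
    ∃ (d : ℕ) (v : Fin d → Ω → ℂ) (A : ι → Fin d → ℝ) (κ : ℝ), d ≤ Fintype.card ι ∧
      (∀ k, Measurable (v k)) ∧ (∀ k, MemLp (v k) (ENNReal.ofReal q) μ) ∧ 0 < κ ∧
      (∀ (c : Fin d → ℝ) (k : Fin d), κ * |c k| ^ q ≤ ∫ ω, ‖lincomb v c ω‖ ^ q ∂μ) ∧
      ∀ᵐ ω ∂μ, ∀ i, g i ω = lincomb v (A i) ω := by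
  have hq0 : 0 < q := by linarith
  have hfact : Fact (1 ≤ ENNReal.ofReal q) := ⟨by simpa using hq⟩
  set G : ι → Lp ℂ (ENNReal.ofReal q) μ := fun i => (hg i).toLp (g i) with hG
  set W := Submodule.span ℝ (Set.range G) with hW
  have hfin : FiniteDimensional ℝ W := FiniteDimensional.span_of_finite ℝ (Set.finite_range G)
  set b := Module.finBasis ℝ W with hb
  have hv : ∀ k, ∃ v : Ω → ℂ, Measurable v ∧ ((b k : Lp ℂ (ENNReal.ofReal q) μ) : Ω → ℂ) =ᵐ[μ] v :=
    fun k => (Lp.stronglyMeasurable (b k : Lp ℂ (ENNReal.ofReal q) μ)).measurable.aemeasurable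
  choose v hvm hvb using hv
  have hcomb : ∀ c : Fin (Module.finrank ℝ W) → ℝ,
      ((∑ k, c k • (b k : Lp ℂ (ENNReal.ofReal q) μ) : Lp ℂ (ENNReal.ofReal q) μ) : Ω → ℂ)
        =ᵐ[μ] lincomb v c := by
    intro c
    have h1 := Lp.coeFn_fun_finsetSum Finset.univ
      fun k => c k • (b k : Lp ℂ (ENNReal.ofReal q) μ)
    have h2 : ∀ᵐ ω ∂μ, ∀ k, (c k • (b k : Lp ℂ (ENNReal.ofReal q) μ) : Lp ℂ _ μ) ω = c k • v k ω := by
      rw [ae_all_iff]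
      intro k
      filter_upwards [Lp.coeFn_smul (c k) (b k : Lp ℂ (ENNReal.ofReal q) μ), hvb k] with ω h3 h4
      rw [h3, Pi.smul_apply, h4]
    filter_upwards [h1, h2] with ω h3 h4
    rw [h3, lincomb]
    exact Finset.sum_congr rfl fun k _ => h4 k
  set T : (Fin (Module.finrank ℝ W) → ℝ) →ₗ[ℝ] W := b.equivFun.symm.toLinearMap with hT
  obtain ⟨K, hK0, hK⟩ := T.exists_antilipschitzWith (LinearMap.ker_eq_bot.2 b.equivFun.symm.injective)
  have hTc : ∀ c, ((T c : W) : Lp ℂ (ENNReal.ofReal q) μ)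
      = ∑ k, c k • (b k : Lp ℂ (ENNReal.ofReal q) μ) := by
    intro c
    simp [hT, Module.Basis.equivFun_symm_apply]
  have hK0' : (0 : ℝ) < K := by exact_mod_cast hK0
  refine ⟨_, v, fun i => b.equivFun ⟨G i, Submodule.subset_span ⟨i, rfl⟩⟩, ((K : ℝ)⁻¹) ^ q,
    finrank_range_le_card G, hvm, fun k => MemLp.ae_eq (hvb k) (Lp.memLp (b k : Lp ℂ (ENNReal.ofReal q) μ)),
    by positivity, ?_, ?_⟩
  · intro c k
    have h1 : ‖c‖ ≤ K * ‖T c‖ := by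
      have := hK.le_mul_norm_sub c 0
      simpa using this
    have h2 : ∫ ω, ‖lincomb v c ω‖ ^ q ∂μ = ‖T c‖ ^ q := by
      have h3 : ‖T c‖ = lpNorm (lincomb v c) (ENNReal.ofReal q) μ := by
        rw [Submodule.coe_norm, hTc, Lp.norm_def, eLpNorm_congr_ae (hcomb c), toReal_eLpNorm]
        exact (measurable_lincomb hvm c).aestronglyMeasurable
      rw [h3, lpNorm_ofReal_rpow hq0 (measurable_lincomb hvm c).aestronglyMeasurable]
    rw [h2, ← Real.mul_rpow (by positivity) (abs_nonneg _)]
    refine Real.rpow_le_rpow (by positivity) ?_ hq0.le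
    rw [inv_mul_le_iff₀ hK0']
    exact (norm_le_pi_norm c k).trans h1
  · rw [ae_all_iff]
    intro i
    have h1 := hcomb (b.equivFun ⟨G i, Submodule.subset_span ⟨i, rfl⟩⟩)
    rw [← hTc, hT, LinearEquiv.coe_coe, LinearEquiv.symm_apply_apply] at h1
    exact (hg i).coeFn_toLp.symm.trans h1

end RealBasis

/-- m may be far larger than any power of N, so log m cannot replace log N. Only m₀ nodes, just
above the threshold, are used; for these log m₀ is of order log N. -/
theorem exists_sample_size {q ε : ℝ} (hq : 2 ≤ q) (hε : 0 < ε) :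
    ∃ C : ℝ, 0 < C ∧ ∀ N m : ℕ, 2 ≤ N →
      C * (N : ℝ) ^ (q / 2) * Real.log (N : ℝ) ^ (2 - 2 / q) ≤ (m : ℝ) →
      ∃ m₀ L : ℕ, 1 ≤ m₀ ∧ m₀ ≤ m ∧ 1 ≤ L ∧ m₀ ≤ 2 ^ L ∧
        100 * signConst q *
          (√((2 ^ (q + 2) * N : ℝ) ^ (q / 2) / m₀) * (L : ℝ) ^ (1 - 1 / q)) ≤ ε := by
  have hq0 : 0 < q := by linarith
  have hs := signConst_pos hq
  set S := 100 * signConst q / ε with hS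
  set H : ℝ := (2 ^ (q + 2)) ^ (q / 2) with hH
  have hS0 : 0 < S := by positivity
  have hH0 : 0 < H := by positivity
  set K := S ^ 2 * H with hK
  have hK0 : 0 < K := by positivity
  obtain ⟨b, hb⟩ := pow_unbounded_of_one_lt K (one_lt_two : (1 : ℝ) < 2)
  set r := ⌈q⌉₊ with hr
  -- Large enough for the threshold t to stay below 2^L with L = 2βk: b absorbs the constant K, r
  -- the power of N, and the rest the power of L itself.
  set β := b + r + 2 with hβ
  have hqq : 2 / q ≤ 1 := by rw [div_le_one hq0]; exact hq
  have hqp : 0 < 2 / q := by positivity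
  refine ⟨K * (6 * β) ^ (2 - 2 / q), by positivity, fun N m hN hm => ?_⟩
  have hN0 : (1 : ℝ) ≤ N := by exact_mod_cast (by omega : 1 ≤ N)
  set k := Nat.log 2 N + 1 with hk
  have hk1 : 1 ≤ Nat.log 2 N := Nat.log_pos one_lt_two hN
  have hNk : N ≤ 2 ^ k := (Nat.lt_pow_succ_log_self one_lt_two N).le
  have hkN : (k : ℝ) ≤ 3 * Real.log N := by
    have h1 : ((2 : ℕ) ^ Nat.log 2 N : ℝ) ≤ N := by
      exact_mod_cast Nat.pow_log_le_self 2 (by omega : N ≠ 0)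
    have h2 := Real.log_le_log (by positivity) h1
    rw [Real.log_pow] at h2
    have h3 := Real.log_two_gt_d9
    have h4 : (1 : ℝ) ≤ Nat.log 2 N := by exact_mod_cast hk1
    rw [hk]; push_cast at h2 ⊢
    nlinarith
  set L := 2 * β * k with hL
  have hL1 : 1 ≤ L := Nat.mul_pos (by omega) (by omega)
  have hL1' : (1 : ℝ) ≤ L := by exact_mod_cast hL1
  have hLN : (L : ℝ) ≤ 6 * β * Real.log N := by
    rw [hL]; push_cast
    nlinarith [(Nat.cast_nonneg β : (0 : ℝ) ≤ β)]
  -- The solution of the error condition for the sample size: with m₀ = t nodes the error would be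
  -- exactly ε.
  set t := K * (N : ℝ) ^ (q / 2) * (L : ℝ) ^ (2 - 2 / q) with ht
  have ht0 : 0 < t := by positivity
  have hlog : 0 ≤ Real.log N := Real.log_nonneg hN0
  have htm : t ≤ m := by
    refine le_trans ?_ hm
    calc t ≤ K * (N : ℝ) ^ (q / 2) * (6 * β * Real.log N) ^ (2 - 2 / q) := by
          rw [ht]; gcongr; linarith
      _ = _ := by rw [Real.mul_rpow (by positivity) hlog]; ring
  have htL : t ≤ ((2 ^ L : ℕ) : ℝ) := by
    have h1 : (N : ℝ) ^ (q / 2) ≤ 2 ^ (k * r) := by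
      calc (N : ℝ) ^ (q / 2) ≤ (N : ℝ) ^ (r : ℝ) :=
            Real.rpow_le_rpow_of_exponent_le hN0 (by have := Nat.le_ceil q; linarith)
        _ = (N : ℝ) ^ r := Real.rpow_natCast _ _
        _ ≤ (2 ^ k) ^ r := by gcongr; exact_mod_cast hNk
        _ = _ := by rw [pow_mul]
    have h2 : (L : ℝ) ^ (2 - 2 / q) ≤ (L : ℝ) ^ 2 := by
      calc _ ≤ (L : ℝ) ^ (2 : ℝ) := Real.rpow_le_rpow_of_exponent_le hL1' (by linarith)
        _ = _ := by norm_num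
    have h3 : L ≤ 2 ^ β * 2 ^ k := by
      have h4 : 2 * β ≤ 2 ^ β := by
        have := Nat.lt_two_pow_self (n := β - 1)
        have h5 : 2 ^ β = 2 * 2 ^ (β - 1) := by
          rw [← pow_succ']; congr 1
        omega
      exact Nat.mul_le_mul h4 Nat.lt_two_pow_self.le
    have h6 : (L : ℝ) ^ 2 ≤ 2 ^ (2 * (β + k)) := by
      rw [mul_comm, pow_mul, pow_add]
      have : (L : ℝ) ≤ 2 ^ β * 2 ^ k := by exact_mod_cast h3
      gcongr
    calc t ≤ 2 ^ b * 2 ^ (k * r) * 2 ^ (2 * (β + k)) := by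
          rw [ht]; gcongr; exact h2.trans h6
      _ = 2 ^ (b + k * r + 2 * (β + k)) := by rw [pow_add, pow_add]
      _ ≤ 2 ^ L := by
          refine pow_le_pow_right₀ one_le_two ?_
          have e : 2 ≤ k := by omega
          have e1 : b ≤ k * b := Nat.le_mul_of_pos_left b (by omega)
          have e2 : 2 * β ≤ k * β := Nat.mul_le_mul_right β e
          have e3 : L = k * b + k * r + 2 * k + k * β := by rw [hL, hβ]; ring
          omega
      _ = _ := by push_cast; rfl
  refine ⟨⌈t⌉₊, L, Nat.ceil_pos.2 ht0, Nat.ceil_le.2 htm, hL1, Nat.ceil_le.2 htL, ?_⟩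
  have hM := Nat.le_ceil t
  have hM0 : (0 : ℝ) < ⌈t⌉₊ := by exact_mod_cast Nat.ceil_pos.2 ht0
  set y := √((2 ^ (q + 2) * N : ℝ) ^ (q / 2) / ⌈t⌉₊) * (L : ℝ) ^ (1 - 1 / q) with hy
  have hL2 : ((L : ℝ) ^ (1 - 1 / q)) ^ 2 = (L : ℝ) ^ (2 - 2 / q) := by
    rw [← Real.rpow_mul_natCast (by positivity)]
    congr 1; push_cast; ring
  have hy2 : (S * y) ^ 2 = t / ⌈t⌉₊ := by
    rw [hy, mul_pow, mul_pow, Real.sq_sqrt (by positivity), hL2,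
      Real.mul_rpow (by positivity) (by positivity), ht, hK]
    ring
  have hy3 : S * y ≤ 1 := by
    refine (abs_le_of_sq_le_sq' ?_ zero_le_one).2
    rw [hy2, one_pow, div_le_one hM0]
    exact hM
  have e : 100 * signConst q * y = ε * (S * y) := by rw [hS]; field_simp
  rw [e]
  nlinarith

/-! ### Real coefficients for real and complex spaces -/

section Coefficients

variable {𝕜 : Type*} [RCLike 𝕜] {Ω : Type*}

theorem RCLike.norm_map_complex (z : 𝕜) : ‖RCLike.map 𝕜 ℂ z‖ = ‖z‖ := by
  rw [← sq_eq_sq₀ (norm_nonneg _) (norm_nonneg _), ← RCLike.normSq_eq_def', ← RCLike.normSq_eq_def',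
    RCLike.normSq_apply, RCLike.normSq_apply]
  simp

/-- Splitting each scalar into real and imaginary parts doubles the system to u and iu. Over the
reals I = 0, and the second family is zero. -/
theorem exists_real_coefficients {N : ℕ} (u : Fin N → Ω → 𝕜) {f : Ω → 𝕜}
    (hf : f ∈ Submodule.span 𝕜 (Set.range u)) :
    ∃ c : Fin N ⊕ Fin N → ℝ, ∀ ω, RCLike.map 𝕜 ℂ (f ω) =
      ∑ i, c i • Sum.elim (fun j ω => RCLike.map 𝕜 ℂ (u j ω))
        (fun j ω => RCLike.map 𝕜 ℂ (RCLike.I * u j ω)) i ω := by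
  obtain ⟨a, rfl⟩ := (Submodule.mem_span_range_iff_exists_fun 𝕜).1 hf
  refine ⟨Sum.elim (fun j => RCLike.re (a j)) fun j => RCLike.im (a j), fun ω => ?_⟩
  rw [Fintype.sum_sum_type, ← Finset.sum_add_distrib, Finset.sum_apply, map_sum]
  refine Finset.sum_congr rfl fun j _ => ?_
  simp only [Sum.elim_inl, Sum.elim_inr, Pi.smul_apply, smul_eq_mul]
  rw [← map_smul, ← map_smul, ← map_add]
  congr 1
  conv_lhs => rw [← RCLike.re_add_im (a j)]
  rw [RCLike.real_smul_eq_coe_mul, RCLike.real_smul_eq_coe_mul]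
  ring

theorem sum_smul_lincomb {ι : Type*} [Fintype ι] {d : ℕ} (v : Fin d → Ω → ℂ) (A : ι → Fin d → ℝ)
    (c : ι → ℝ) (ω : Ω) :
    ∑ i, c i • lincomb v (A i) ω = lincomb v (fun k => ∑ i, c i * A i k) ω := by
  simp only [lincomb, Finset.smul_sum, Finset.sum_smul, smul_smul]
  exact Finset.sum_comm

end Coefficients

/-! ### Reduction of the theorem to real combinations -/

section Reduction

variable {𝕜 : Type*} [RCLike 𝕜] {Ω : Type*} [MeasurableSpace Ω] {μ : Measure Ω}

/-- Fewer than m nodes are padded with an arbitrary point of weight 0. -/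
theorem weightedMarcinkiewiczEps_of_finset {X : Submodule 𝕜 (Ω → 𝕜)} {m : ℕ} {q ε : ℝ}
    (s : Finset ℕ) (ξ : ℕ → Ω) (w : ℕ → ℝ) (hs : s.card ≤ m)
    (h : ∀ f ∈ X, |∑ i ∈ s, w i * ‖f (ξ i)‖ ^ q - lpNorm f (ENNReal.ofReal q) μ ^ q|
      ≤ ε * lpNorm f (ENNReal.ofReal q) μ ^ q) : WeightedMarcinkiewiczEps μ X m q ε := by
  set φ : s → Fin m := fun i => Fin.castLE hs (s.equivFin i) with hφ
  have hinj : Function.Injective φ := (Fin.castLE_injective hs).comp s.equivFin.injective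
  refine ⟨Function.extend φ (fun i => ξ i) fun _ => ξ 0,
    Function.extend φ (fun i => w i) fun _ => (0 : ℝ), fun f hf => ?_⟩
  have e : ∑ ν : Fin m, Function.extend φ (fun i => w i) (fun _ => (0 : ℝ)) ν *
      ‖f (Function.extend φ (fun i => ξ i) (fun _ => ξ 0) ν)‖ ^ q
        = ∑ i ∈ s, w i * ‖f (ξ i)‖ ^ q := by
    rw [← Finset.sum_coe_sort s fun i => w i * ‖f (ξ i)‖ ^ q]
    refine (Fintype.sum_of_injective φ hinj _ _ (fun ν hν => ?_) fun i => ?_).symm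
    · rw [Function.extend_apply' _ _ _ hν, zero_mul]
    · rw [hinj.extend_apply, hinj.extend_apply]
  rw [e]
  have := abs_le.1 (h f hf)
  constructor <;> linarith [this.1, this.2]

/-- Every node satisfies the almost-everywhere identities for the 2N generators, so the value of |f|
at the nodes and its integral are those of one real combination of the measurable basis. -/
theorem weightedMarcinkiewiczEps_span [IsProbabilityMeasure μ] {q ε : ℝ} (hq : 2 ≤ q)
    (hε0 : 0 < ε) (hε1 : ε < 1) {N : ℕ} (hN : 1 ≤ N) {u : Fin N → Ω → 𝕜}
    (hum : ∀ j, Measurable (u j)) (hu : ∀ j, MemLp (u j) (ENNReal.ofReal q) μ)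
    {m m₀ L : ℕ} (hm₀ : 1 ≤ m₀) (hmm : m₀ ≤ m) (hL : 1 ≤ L) (hmL : m₀ ≤ 2 ^ L)
    (hε : 100 * signConst q *
      (√((2 ^ (q + 2) * N : ℝ) ^ (q / 2) / m₀) * (L : ℝ) ^ (1 - 1 / q)) ≤ ε) :
    WeightedMarcinkiewiczEps μ (Submodule.span 𝕜 (Set.range u)) m q ε := by
  have hmap : ∀ f : Ω → 𝕜, MemLp f (ENNReal.ofReal q) μ →
      MemLp (fun ω => RCLike.map 𝕜 ℂ (f ω)) (ENNReal.ofReal q) μ := fun f hf =>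
    (RCLike.map 𝕜 ℂ).comp_memLp' hf
  obtain ⟨d, v, A, κ, hd, hvm, hv, hκ, hlow, hP⟩ := exists_measurable_real_basis (μ := μ)
    (by linarith : 1 ≤ q)
    (g := Sum.elim (fun j ω => RCLike.map 𝕜 ℂ (u j ω))
      (fun j ω => RCLike.map 𝕜 ℂ (RCLike.I * u j ω)))
    (Sum.rec (fun j => hmap _ (hu j)) fun j => hmap _ ((hu j).const_mul _))
  have hd' : d ≤ 2 * N := by simpa [two_mul] using hd
  obtain ⟨s, ξ, w, hs, hξ, h⟩ := exists_weighted_discretization hq hκ hvm hv hlow hP hε0 hε1 hN hd'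
    hm₀ hL hmL hε
  refine weightedMarcinkiewiczEps_of_finset s ξ w (hs.trans hmm) fun f hf => ?_
  obtain ⟨c, hc⟩ := exists_real_coefficients u hf
  have hfv : ∀ ω, (∀ i, Sum.elim (fun j ω => RCLike.map 𝕜 ℂ (u j ω))
      (fun j ω => RCLike.map 𝕜 ℂ (RCLike.I * u j ω)) i ω = lincomb v (A i) ω) →
      ‖f ω‖ = ‖lincomb v (fun k => ∑ i, c i * A i k) ω‖ := fun ω hω => by
    rw [← RCLike.norm_map_complex, hc, ← sum_smul_lincomb]
    simp_rw [hω]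
  have hfm : Measurable f := by
    obtain ⟨a, rfl⟩ := (Submodule.mem_span_range_iff_exists_fun 𝕜).1 hf
    rw [Finset.sum_fn]
    exact Finset.measurable_sum _ fun j _ => (hum j).const_smul (a j)
  have hint : lpNorm f (ENNReal.ofReal q) μ ^ q
      = ∫ ω, ‖lincomb v (fun k => ∑ i, c i * A i k) ω‖ ^ q ∂μ := by
    rw [lpNorm_ofReal_rpow (by linarith) hfm.aestronglyMeasurable]
    refine integral_congr_ae ?_
    filter_upwards [hP] with ω hω
    rw [hfv ω hω]
  have hsum : ∑ i ∈ s, w i * ‖f (ξ i)‖ ^ q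
      = ∑ i ∈ s, w i * ‖lincomb v (fun k => ∑ i, c i * A i k) (ξ i)‖ ^ q :=
    Finset.sum_congr rfl fun i _ => by rw [hfv _ (hξ i)]
  rw [hint, hsum]
  exact h _

/-- On a line all the functionals are multiples of each other, so one node where u does not vanish,
suitably weighted, is exact. -/
theorem weightedMarcinkiewiczEps_span_singleton [Nonempty Ω] {q ε : ℝ} (hq : 0 < q) (hε0 : 0 < ε)
    (u : Ω → 𝕜) (hu : MemLp u (ENNReal.ofReal q) μ) {m : ℕ} (hm : 1 ≤ m) :
    WeightedMarcinkiewiczEps μ (Submodule.span 𝕜 {u}) m q ε := by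
  have hlp : ∀ a : 𝕜, lpNorm (a • u) (ENNReal.ofReal q) μ ^ q
      = ‖a‖ ^ q * lpNorm u (ENNReal.ofReal q) μ ^ q := fun a => by
    rw [lpNorm_ofReal_rpow hq (hu.const_smul a).1, lpNorm_ofReal_rpow hq hu.1,
      ← integral_const_mul]
    congr 1; ext ω
    rw [Pi.smul_apply, norm_smul, Real.mul_rpow (norm_nonneg _) (norm_nonneg _)]
  obtain ⟨ξ, w, hw⟩ : ∃ (ξ : Ω) (w : ℝ), w * ‖u ξ‖ ^ q = lpNorm u (ENNReal.ofReal q) μ ^ q := by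
    by_cases h : ∃ ξ, u ξ ≠ 0
    · obtain ⟨ξ, hξ⟩ := h
      have : 0 < ‖u ξ‖ := norm_pos_iff.2 hξ
      exact ⟨ξ, lpNorm u (ENNReal.ofReal q) μ ^ q / ‖u ξ‖ ^ q, by field_simp⟩
    · push Not at h
      obtain rfl : u = 0 := funext h
      exact ⟨Classical.arbitrary Ω, 0, by rw [lpNorm_zero, Real.zero_rpow hq.ne', zero_mul]⟩
  refine weightedMarcinkiewiczEps_of_finset {0} (fun _ => ξ) (fun _ => w) (by simpa using hm)
    fun f hf => ?_
  obtain ⟨a, rfl⟩ := Submodule.mem_span_singleton.1 hf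
  rw [hlp, ← hw, Finset.sum_singleton, Pi.smul_apply, norm_smul,
    Real.mul_rpow (norm_nonneg _) (norm_nonneg _), mul_left_comm, sub_self, abs_zero, hw, ← hlp]
  exact mul_nonneg hε0.le (Real.rpow_nonneg lpNorm_nonneg _)

end Reduction

theorem mainTheorem4 (q : ℝ) (hq : 2 ≤ q) (ε : ℝ) (hε : ε ∈ Set.Ioo (0 : ℝ) 1) :
    ∃ C : ℝ, 0 < C ∧
      ∀ (𝕜 : Type) [RCLike 𝕜]
        (Ω : Type*) [TopologicalSpace Ω] [MeasurableSpace Ω] [BorelSpace Ω]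
        (μ : Measure Ω) [IsProbabilityMeasure μ]
        (N : ℕ) (X : Submodule 𝕜 (Ω → 𝕜)),
        X ≤ continuousLq 𝕜 μ q → SpannedBy X N →
        ∀ m : ℕ, 1 ≤ m →
          C * (N : ℝ) ^ (q / 2) * Real.log (N : ℝ) ^ (2 - 2 / q) ≤ (m : ℝ) →
          WeightedMarcinkiewiczEps μ X m q ε := by
  obtain ⟨C, hC, h⟩ := exists_sample_size hq hε.1
  refine ⟨C, hC, ?_⟩
  intro 𝕜 _ Ω _ _ _ μ _ N X hX hXN m hm hCm
  have hΩ : Nonempty Ω := nonempty_of_isProbabilityMeasure μ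
  have hq0 : 0 < q := by linarith
  obtain ⟨u, rfl⟩ := hXN
  have hu : ∀ j, Continuous (u j) ∧ MemLp (u j) (ENNReal.ofReal q) μ := fun j =>
    hX (Submodule.subset_span ⟨j, rfl⟩)
  -- For N = 0 and N = 1 the right-hand side of the size condition vanishes, so only m ≥ 1 is
  -- available and one node has to suffice.
  rcases (by omega : N = 0 ∨ N = 1 ∨ 2 ≤ N) with rfl | rfl | hN
  · have e : Set.range u = ∅ := Set.range_eq_empty u
    have e0 : Submodule.span 𝕜 (Set.range u) = Submodule.span 𝕜 {(0 : Ω → 𝕜)} := by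
      rw [e, Submodule.span_empty, Submodule.span_zero_singleton]
    rw [e0]
    have h0 : MemLp (0 : Ω → 𝕜) (ENNReal.ofReal q) μ := MemLp.zero
    exact weightedMarcinkiewiczEps_span_singleton hq0 hε.1 0 h0 hm
  · rw [Set.range_unique]
    have h1 := (hu default).2
    exact weightedMarcinkiewiczEps_span_singleton hq0 hε.1 (u default) h1 hm
  · obtain ⟨m₀, L, h1, h2, h3, h4, h5⟩ := h N m hN hCm
    exact weightedMarcinkiewiczEps_span hq hε.1 hε.2 (by omega) (fun j => (hu j).1.measurable)
      (fun j => (hu j).2) h1 h2 h3 h4 h5
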